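/- Conventions. All manifolds are smooth and Hausdorff, with (possibly empty) smooth boundary; Lorentzian metrics are smooth of signature $(-,+,\dots,+)$. For a time-oriented Lorentzian manifold $\overline M$ with boundary $\partial\overline M$, let $\partial T\overline M$ be the restriction of $T\overline M$ to $\partial\overline M$. Geodesics are defined on nondegenerate compact intervals and may meet $\partial\overline M$ arbitrarily often; lightlike vectors are nonzero; causal and timelike curves are piecewise smooth. $\overline M$ is *strongly causal* if every neighborhood of every point contains a neighborhood of that point which no causal curve intersects twice (i.e. which every causal curve meets in a connected set of parameters). A set is *achronal* if no two of its points are joined by a timelike curve. The *broken* (resp. *unbroken*) *lightlike scattering data* of $\overline M$ is the set of pairs $(\xi,\eta)\in\partial T\overline M\times\partial T\overline M$ of future-directed lightlike vectors such that a geodesic starting with $\xi$ intersects a geodesic ending with $\eta$ (resp. such that there is a geodesic starting with $\xi$ and ending with $\eta$). The *past sky shadow* of $p\in\overline M$ is the set of $\eta\in\partial T\overline M$ such that $\eta$ or $-\eta$ is the initial velocity of a future-directed lightlike geodesic through $p$. The *past sky shadow data* of $\overline M$ is the set of past sky shadows of points in the interior of $\overline M$. Two vectors $\xi,\xi'\in\partial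 T\overline M$ *intersect* if there are future-directed lightlike geodesics with initial velocities $\pm\xi$ and $\pm\xi'$ which have a point in common. Theorem. Let $(\overline M_1,g_1)$ and $(\overline M_2,g_2)$ be strongly causal, compact, time-oriented Lorentzian manifolds with boundary, of the same dimension $n\ge 3$. Suppose that in each of them no two points are connected by two different lightlike geodesics (as unparametrized curves) and all lightlike geodesics are achronal. (1) Let $\Phi\colon\partial T\overline M_1\to\partial T\overline M_2$ be an isomorphism of smooth vector bundles which is conformal (i.e. at each point of $\partial\overline M_1$, $\Phi^*g_2$ is a positive multiple of $g_1$) and maps $T\partial\overline M_1$ onto $T\partial\overline M_2$. If $\Phi$ identifies the broken lightlike scattering data of $\overline M_1$ with that of $\overline M_2$, and the unbroken lightlike scattering data of $\overline M_1$ with that of $\overline M_2$, then $\Phi$ identifies the past sky shadow data of $\overline M_1$ with that of $\overline M_2$. In particular, if $\overline M_1$ and $\overline M_2$ have isomorphic broken and unbroken lightlike scattering data, then they have isomorphic past sky shadow data. (2) For $\overline M=\overline M_1$ (and likewise $\overline M_2$), the past sky shadow of each interior point is a maximal set of pairwise intersecting vectors of $\partial T\overline M$ (maximal under inclusion, each vector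 also being required to intersect itself). If moreover no lightlike geodesic is orthogonal to $T_p\partial\overline M$ at a boundary point $p$, then the nonempty maximal sets of pairwise intersecting vectors of $\partial T\overline M$ are exactly the past sky shadows of the points of $\overline M$ (interior points and boundary points). -/

import Mathlib

open Set Topology
open scoped Manifold ContDiff

noncomputable section

namespace LightlikeScattering

section Local

variable {n : ℕ} [NeZero n]
  {M : Type*} [TopologicalSpace M] [ChartedSpace (EuclideanHalfSpace n) M]
  [IsManifold (𝓡∂ n) ∞ M]

/-! ### Time-oriented Lorentzian manifolds with boundary -/

variable (n M) in
/-- A smooth Lorentzian metric, of signature `(-, +, …, +)`, on a manifold with boundary. -/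
structure LorentzMetric where
  /-- The bilinear form on each tangent space. -/
  val : ∀ p : M, TangentSpace (𝓡∂ n) p →L[ℝ] TangentSpace (𝓡∂ n) p →L[ℝ] ℝ
  symm : ∀ p (v w : TangentSpace (𝓡∂ n) p), val p v w = val p w v
  lorentzian : ∀ p, ∃ t : TangentSpace (𝓡∂ n) p, val p t t < 0 ∧
    ∀ v : TangentSpace (𝓡∂ n) p, val p t v = 0 → v ≠ 0 → 0 < val p v v
  contMDiff : ContMDiff (𝓡∂ n) ((𝓡∂ n).prod
      𝓘(ℝ, EuclideanSpace ℝ (Fin n) →L[ℝ] EuclideanSpace ℝ (Fin n) →L[ℝ] ℝ)) ∞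
    (fun p ↦ Bundle.TotalSpace.mk'
      (EuclideanSpace ℝ (Fin n) →L[ℝ] EuclideanSpace ℝ (Fin n) →L[ℝ] ℝ) p (val p))

/-- A time-orientation, given by a smooth timelike vector field. -/
structure TimeOrientation (g : LorentzMetric n M) where
  /-- The vector field; it is declared to be future-directed. -/
  field : ∀ p : M, TangentSpace (𝓡∂ n) p
  timelike : ∀ p, g.val p (field p) (field p) < 0
  contMDiff : ContMDiff (𝓡∂ n) (𝓡∂ n).tangent ∞
    (fun p ↦ (⟨p, field p⟩ : TangentBundle (𝓡∂ n) M))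

/-- The set of lightlike tangent vectors; they are nonzero by definition. -/
def lightlike (g : LorentzMetric n M) : Set (TangentBundle (𝓡∂ n) M) :=
  {v | v.2 ≠ 0 ∧ g.val v.1 v.2 v.2 = 0}

/-- The set of future-directed lightlike tangent vectors. -/
def futureLightlike {g : LorentzMetric n M} (T : TimeOrientation g) :
    Set (TangentBundle (𝓡∂ n) M) :=
  {v | v ∈ lightlike g ∧ g.val v.1 v.2 (T.field v.1) < 0}

/-- The set of future-directed timelike tangent vectors. -/
def futureTimelike {g : LorentzMetric n M} (T : TimeOrientation g) :
    Set (TangentBundle (𝓡∂ n) M) :=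
  {v | g.val v.1 v.2 v.2 < 0 ∧ g.val v.1 v.2 (T.field v.1) < 0}

/-- The set of future-directed causal (that is, timelike or lightlike) tangent vectors. -/
def futureCausal {g : LorentzMetric n M} (T : TimeOrientation g) :
    Set (TangentBundle (𝓡∂ n) M) :=
  futureTimelike T ∪ futureLightlike T

/-! ### Curves and causality -/

/-- The velocity at time `t` of a curve defined on `[a, b]` (one-sided at the endpoints). -/
def velocity (γ : ℝ → M) (a b t : ℝ) : TangentBundle (𝓡∂ n) M :=
  ⟨γ t, mfderivWithin 𝓘(ℝ, ℝ) (𝓡∂ n) γ (Icc a b) t (1 : ℝ)⟩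

/-- `γ` restricted to `[a, b]` is a piecewise smooth curve whose velocity vectors (one-sided at the
breakpoints) all belong to `P`. -/
def IsPiecewiseCurve (P : Set (TangentBundle (𝓡∂ n) M)) (γ : ℝ → M) (a b : ℝ) : Prop :=
  a < b ∧ ContinuousOn γ (Icc a b) ∧ ∃ (N : ℕ) (τ : ℕ → ℝ), τ 0 = a ∧ τ N = b ∧
    ∀ i < N, τ i < τ (i + 1) ∧
      ContMDiffOn 𝓘(ℝ, ℝ) (𝓡∂ n) ∞ γ (Icc (τ i) (τ (i + 1))) ∧
      ∀ t ∈ Icc (τ i) (τ (i + 1)), velocity γ (τ i) (τ (i + 1)) t ∈ P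

/-- Strong causality: each point has arbitrarily small neighborhoods which no causal curve
intersects twice, that is, which every causal curve meets in a connected set of times. -/
def StronglyCausal {g : LorentzMetric n M} (T : TimeOrientation g) : Prop :=
  ∀ p : M, ∀ U ∈ 𝓝 p, ∃ V ∈ 𝓝 p, V ⊆ U ∧
    ∀ (γ : ℝ → M) (a b : ℝ), IsPiecewiseCurve (futureCausal T) γ a b →
      (Icc a b ∩ γ ⁻¹' V).OrdConnected

/-- There is a future-directed timelike curve from `p` to `q`. -/
def Chronological {g : LorentzMetric n M} (T : TimeOrientation g) (p q : M) : Prop :=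
  ∃ (γ : ℝ → M) (a b : ℝ), IsPiecewiseCurve (futureTimelike T) γ a b ∧ γ a = p ∧ γ b = q

/-- A set is achronal if no timelike curve joins two of its points. -/
def Achronal {g : LorentzMetric n M} (T : TimeOrientation g) (A : Set M) : Prop :=
  ∀ p ∈ A, ∀ q ∈ A, ¬ Chronological T p q

/-! ### Geodesics -/

/-- The coordinate frame at the point with coordinates `y` in the chart at `x₀`: it sends `u` to the
coordinate vector `∂_u`. -/
def coordFrame (x₀ : M) (y : EuclideanSpace ℝ (Fin n)) : EuclideanSpace ℝ (Fin n) →L[ℝ]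
    TangentSpace (𝓡∂ n) ((extChartAt (𝓡∂ n) x₀).symm y) :=
  mfderivWithin 𝓘(ℝ, EuclideanSpace ℝ (Fin n)) (𝓡∂ n) (extChartAt (𝓡∂ n) x₀).symm
    (range (𝓡∂ n)) y

/-- The coordinate expression of the metric in the chart at `x₀`: the components
`g (∂_u, ∂_v)` at the point with coordinates `y`. -/
def metricInChart (g : LorentzMetric n M) (x₀ : M) (u v y : EuclideanSpace ℝ (Fin n)) : ℝ :=
  g.val ((extChartAt (𝓡∂ n) x₀).symm y) (coordFrame x₀ y u) (coordFrame x₀ y v)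

/-- The derivative of `g (∂_u, ∂_v)` in direction `∂_w`, at the point with coordinates `y`. -/
def metricDeriv (g : LorentzMetric n M) (x₀ : M) (w u v y : EuclideanSpace ℝ (Fin n)) : ℝ :=
  fderivWithin ℝ (metricInChart g x₀ u v) (range (𝓡∂ n)) y w

/-- Christoffel symbols of the first kind of the Levi-Civita connection in the chart at `x₀`:
`g (∇_{∂_u} ∂_v, ∂_w) = (∂_u g(v, w) + ∂_v g(u, w) - ∂_w g(u, v)) / 2`. -/
def christoffel (g : LorentzMetric n M) (x₀ : M) (u v w y : EuclideanSpace ℝ (Fin n)) : ℝ :=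
  (metricDeriv g x₀ u v w y + metricDeriv g x₀ v u w y - metricDeriv g x₀ w u v y) / 2

/-- `γ` restricted to the nondegenerate interval `[a, b]` is a geodesic: it is smooth, and in every
chart its coordinate expression `c` satisfies `g (∇_{c'} c', w) = 0` for all `w`. The curve may
meet the boundary at any times. -/
def IsGeodesic (g : LorentzMetric n M) (γ : ℝ → M) (a b : ℝ) : Prop :=
  a < b ∧ ContMDiffOn 𝓘(ℝ, ℝ) (𝓡∂ n) ∞ γ (Icc a b) ∧
    ∀ x₀ : M, ∀ t ∈ Icc a b, γ t ∈ (extChartAt (𝓡∂ n) x₀).source →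
      let c : ℝ → EuclideanSpace ℝ (Fin n) := fun s ↦ extChartAt (𝓡∂ n) x₀ (γ s)
      let c' : ℝ → EuclideanSpace ℝ (Fin n) := derivWithin c (Icc a b)
      let c'' : ℝ → EuclideanSpace ℝ (Fin n) := derivWithin c' (Icc a b)
      ∀ w : EuclideanSpace ℝ (Fin n),
        metricInChart g x₀ (c'' t) w (c t) + christoffel g x₀ (c' t) (c' t) w (c t) = 0

/-- A lightlike geodesic, future- or past-directed. -/
def IsLightlikeGeodesic (g : LorentzMetric n M) (γ : ℝ → M) (a b : ℝ) : Prop :=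
  IsGeodesic g γ a b ∧ ∀ t ∈ Icc a b, velocity γ a b t ∈ lightlike g

/-- A future-directed lightlike geodesic. -/
def IsFutureLightlikeGeodesic {g : LorentzMetric n M} (T : TimeOrientation g)
    (γ : ℝ → M) (a b : ℝ) : Prop :=
  IsGeodesic g γ a b ∧ ∀ t ∈ Icc a b, velocity γ a b t ∈ futureLightlike T

/-- No two points are connected by two lightlike geodesics which are different as unparametrized
curves. -/
def NoRefocusing (g : LorentzMetric n M) : Prop :=
  ∀ (γ σ : ℝ → M) (a b c d : ℝ), IsLightlikeGeodesic g γ a b → IsLightlikeGeodesic g σ c d →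
    γ a = σ c → γ b = σ d → γ '' Icc a b = σ '' Icc c d

/-- All lightlike geodesics are achronal. -/
def LightlikeGeodesicsAchronal {g : LorentzMetric n M} (T : TimeOrientation g) : Prop :=
  ∀ (γ : ℝ → M) (a b : ℝ), IsLightlikeGeodesic g γ a b → Achronal T (γ '' Icc a b)

/-! ### The boundary -/

variable (n M) in
/-- The restriction of the tangent bundle to the boundary: all tangent vectors of the manifold
(not only those tangent to the boundary) which are based at boundary points. -/
def boundaryTangent : Set (TangentBundle (𝓡∂ n) M) :=
  {v | v.1 ∈ (𝓡∂ n).boundary M}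

/-- The tangent space of the boundary at a boundary point `p`: the vectors along which the
coordinate which defines the boundary has derivative zero. -/
def tangentToBoundary (p : M) : Set (TangentSpace (𝓡∂ n) p) :=
  {v | let u : EuclideanSpace ℝ (Fin n) :=
        mfderiv (𝓡∂ n) 𝓘(ℝ, EuclideanSpace ℝ (Fin n)) (extChartAt (𝓡∂ n) p) p v
      u 0 = 0}

/-- No lightlike geodesic is orthogonal to the boundary at a boundary point. (Such a geodesic would
be tangent to the boundary at a point where the metric of the boundary is degenerate.) -/
def NoLightlikeGeodesicNormalToBoundary (g : LorentzMetric n M) : Prop :=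
  ∀ (γ : ℝ → M) (a b : ℝ), IsLightlikeGeodesic g γ a b →
    ∀ t ∈ Icc a b, γ t ∈ (𝓡∂ n).boundary M →
      ∃ w ∈ tangentToBoundary (γ t), g.val (γ t) (velocity γ a b t).2 w ≠ 0

/-! ### Scattering data and sky shadows -/

/-- The broken lightlike scattering data: pairs of future-directed lightlike vectors `ξ`, `η` at
the boundary such that the geodesic starting with `ξ` intersects the geodesic ending with `η`. -/
def brokenData {g : LorentzMetric n M} (T : TimeOrientation g) :
    Set (TangentBundle (𝓡∂ n) M × TangentBundle (𝓡∂ n) M) :=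
  {x | x.1 ∈ boundaryTangent n M ∧ x.2 ∈ boundaryTangent n M ∧
    ∃ (γ σ : ℝ → M) (a b c d : ℝ),
      IsFutureLightlikeGeodesic T γ a b ∧ velocity γ a b a = x.1 ∧
      IsFutureLightlikeGeodesic T σ c d ∧ velocity σ c d d = x.2 ∧
      (γ '' Icc a b ∩ σ '' Icc c d).Nonempty}

/-- The unbroken lightlike scattering data: pairs of future-directed lightlike vectors `ξ`, `η` at
the boundary such that there is a geodesic starting with `ξ` and ending with `η`. -/
def unbrokenData {g : LorentzMetric n M} (T : TimeOrientation g) :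
    Set (TangentBundle (𝓡∂ n) M × TangentBundle (𝓡∂ n) M) :=
  {x | x.1 ∈ boundaryTangent n M ∧ x.2 ∈ boundaryTangent n M ∧
    ∃ (γ : ℝ → M) (a b : ℝ), IsFutureLightlikeGeodesic T γ a b ∧
      velocity γ a b a = x.1 ∧ velocity γ a b b = x.2}

/-- The future-directed lightlike geodesic `γ` on `[a, b]` starts with `η` or with `-η`. -/
def StartsWith {g : LorentzMetric n M} (T : TimeOrientation g) (η : TangentBundle (𝓡∂ n) M)
    (γ : ℝ → M) (a b : ℝ) : Prop :=
  IsFutureLightlikeGeodesic T γ a b ∧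
    (velocity γ a b a = η ∨ velocity γ a b a = ⟨η.1, -η.2⟩)

/-- The past sky shadow of `p`: the vectors `η` at the boundary such that `η` or `-η` is the initial
velocity of a future-directed lightlike geodesic through `p`. -/
def pastSkyShadow {g : LorentzMetric n M} (T : TimeOrientation g) (p : M) :
    Set (TangentBundle (𝓡∂ n) M) :=
  {η | η ∈ boundaryTangent n M ∧
    ∃ (γ : ℝ → M) (a b : ℝ), StartsWith T η γ a b ∧ p ∈ γ '' Icc a b}

/-- The past sky shadow data: the set of past sky shadows of interior points. -/
def pastSkyShadowData {g : LorentzMetric n M} (T : TimeOrientation g) :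
    Set (Set (TangentBundle (𝓡∂ n) M)) :=
  pastSkyShadow T '' (𝓡∂ n).interior M

/-- `ξ` and `ξ'` are vectors at the boundary, and there are future-directed lightlike geodesics with
initial velocities `±ξ` and `±ξ'` which intersect. -/
def Intersecting {g : LorentzMetric n M} (T : TimeOrientation g)
    (ξ ξ' : TangentBundle (𝓡∂ n) M) : Prop :=
  ξ ∈ boundaryTangent n M ∧ ξ' ∈ boundaryTangent n M ∧
    ∃ (γ σ : ℝ → M) (a b c d : ℝ), StartsWith T ξ γ a b ∧ StartsWith T ξ' σ c d ∧
      (γ '' Icc a b ∩ σ '' Icc c d).Nonempty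

/-- `A` is maximal, with respect to inclusion, among the sets of pairwise intersecting vectors. -/
def IsMaximalIntersecting {g : LorentzMetric n M} (T : TimeOrientation g)
    (A : Set (TangentBundle (𝓡∂ n) M)) : Prop :=
  Maximal (fun S ↦ ∀ ξ ∈ S, ∀ ξ' ∈ S, Intersecting T ξ ξ') A

end Local

section Comparison

variable {n : ℕ} [NeZero n]
  {M₁ : Type*} [TopologicalSpace M₁] [ChartedSpace (EuclideanHalfSpace n) M₁]
  [IsManifold (𝓡∂ n) ∞ M₁]
  {M₂ : Type*} [TopologicalSpace M₂] [ChartedSpace (EuclideanHalfSpace n) M₂]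
  [IsManifold (𝓡∂ n) ∞ M₂]

/-- A conformal isomorphism between the restrictions to the boundaries of the tangent bundles, as
smooth vector bundles with Lorentzian metrics, which identifies the tangent bundles of the
boundaries. The values of the maps outside of the boundaries are irrelevant. -/
structure ConformalBoundaryIso (g₁ : LorentzMetric n M₁) (g₂ : LorentzMetric n M₂) where
  /-- The map of total spaces, with its inverse. -/
  toPartialEquiv : PartialEquiv (TangentBundle (𝓡∂ n) M₁) (TangentBundle (𝓡∂ n) M₂)
  source_eq : toPartialEquiv.source = boundaryTangent n M₁
  target_eq : toPartialEquiv.target = boundaryTangent n M₂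
  contMDiffOn : ContMDiffOn (𝓡∂ n).tangent (𝓡∂ n).tangent ∞ toPartialEquiv
    (boundaryTangent n M₁)
  contMDiffOn_symm : ContMDiffOn (𝓡∂ n).tangent (𝓡∂ n).tangent ∞ toPartialEquiv.symm
    (boundaryTangent n M₂)
  /-- The map of base spaces. -/
  base : M₁ → M₂
  /-- The linear maps of fibers. -/
  fiber : ∀ p : M₁, TangentSpace (𝓡∂ n) p →ₗ[ℝ] TangentSpace (𝓡∂ n) (base p)
  map_eq : ∀ v ∈ boundaryTangent n M₁, toPartialEquiv v = ⟨base v.1, fiber v.1 v.2⟩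
  conformal : ∀ p ∈ (𝓡∂ n).boundary M₁, ∃ r : ℝ, 0 < r ∧
    ∀ v w : TangentSpace (𝓡∂ n) p,
      g₂.val (base p) (fiber p v) (fiber p w) = r * g₁.val p v w
  map_tangent : ∀ p ∈ (𝓡∂ n).boundary M₁, ∀ v : TangentSpace (𝓡∂ n) p,
    fiber p v ∈ tangentToBoundary (base p) ↔ v ∈ tangentToBoundary p

variable {g₁ : LorentzMetric n M₁} {g₂ : LorentzMetric n M₂}

/-- The isomorphism identifies the broken lightlike scattering data. -/
def ConformalBoundaryIso.IdentifiesBroken (Φ : ConformalBoundaryIso g₁ g₂)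
    (T₁ : TimeOrientation g₁) (T₂ : TimeOrientation g₂) : Prop :=
  Prod.map Φ.toPartialEquiv Φ.toPartialEquiv '' brokenData T₁ = brokenData T₂

/-- The isomorphism identifies the unbroken lightlike scattering data. -/
def ConformalBoundaryIso.IdentifiesUnbroken (Φ : ConformalBoundaryIso g₁ g₂)
    (T₁ : TimeOrientation g₁) (T₂ : TimeOrientation g₂) : Prop :=
  Prod.map Φ.toPartialEquiv Φ.toPartialEquiv '' unbrokenData T₁ = unbrokenData T₂

/-- The isomorphism identifies the past sky shadow data. -/
def ConformalBoundaryIso.IdentifiesShadows (Φ : ConformalBoundaryIso g₁ g₂)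
    (T₁ : TimeOrientation g₁) (T₂ : TimeOrientation g₂) : Prop :=
  (fun S ↦ Φ.toPartialEquiv '' S) '' pastSkyShadowData T₁ = pastSkyShadowData T₂

end Comparison

end LightlikeScattering

end

open LightlikeScattering

noncomputable section

open Filter Bundle
open scoped NNReal

namespace LightlikeScattering

set_option linter.unusedSectionVars false

/-! Geodesics are treated as integral curves of the geodesic spray in coordinates (`IsIntegral`),
and a future-directed lightlike geodesic is recorded by its initial and final velocities (`Flow`,
`Le`). At the boundary a solution need not exist in either direction. What remains is uniqueness
(`Flow.unique`), passage to limits (`exists_local_flow_limit`) and, by compactness and strong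
causality, the existence of a last vector on each geodesic (`exists_maximal_flow`). Without closed
causal curves and without refocusing, two lightlike geodesics with two common points agree
(`Cmp.par_of_base`).

The shadow of an interior point `q` is maximal for a topological reason. Suppose a geodesic meets
every lightlike geodesic through `q` but misses `q`. A circle of lightlike directions at `q`,
available since `n ≥ 3`, then yields nonempty, pairwise disjoint intervals in its parameter
interval, depending on the direction with closed graph. For each direction, all the others must lie
on the same side of its interval, which fails for the middle one of three
(`exists_le_of_forall_meet`, `not_exists_disjoint_intervals`).

The second tool is the absence of lightlike triangles (`not_triangle`). Some vertex is entered along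
one side and left along another. Cutting this corner gives a short timelike curve, whose ends can be
pushed along the two sides; so two points of the third side are chronologically related, against
achronality. Pushing needs a sideways displacement which stays in the manifold, hence at boundary
points a tangential direction not orthogonal to the geodesic (`push_local`); this is the role of the
assumption on geodesics normal to the boundary. Consequently a geodesic which meets two different
geodesics through a point passes through that point (`base_eq_of_meet`). This gives the description
of maximal sets (`isMaximalIntersecting_iff`), except when no two geodesics of the set cross; then
they all run into the same end.

For the comparison, a chord is the part of a geodesic between consecutive boundary vectors around an
interior point. Unbroken data carry chords to chords, and broken data make the images of two chords
through `q` meet at an interior point (`DataIso.exists_meet`). No boundary point lies inside a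
chord, so the triangle lemma applies without any assumption at the boundary, and all image chords
pass through a single point `p`. Hence the shadow of `q` is mapped into that of `p`. The same holds
for the inverse map, and maximality gives equality (`DataIso.exists_image_eq`). -/

/-- The model vector space of an `n`-dimensional manifold. -/
abbrev Vec (n : ℕ) := EuclideanSpace ℝ (Fin n)

/-- On `t` the derivatives within `s` and within `t` coincide, because `t` is a neighborhood within
`s` of each of its points. Christoffel symbols are derivatives within the whole half-space, while
the metric is smooth only on the chart target. -/
theorem contDiffOn_fderivWithin_apply {E F Z : Type*} [NormedAddCommGroup E] [NormedSpace ℝ E]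
    [NormedAddCommGroup F] [NormedSpace ℝ F] [NormedAddCommGroup Z] [NormedSpace ℝ Z]
    {f : E → F} {s t : Set E} {a b : Z → E} {u : Set Z} (hf : ContDiffOn ℝ ∞ f t)
    (ht : UniqueDiffOn ℝ t) (hs : UniqueDiffOn ℝ s)
    (hst : t ⊆ s) (hts : ∀ y ∈ t, t ∈ 𝓝[s] y) (ha : ContDiffOn ℝ ∞ a u)
    (hb : ContDiffOn ℝ ∞ b u) (hau : MapsTo a u t) :
    ContDiffOn ℝ ∞ (fun z ↦ fderivWithin ℝ f s (a z) (b z)) u := by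
  have hD : ContDiffOn ℝ ∞ (fderivWithin ℝ f s) t := by
    refine (hf.fderivWithin (m := ∞) ht (by simp)).congr fun y hy ↦ ?_
    exact (fderivWithin_of_mem_nhdsWithin (hts y hy) (hs y (hst hy))
      ((hf y hy).differentiableWithinAt (by simp)))
  exact (hD.comp ha hau).clm_apply hb

theorem contDiffOn_inverse_apply {E F Z : Type*} [NormedAddCommGroup E] [NormedSpace ℝ E]
    [CompleteSpace E] [NormedAddCommGroup F] [NormedSpace ℝ F]
    [NormedAddCommGroup Z] [NormedSpace ℝ Z] {G : Z → E →L[ℝ] F} {b : Z → F} {u : Set Z}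
    (hG : ContDiffOn ℝ ∞ G u) (hinv : ∀ z ∈ u, (G z).IsInvertible) (hb : ContDiffOn ℝ ∞ b u) :
    ContDiffOn ℝ ∞ (fun z ↦ (G z).inverse (b z)) u := by
  have h : ContDiffOn ℝ ∞ (fun z ↦ (G z).inverse) u := fun z hz ↦
    ((hinv z hz).contDiffAt_map_inverse).comp_contDiffWithinAt z (hG z hz)
  exact h.clm_apply hb

/-! ### Charts, coordinates of tangent vectors, and the geodesic spray -/

section Charts

variable {n : ℕ} [NeZero n]
  {M : Type*} [TopologicalSpace M] [ChartedSpace (EuclideanHalfSpace n) M]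

/-- The value of the metric at a point, as a bilinear form on the model space. -/
def LorentzMetric.form [IsManifold (𝓡∂ n) ∞ M] (g : LorentzMetric n M) (p : M) :
    Vec n →L[ℝ] Vec n →L[ℝ] ℝ := g.val p

/-- The derivative of the chart at `x₀`, as an endomorphism of the model space. -/
def chartDeriv (x₀ p : M) : Vec n →L[ℝ] Vec n :=
  mfderiv (𝓡∂ n) 𝓘(ℝ, EuclideanSpace ℝ (Fin n)) (extChartAt (𝓡∂ n) x₀) p

/-- The coordinate frame, as an endomorphism of the model space. -/
def frame (x₀ : M) (y : Vec n) : Vec n →L[ℝ] Vec n := coordFrame x₀ y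

/-- The tangent vector at a given point with given components. -/
def tvec (p : M) (v : Vec n) : TangentBundle (𝓡∂ n) M := ⟨p, v⟩

/-- The components of a tangent vector with respect to the fiber of the tangent bundle. -/
def vecOf (v : TangentBundle (𝓡∂ n) M) : Vec n := v.2

/-- The coordinates of a tangent vector in the chart at `x₀`. -/
def coords (x₀ : M) (v : TangentBundle (𝓡∂ n) M) : Vec n × Vec n :=
  (extChartAt (𝓡∂ n) x₀ v.1, chartDeriv x₀ v.1 (vecOf v))

/-- The tangent vector with given coordinates in the chart at `x₀`. -/
def ofCoords (x₀ : M) (z : Vec n × Vec n) : TangentBundle (𝓡∂ n) M :=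
  tvec ((extChartAt (𝓡∂ n) x₀).symm z.1) (frame x₀ z.1 z.2)

/-- The set of coordinates in the half-space. -/
abbrev halfSpace (n : ℕ) [NeZero n] : Set (Vec n) := range (𝓡∂ n)

theorem halfSpace_eq (n : ℕ) [NeZero n] : halfSpace n = {y : Vec n | 0 ≤ y 0} := by
  exact range_modelWithCornersEuclideanHalfSpace n

theorem mem_halfSpace {y : Vec n} : y ∈ halfSpace n ↔ 0 ≤ y 0 := by
  rw [halfSpace_eq]; rfl

theorem convex_halfSpace (n : ℕ) [NeZero n] : Convex ℝ (halfSpace n) := by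
  exact (𝓡∂ n).convex_range

theorem isClosed_halfSpace (n : ℕ) [NeZero n] : IsClosed (halfSpace n) := (𝓡∂ n).isClosed_range

variable [IsManifold (𝓡∂ n) ∞ M]

theorem chartDeriv_frame (x₀ : M) {y : Vec n} (hy : y ∈ (extChartAt (𝓡∂ n) x₀).target)
    (v : Vec n) : chartDeriv x₀ ((extChartAt (𝓡∂ n) x₀).symm y) (frame x₀ y v) = v :=
  DFunLike.congr_fun (mfderiv_extChartAt_comp_mfderivWithin_extChartAt_symm (I := 𝓡∂ n) hy) v

theorem frame_chartDeriv (x₀ : M) {p : M} (hp : p ∈ (extChartAt (𝓡∂ n) x₀).source)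
    (v : Vec n) : frame x₀ (extChartAt (𝓡∂ n) x₀ p) (chartDeriv x₀ p v) = v :=
  DFunLike.congr_fun (mfderivWithin_extChartAt_symm_comp_mfderiv_extChartAt' (I := 𝓡∂ n) hp) v

theorem chartDeriv_self (p : M) (v : Vec n) : chartDeriv p p v = v :=
  DFunLike.congr_fun (mfderiv_extChartAt_self (I := 𝓡∂ n) (x := p)) v

theorem coords_ofCoords (x₀ : M) {z : Vec n × Vec n}
    (hz : z.1 ∈ (extChartAt (𝓡∂ n) x₀).target) : coords x₀ (ofCoords x₀ z) = z := by
  refine Prod.ext ?_ ?_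
  · exact (extChartAt (𝓡∂ n) x₀).right_inv hz
  · exact chartDeriv_frame x₀ hz z.2

theorem ofCoords_coords (x₀ : M) {v : TangentBundle (𝓡∂ n) M}
    (hv : v.1 ∈ (extChartAt (𝓡∂ n) x₀).source) : ofCoords x₀ (coords x₀ v) = v := by
  have h1 : (extChartAt (𝓡∂ n) x₀).symm (extChartAt (𝓡∂ n) x₀ v.1) = v.1 :=
    (extChartAt (𝓡∂ n) x₀).left_inv hv
  have h2 := frame_chartDeriv x₀ hv (vecOf v)
  obtain ⟨p, v⟩ := v
  simp only [ofCoords, coords] at h1 h2 ⊢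
  rw [h1, h2]
  rfl

/-- Links the explicit coordinates with the bundle topology, so that `coords` and `ofCoords` inherit
continuity from the trivialization. -/
theorem coords_eq_trivialization (x₀ : M) {v : TangentBundle (𝓡∂ n) M}
    (hv : v.1 ∈ (extChartAt (𝓡∂ n) x₀).source) :
    (trivializationAt (Vec n) (TangentSpace (𝓡∂ n)) x₀ v).2 = (coords x₀ v).2 := by
  rw [extChartAt_source] at hv
  have h := TangentBundle.continuousLinearMapAt_trivializationAt (I := 𝓡∂ n) hv
  have h2 := DFunLike.congr_fun h v.2
  refine Eq.trans ?_ h2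
  rw [Trivialization.continuousLinearMapAt_apply, Trivialization.linearMapAt_apply, if_pos]
  simpa using hv

theorem continuousOn_coords (x₀ : M) :
    ContinuousOn (coords (n := n) x₀)
      {v : TangentBundle (𝓡∂ n) M | v.1 ∈ (extChartAt (𝓡∂ n) x₀).source} := by
  set e := trivializationAt (Vec n) (TangentSpace (𝓡∂ n)) x₀ with he
  have h1 : ContinuousOn (fun v : TangentBundle (𝓡∂ n) M ↦ (extChartAt (𝓡∂ n) x₀ v.1, (e v).2))
      {v : TangentBundle (𝓡∂ n) M | v.1 ∈ (extChartAt (𝓡∂ n) x₀).source} := by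
    refine ContinuousOn.prodMk ?_ ?_
    · exact (continuousOn_extChartAt x₀).comp
        (FiberBundle.continuous_proj (Vec n) (TangentSpace (𝓡∂ n))).continuousOn (fun v hv ↦ hv)
    · refine continuous_snd.comp_continuousOn (e.continuousOn.mono ?_)
      intro v hv
      rw [e.source_eq]
      simpa [he, extChartAt_source] using hv
  exact h1.congr fun v hv ↦ Prod.ext rfl (coords_eq_trivialization x₀ hv).symm

theorem continuousOn_ofCoords (x₀ : M) :
    ContinuousOn (ofCoords (n := n) x₀) {z | z.1 ∈ (extChartAt (𝓡∂ n) x₀).target} := by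
  set e := trivializationAt (Vec n) (TangentSpace (𝓡∂ n)) x₀ with he
  have h1 : ContinuousOn (fun z : Vec n × Vec n ↦
      e.toOpenPartialHomeomorph.symm ((extChartAt (𝓡∂ n) x₀).symm z.1, z.2))
      {z | z.1 ∈ (extChartAt (𝓡∂ n) x₀).target} := by
    refine e.toOpenPartialHomeomorph.symm.continuousOn.comp ?_ ?_
    · exact ((continuousOn_extChartAt_symm x₀).comp continuous_fst.continuousOn
        (fun z hz ↦ hz)).prodMk continuous_snd.continuousOn
    · intro z hz
      have := (extChartAt (𝓡∂ n) x₀).map_target hz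
      rw [extChartAt_source] at this
      simpa [he, e.target_eq] using this
  refine h1.congr fun z hz ↦ ?_
  have hs := (extChartAt (𝓡∂ n) x₀).map_target hz
  have hc := coords_eq_trivialization x₀ (v := ofCoords x₀ z) hs
  rw [coords_ofCoords x₀ hz] at hc
  have hmem : ofCoords x₀ z ∈ e.source := by
    rw [e.source_eq]
    rw [extChartAt_source] at hs
    have : (ofCoords x₀ z).1 ∈ (chartAt (EuclideanHalfSpace n) x₀).source := hs
    simpa [he] using this
  have h3 : e (ofCoords x₀ z) = ((extChartAt (𝓡∂ n) x₀).symm z.1, z.2) := by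
    refine Prod.ext ?_ hc
    exact e.coe_fst hmem
  change ofCoords x₀ z = e.toOpenPartialHomeomorph.symm ((extChartAt (𝓡∂ n) x₀).symm z.1, z.2)
  rw [← h3]
  exact (e.toOpenPartialHomeomorph.left_inv hmem).symm

theorem isOpen_chartDomain (x₀ : M) :
    IsOpen {v : TangentBundle (𝓡∂ n) M | v.1 ∈ (extChartAt (𝓡∂ n) x₀).source} :=
  (isOpen_extChartAt_source x₀).preimage
    (FiberBundle.continuous_proj (Vec n) (TangentSpace (𝓡∂ n)))

theorem continuous_base : Continuous (fun v : TangentBundle (𝓡∂ n) M ↦ v.1) :=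
  FiberBundle.continuous_proj (Vec n) (TangentSpace (𝓡∂ n))

/-- The coordinate expression of the metric as a bilinear form. -/
def metricForm (g : LorentzMetric n M) (x₀ : M) (y : Vec n) : Vec n →L[ℝ] Vec n →L[ℝ] ℝ :=
  (g.form ((extChartAt (𝓡∂ n) x₀).symm y)).bilinearComp (frame x₀ y) (frame x₀ y)

theorem metricForm_apply (g : LorentzMetric n M) (x₀ : M) (y u v : Vec n) :
    metricForm g x₀ y u v = metricInChart g x₀ u v y := rfl

theorem metricForm_eq (g : LorentzMetric n M) (x₀ : M) (y u v : Vec n) :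
    metricForm g x₀ y u v =
      g.form ((extChartAt (𝓡∂ n) x₀).symm y) (frame x₀ y u) (frame x₀ y v) := rfl

theorem metricForm_symm (g : LorentzMetric n M) (x₀ : M) (y u v : Vec n) :
    metricForm g x₀ y u v = metricForm g x₀ y v u := g.symm _ _ _

theorem metricForm_coords (g : LorentzMetric n M) (x₀ : M) {p : M}
    (hp : p ∈ (extChartAt (𝓡∂ n) x₀).source) (u v : Vec n) :
    metricForm g x₀ (extChartAt (𝓡∂ n) x₀ p) (chartDeriv x₀ p u) (chartDeriv x₀ p v) =
      g.form p u v := by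
  rw [metricForm_eq, frame_chartDeriv x₀ hp, frame_chartDeriv x₀ hp,
    (extChartAt (𝓡∂ n) x₀).left_inv hp]

/-- The constant coordinate vector fields are smooth. -/
theorem contMDiffOn_frame (x₀ : M) (u : Vec n) :
    ContMDiffOn (𝓡∂ n) (𝓡∂ n).tangent ∞
      (fun p : M ↦ tvec p (frame x₀ (extChartAt (𝓡∂ n) x₀ p) u)) (chartAt (EuclideanHalfSpace n) x₀).source := by
  intro p hp
  refine ContMDiffAt.contMDiffWithinAt ?_
  have hb : p ∈ (trivializationAt (Vec n) (TangentSpace (𝓡∂ n) (M := M)) x₀).baseSet := by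
    simpa using hp
  refine ((trivializationAt (Vec n) (TangentSpace (𝓡∂ n) (M := M)) x₀).contMDiffAt_section_iff
    (IB := 𝓡∂ n) hb).2 ?_
  -- Read in the trivialization at `x₀`, a coordinate field is constant.
  refine (contMDiffAt_const (c := u)).congr_of_eventuallyEq ?_
  filter_upwards [(chartAt (EuclideanHalfSpace n) x₀).open_source.mem_nhds hp] with q hq
  rw [← extChartAt_source (𝓡∂ n)] at hq
  have := coords_eq_trivialization x₀ (v := tvec q (frame x₀ (extChartAt (𝓡∂ n) x₀ q) u)) hq
  refine this.trans ?_
  have h2 := chartDeriv_frame x₀ ((extChartAt (𝓡∂ n) x₀).map_source hq) u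
  rw [(extChartAt (𝓡∂ n) x₀).left_inv hq] at h2
  exact h2

theorem contDiffOn_of_contMDiffOn_source {F : Type*} [NormedAddCommGroup F] [NormedSpace ℝ F]
    (x₀ : M) {f : M → F}
    (hf : ContMDiffOn (𝓡∂ n) 𝓘(ℝ, F) ∞ f (chartAt (EuclideanHalfSpace n) x₀).source) :
    ContDiffOn ℝ ∞ (f ∘ (extChartAt (𝓡∂ n) x₀).symm) (extChartAt (𝓡∂ n) x₀).target := by
  rw [← contMDiffOn_iff_contDiffOn]
  refine hf.comp (contMDiffOn_extChartAt_symm x₀) ?_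
  intro y hy
  have := (extChartAt (𝓡∂ n) x₀).map_target hy
  rwa [extChartAt_source] at this

/-- In finite dimension it suffices that the values on fixed vectors are smooth, and these are
values of the metric on the smooth coordinate fields. -/
theorem contDiffOn_metricForm (g : LorentzMetric n M) (x₀ : M) :
    ContDiffOn ℝ ∞ (metricForm g x₀) (extChartAt (𝓡∂ n) x₀).target := by
  rw [contDiffOn_clm_apply]
  intro u
  rw [contDiffOn_clm_apply]
  intro v
  have h : ContMDiffOn (𝓡∂ n) 𝓘(ℝ, ℝ) ∞ (fun p : M ↦ g.form p
      (frame x₀ (extChartAt (𝓡∂ n) x₀ p) u) (frame x₀ (extChartAt (𝓡∂ n) x₀ p) v))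
      (chartAt (EuclideanHalfSpace n) x₀).source := by
    have h0 := g.contMDiff
    have h1 := contMDiffOn_frame x₀ u
    have h2 := contMDiffOn_frame x₀ v
    have h3 : ContMDiffOn (𝓡∂ n) ((𝓡∂ n).prod 𝓘(ℝ, ℝ)) ∞
      (fun m : M ↦ TotalSpace.mk' ℝ (E := Bundle.Trivial M ℝ) m (g.val m
        (frame x₀ (extChartAt (𝓡∂ n) x₀ m) u) (frame x₀ (extChartAt (𝓡∂ n) x₀ m) v)))
      (chartAt (EuclideanHalfSpace n) x₀).source := by
      apply ContMDiffOn.clm_bundle_apply₂ (F₁ := Vec n) (F₂ := Vec n)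
      · exact h0.contMDiffOn
      · exact h1
      · exact h2
    intro p hp
    have h4 := h3 p hp
    rw [contMDiffWithinAt_totalSpace] at h4
    exact h4.2
  refine (contDiffOn_of_contMDiffOn_source x₀ h).congr fun y hy ↦ ?_
  simp only [Function.comp]
  rw [(extChartAt (𝓡∂ n) x₀).right_inv hy]
  rfl

/-- The coordinate expression of the one-form which is dual to the time orientation. -/
def timeForm {g : LorentzMetric n M} (T : TimeOrientation g) (x₀ : M) (y : Vec n) :
    Vec n →L[ℝ] ℝ :=
  ((g.form ((extChartAt (𝓡∂ n) x₀).symm y)).flip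
    (T.field ((extChartAt (𝓡∂ n) x₀).symm y) : Vec n)).comp (frame x₀ y)

theorem timeForm_apply {g : LorentzMetric n M} (T : TimeOrientation g) (x₀ : M) (y u : Vec n) :
    timeForm T x₀ y u = g.form ((extChartAt (𝓡∂ n) x₀).symm y) (frame x₀ y u)
      (T.field ((extChartAt (𝓡∂ n) x₀).symm y) : Vec n) := rfl

theorem timeForm_coords {g : LorentzMetric n M} (T : TimeOrientation g) (x₀ : M) {p : M}
    (hp : p ∈ (extChartAt (𝓡∂ n) x₀).source) (u : Vec n) :
    timeForm T x₀ (extChartAt (𝓡∂ n) x₀ p) (chartDeriv x₀ p u) =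
      g.form p u (T.field p : Vec n) := by
  rw [timeForm_apply, frame_chartDeriv x₀ hp, (extChartAt (𝓡∂ n) x₀).left_inv hp]

theorem contDiffOn_timeForm {g : LorentzMetric n M} (T : TimeOrientation g) (x₀ : M) :
    ContDiffOn ℝ ∞ (timeForm T x₀) (extChartAt (𝓡∂ n) x₀).target := by
  rw [contDiffOn_clm_apply]
  intro u
  have h : ContMDiffOn (𝓡∂ n) 𝓘(ℝ, ℝ) ∞ (fun p : M ↦ g.form p
      (frame x₀ (extChartAt (𝓡∂ n) x₀ p) u) (T.field p : Vec n))
      (chartAt (EuclideanHalfSpace n) x₀).source := by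
    have h0 := g.contMDiff
    have h1 := contMDiffOn_frame x₀ u
    have h2 := T.contMDiff
    have h3 : ContMDiffOn (𝓡∂ n) ((𝓡∂ n).prod 𝓘(ℝ, ℝ)) ∞
      (fun m : M ↦ TotalSpace.mk' ℝ (E := Bundle.Trivial M ℝ) m (g.val m
        (frame x₀ (extChartAt (𝓡∂ n) x₀ m) u) (T.field m)))
      (chartAt (EuclideanHalfSpace n) x₀).source := by
      apply ContMDiffOn.clm_bundle_apply₂ (F₁ := Vec n) (F₂ := Vec n)
      · exact h0.contMDiffOn
      · exact h1
      · exact h2.contMDiffOn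
    intro p hp
    have h4 := h3 p hp
    rw [contMDiffWithinAt_totalSpace] at h4
    exact h4.2
  refine (contDiffOn_of_contMDiffOn_source x₀ h).congr fun y hy ↦ ?_
  simp only [Function.comp]
  rw [(extChartAt (𝓡∂ n) x₀).right_inv hy]
  rfl

theorem form_nondegenerate (g : LorentzMetric n M) (p : M) {v : Vec n}
    (hv : ∀ w : Vec n, g.form p v w = 0) : v = 0 := by
  obtain ⟨t, ht, hpos⟩ := g.lorentzian p
  by_contra hne
  have h1 : 0 < g.form p v v := hpos v (by
    have := hv t
    rwa [show g.form p v t = g.val p t v from g.symm p v t] at this) hne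
  exact absurd (hv v) h1.ne'

theorem frame_surjective (x₀ : M) {y : Vec n} (hy : y ∈ (extChartAt (𝓡∂ n) x₀).target)
    (w : Vec n) : ∃ v, frame x₀ y v = w := by
  refine ⟨chartDeriv x₀ ((extChartAt (𝓡∂ n) x₀).symm y) w, ?_⟩
  have := frame_chartDeriv x₀ ((extChartAt (𝓡∂ n) x₀).map_target hy) w
  rwa [(extChartAt (𝓡∂ n) x₀).right_inv hy] at this

theorem metricForm_nondegenerate (g : LorentzMetric n M) (x₀ : M) {y : Vec n}
    (hy : y ∈ (extChartAt (𝓡∂ n) x₀).target) {v : Vec n}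
    (hv : ∀ w, metricForm g x₀ y v w = 0) : v = 0 := by
  have h : frame x₀ y v = 0 := by
    refine form_nondegenerate g ((extChartAt (𝓡∂ n) x₀).symm y) fun w ↦ ?_
    obtain ⟨w, rfl⟩ := frame_surjective x₀ hy w
    exact hv w
  have := chartDeriv_frame x₀ hy v
  rw [h, map_zero] at this
  exact this.symm

/-- Nondegeneracy makes the map to the dual space injective, hence bijective by dimension. Inverting
it solves the geodesic equation for the acceleration. -/
theorem metricForm_isInvertible (g : LorentzMetric n M) (x₀ : M) {y : Vec n}
    (hy : y ∈ (extChartAt (𝓡∂ n) x₀).target) : (metricForm g x₀ y).IsInvertible := by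
  have hinj : Function.Injective (metricForm g x₀ y) := by
    rw [injective_iff_map_eq_zero]
    intro v hv
    exact metricForm_nondegenerate g x₀ hy fun w ↦ by rw [hv]; rfl
  have hdim : Module.finrank ℝ (Vec n) = Module.finrank ℝ (Vec n →L[ℝ] ℝ) := by
    rw [(LinearMap.toContinuousLinearMap (𝕜 := ℝ) (E := Vec n) (F' := ℝ)).symm.finrank_eq]
    exact (Subspace.dual_finrank_eq (K := ℝ) (V := Vec n)).symm
  refine ⟨(LinearEquiv.ofInjectiveOfFinrankEq
    (metricForm g x₀ y).toLinearMap hinj hdim).toContinuousLinearEquiv, ?_⟩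
  ext u v
  rfl

/-- The Christoffel symbols of the first kind, applied to `u, u`, as a linear form. -/
def christoffelForm (g : LorentzMetric n M) (x₀ : M) (y u : Vec n) : Vec n →L[ℝ] ℝ :=
  fderivWithin ℝ (metricForm g x₀) (halfSpace n) y u u -
    (2⁻¹ : ℝ) • ((fderivWithin ℝ (metricForm g x₀) (halfSpace n) y).flip u).flip u

theorem differentiableWithinAt_metricForm (g : LorentzMetric n M) (x₀ : M) {y : Vec n}
    (hy : y ∈ (extChartAt (𝓡∂ n) x₀).target) :
    DifferentiableWithinAt ℝ (metricForm g x₀) (halfSpace n) y :=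
  (((contDiffOn_metricForm g x₀) y hy).differentiableWithinAt (by simp)).mono_of_mem_nhdsWithin
    (extChartAt_target_mem_nhdsWithin_of_mem hy)

theorem metricDeriv_eq (g : LorentzMetric n M) (x₀ : M) {y : Vec n}
    (hy : y ∈ (extChartAt (𝓡∂ n) x₀).target) (w u v : Vec n) :
    metricDeriv g x₀ w u v y = fderivWithin ℝ (metricForm g x₀) (halfSpace n) y w u v := by
  have hu : UniqueDiffWithinAt ℝ (halfSpace n) y :=
    (𝓡∂ n).uniqueDiffOn y (extChartAt_target_subset_range x₀ hy)
  have h := (differentiableWithinAt_metricForm g x₀ hy).hasFDerivWithinAt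
  have h2 := (h.clm_apply (hasFDerivWithinAt_const u y _)).clm_apply
    (hasFDerivWithinAt_const v y _)
  have h3 := h2.fderivWithin hu
  have h4 : metricDeriv g x₀ w u v y =
    fderivWithin ℝ (fun y ↦ metricForm g x₀ y u v) (halfSpace n) y w := rfl
  rw [h4, h3]
  simp

theorem christoffel_eq (g : LorentzMetric n M) (x₀ : M) {y : Vec n}
    (hy : y ∈ (extChartAt (𝓡∂ n) x₀).target) (u w : Vec n) :
    christoffel g x₀ u u w y = christoffelForm g x₀ y u w := by
  rw [christoffel, metricDeriv_eq g x₀ hy, metricDeriv_eq g x₀ hy, christoffelForm]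
  simp
  ring

/-- The acceleration of the geodesic with given coordinates and velocity. -/
def acc (g : LorentzMetric n M) (x₀ : M) (y u : Vec n) : Vec n :=
  -(metricForm g x₀ y).inverse (christoffelForm g x₀ y u)

theorem metricForm_acc (g : LorentzMetric n M) (x₀ : M) {y : Vec n}
    (hy : y ∈ (extChartAt (𝓡∂ n) x₀).target) (u w : Vec n) :
    metricForm g x₀ y (acc g x₀ y u) w = -christoffelForm g x₀ y u w := by
  rw [acc, map_neg, (metricForm_isInvertible g x₀ hy).self_apply_inverse]
  rfl

theorem eq_acc (g : LorentzMetric n M) (x₀ : M) {y : Vec n}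
    (hy : y ∈ (extChartAt (𝓡∂ n) x₀).target) {u a : Vec n}
    (h : ∀ w, metricForm g x₀ y a w + christoffelForm g x₀ y u w = 0) : a = acc g x₀ y u := by
  rw [← sub_eq_zero]
  refine metricForm_nondegenerate g x₀ hy fun w ↦ ?_
  rw [map_sub]
  change metricForm g x₀ y a w - metricForm g x₀ y (acc g x₀ y u) w = 0
  rw [metricForm_acc g x₀ hy]
  linarith [h w]

/-- The geodesic spray in the chart at `x₀`. -/
def spray (g : LorentzMetric n M) (x₀ : M) (z : Vec n × Vec n) : Vec n × Vec n :=
  (z.2, acc g x₀ z.1 z.2)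

/-- The acceleration is the inverse metric applied to the Christoffel form, and inversion of linear
maps is smooth. -/
theorem contDiffOn_spray (g : LorentzMetric n M) (x₀ : M) :
    ContDiffOn ℝ ∞ (spray g x₀) ((extChartAt (𝓡∂ n) x₀).target ×ˢ univ) := by
  have hG := contDiffOn_metricForm g x₀
  have hfst : ContDiffOn ℝ ∞ (fun z : Vec n × Vec n ↦ z.1)
    ((extChartAt (𝓡∂ n) x₀).target ×ˢ univ) := contDiff_fst.contDiffOn
  have hsnd : ContDiffOn ℝ ∞ (fun z : Vec n × Vec n ↦ z.2)
    ((extChartAt (𝓡∂ n) x₀).target ×ˢ univ) := contDiff_snd.contDiffOn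
  have hmaps : MapsTo (fun z : Vec n × Vec n ↦ z.1) ((extChartAt (𝓡∂ n) x₀).target ×ˢ univ)
    (extChartAt (𝓡∂ n) x₀).target := fun z hz ↦ hz.1
  have hD' (b : Vec n × Vec n → Vec n)
      (hb : ContDiffOn ℝ ∞ b ((extChartAt (𝓡∂ n) x₀).target ×ˢ univ)) :=
    contDiffOn_fderivWithin_apply hG (uniqueDiffOn_extChartAt_target x₀)
      (𝓡∂ n).uniqueDiffOn (extChartAt_target_subset_range x₀)
      (fun y hy ↦ extChartAt_target_mem_nhdsWithin_of_mem hy) hfst hb hmaps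
  have hG' := hG.comp hfst hmaps
  have hC : ContDiffOn ℝ ∞ (fun z : Vec n × Vec n ↦ christoffelForm g x₀ z.1 z.2)
      ((extChartAt (𝓡∂ n) x₀).target ×ˢ univ) := by
    rw [contDiffOn_clm_apply]
    intro w
    have h1 := ((hD' _ hsnd).clm_apply hsnd).clm_apply (contDiffOn_const (c := w))
    have h2 := ((hD' _ (contDiffOn_const (c := w))).clm_apply hsnd).clm_apply hsnd
    refine (h1.sub (h2.const_smul (2⁻¹ : ℝ))).congr fun z hz ↦ rfl
  refine hsnd.prodMk (ContDiffOn.neg ?_)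
  exact contDiffOn_inverse_apply hG' (fun z hz ↦ metricForm_isInvertible g x₀ hz.1) hC

end Charts

/-! ### Derivatives of pulled-back forms and of tangent maps -/

section Calculus

variable {E : Type*} [NormedAddCommGroup E] [NormedSpace ℝ E]

set_option synthInstance.maxHeartbeats 200000 in
theorem hasFDerivWithinAt_form_comp {s : Set E} {φ : E → E} {φ₁ : E →L[ℝ] E}
    {G₁ : E → E →L[ℝ] E →L[ℝ] ℝ} {D₁ : E →L[ℝ] E →L[ℝ] E →L[ℝ] ℝ} {y : E}
    (hφ : HasFDerivWithinAt φ φ₁ s y) (hG₁ : HasFDerivWithinAt G₁ D₁ s (φ y))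
    (hmaps : MapsTo φ s s) :
    HasFDerivWithinAt (fun z ↦ G₁ (φ z)) (D₁.comp φ₁) s y := by
  exact HasFDerivWithinAt.comp (G := E →L[ℝ] E →L[ℝ] ℝ) (g := G₁) (g' := D₁) (t := s) y hG₁ hφ hmaps

set_option synthInstance.maxHeartbeats 200000 in
/-- The derivative of a bilinear form which is pulled back by a differentiable map. -/
theorem fderivWithin_pullback_form {s : Set E} {φ : E → E} {φ₁ : E → E →L[ℝ] E}
    {φ₂ : E →L[ℝ] E →L[ℝ] E} {G₀ G₁ : E → E →L[ℝ] E →L[ℝ] ℝ}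
    {D₀ D₁ : E →L[ℝ] E →L[ℝ] E →L[ℝ] ℝ} {y : E} (hs : UniqueDiffWithinAt ℝ s y) (hy : y ∈ s)
    (hφ : HasFDerivWithinAt φ (φ₁ y) s y) (hφ₁ : HasFDerivWithinAt φ₁ φ₂ s y)
    (hG₀ : HasFDerivWithinAt G₀ D₀ s y) (hG₁ : HasFDerivWithinAt G₁ D₁ s (φ y))
    (hmaps : MapsTo φ s s)
    (heq : ∀ᶠ z in 𝓝[s] y, ∀ u v, G₀ z u v = G₁ (φ z) (φ₁ z u) (φ₁ z v)) (w u v : E) :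
    D₀ w u v = D₁ (φ₁ y w) (φ₁ y u) (φ₁ y v) + G₁ (φ y) (φ₂ w u) (φ₁ y v) +
      G₁ (φ y) (φ₁ y u) (φ₂ w v) := by
  have h0 : HasFDerivWithinAt (fun z ↦ G₀ z u v) ((D₀.flip u).flip v) s y := by
    have := (hG₀.clm_apply (hasFDerivWithinAt_const u y s)).clm_apply
      (hasFDerivWithinAt_const v y s)
    refine this.congr_fderiv ?_
    ext w
    simp
  have hc : HasFDerivWithinAt (fun z ↦ G₁ (φ z)) (D₁.comp (φ₁ y)) s y :=
    hasFDerivWithinAt_form_comp hφ hG₁ hmaps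
  have h1 : HasFDerivWithinAt (fun z ↦ G₁ (φ z) (φ₁ z u) (φ₁ z v)) _ s y :=
    (hc.clm_apply (hφ₁.clm_apply (hasFDerivWithinAt_const u y s))).clm_apply
      (hφ₁.clm_apply (hasFDerivWithinAt_const v y s))
  have h2 := h0.congr_of_eventuallyEq (heq.mono fun z hz ↦ (hz u v).symm)
    (heq.self_of_nhdsWithin hy u v).symm
  have h3 := DFunLike.congr_fun (hs.eq h2 h1) w
  simp only [ContinuousLinearMap.flip_apply, add_apply,
    ContinuousLinearMap.comp_apply, map_zero, zero_add, zero_apply] at h3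
  rw [h3]
  ring

/-- The derivative of the coordinates of a curve of tangent vectors after a change of coordinates. -/
theorem hasDerivWithinAt_tangentMap {H : Set E} {s : Set ℝ} {φ : E → E} {φ₁ : E → E →L[ℝ] E}
    {φ₂ : E →L[ℝ] E →L[ℝ] E} {z : ℝ → E × E} {z' : E × E} {t : ℝ}
    (hφ : HasFDerivWithinAt φ (φ₁ (z t).1) H (z t).1)
    (hφ₁ : HasFDerivWithinAt φ₁ φ₂ H (z t).1)
    (hz : HasDerivWithinAt z z' s t) (hmaps : MapsTo (fun r ↦ (z r).1) s H) :
    HasDerivWithinAt (fun r ↦ (φ (z r).1, φ₁ (z r).1 (z r).2))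
      (φ₁ (z t).1 z'.1, φ₂ z'.1 (z t).2 + φ₁ (z t).1 z'.2) s t := by
  have hfst : HasDerivWithinAt (fun r ↦ (z r).1) z'.1 s t :=
    hz.hasFDerivWithinAt.fst.hasDerivWithinAt.congr_deriv (by simp)
  have hsnd : HasDerivWithinAt (fun r ↦ (z r).2) z'.2 s t :=
    hz.hasFDerivWithinAt.snd.hasDerivWithinAt.congr_deriv (by simp)
  have h1 : HasDerivWithinAt (fun r ↦ φ (z r).1) (φ₁ (z t).1 z'.1) s t :=
    hφ.comp_hasDerivWithinAt t hfst hmaps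
  have h2 : HasDerivWithinAt (fun r ↦ φ₁ (z r).1) (φ₂ z'.1) s t :=
    HasFDerivWithinAt.comp_hasDerivWithinAt (F := E) (E := E →L[ℝ] E) (l := φ₁) (l' := φ₂)
      (f := fun r ↦ (z r).1) (t := H) t hφ₁ hfst hmaps
  exact h1.prodMk (h2.clm_apply hsnd)

end Calculus

/-! ### Coordinate changes and invariance of the geodesic equation -/

section Change

variable {n : ℕ} [NeZero n]
  {M : Type*} [TopologicalSpace M] [ChartedSpace (EuclideanHalfSpace n) M]

/-- The change of coordinates from the chart at `x₀` to the chart at `x₁`. -/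
def coordChange (x₀ x₁ : M) : Vec n → Vec n :=
  extChartAt (𝓡∂ n) x₁ ∘ (extChartAt (𝓡∂ n) x₀).symm

theorem mem_closure_interior_halfSpace {y : Vec n} (hy : y ∈ halfSpace n) :
    y ∈ closure (interior (halfSpace n)) := by
  exact (𝓡∂ n).range_subset_closure_interior hy

variable [IsManifold (𝓡∂ n) ∞ M]

/-- The overlap of two charts, in the coordinates of the first one. -/
def overlap (x₀ x₁ : M) : Set (Vec n) :=
  {y | y ∈ (extChartAt (𝓡∂ n) x₀).target ∧
    (extChartAt (𝓡∂ n) x₀).symm y ∈ (extChartAt (𝓡∂ n) x₁).source}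

theorem overlap_mem_nhdsWithin {x₀ x₁ : M} {y : Vec n} (hy : y ∈ overlap x₀ x₁) :
    overlap x₀ x₁ ∈ 𝓝[halfSpace n] y := by
  have h1 := extChartAt_target_mem_nhdsWithin_of_mem (I := 𝓡∂ n) hy.1
  have h2 : (extChartAt (𝓡∂ n) x₀).symm ⁻¹' (extChartAt (𝓡∂ n) x₁).source ∈
      𝓝[(extChartAt (𝓡∂ n) x₀).target] y :=
    (continuousOn_extChartAt_symm x₀ y hy.1).preimage_mem_nhdsWithin
      ((isOpen_extChartAt_source x₁).mem_nhds hy.2)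
  rw [nhdsWithin_extChartAt_target_eq_of_mem hy.1] at h2
  exact inter_mem h1 h2

theorem contDiffWithinAt_coordChange {x₀ x₁ : M} {y : Vec n} (hy : y ∈ overlap x₀ x₁) :
    ContDiffWithinAt ℝ ∞ (coordChange x₀ x₁) (halfSpace n) y := by
  refine contDiffWithinAt_ext_coord_change x₁ x₀ ?_
  rw [PartialEquiv.trans_source, PartialEquiv.symm_source]
  exact hy

theorem fderivWithin_coordChange {x₀ x₁ : M} {y : Vec n} (hy : y ∈ overlap x₀ x₁) (u : Vec n) :
    fderivWithin ℝ (coordChange x₀ x₁) (halfSpace n) y u =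
      chartDeriv x₁ ((extChartAt (𝓡∂ n) x₀).symm y) (frame x₀ y u) := by
  have hs := hy.2
  rw [extChartAt_source] at hs
  have h := mfderiv_comp_mfderivWithin (I := 𝓘(ℝ, Vec n)) (I' := 𝓡∂ n) (I'' := 𝓘(ℝ, Vec n)) y
    (mdifferentiableAt_extChartAt (I := 𝓡∂ n) hs)
    (mdifferentiableWithinAt_extChartAt_symm (I := 𝓡∂ n) hy.1)
    ((𝓡∂ n).uniqueMDiffOn _ (extChartAt_target_subset_range x₀ hy.1))
  rw [mfderivWithin_eq_fderivWithin] at h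
  exact DFunLike.congr_fun h u

theorem metricForm_coordChange (g : LorentzMetric n M) {x₀ x₁ : M} {y : Vec n}
    (hy : y ∈ overlap x₀ x₁) (u v : Vec n) :
    metricForm g x₀ y u v = metricForm g x₁ (coordChange x₀ x₁ y)
      (fderivWithin ℝ (coordChange x₀ x₁) (halfSpace n) y u)
      (fderivWithin ℝ (coordChange x₀ x₁) (halfSpace n) y v) := by
  rw [fderivWithin_coordChange hy, fderivWithin_coordChange hy]
  exact (metricForm_coords g x₁ hy.2 _ _).symm

theorem coordChange_mem_target {x₀ x₁ : M} {y : Vec n} (hy : y ∈ overlap x₀ x₁) :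
    coordChange x₀ x₁ y ∈ (extChartAt (𝓡∂ n) x₁).target :=
  (extChartAt (𝓡∂ n) x₁).map_source hy.2

/-- The transformation rule of the coordinate acceleration of geodesics. -/
theorem acc_coordChange (g : LorentzMetric n M) {x₀ x₁ : M} {y : Vec n}
    (hy : y ∈ overlap x₀ x₁) (u : Vec n) :
    acc g x₁ (coordChange x₀ x₁ y) (fderivWithin ℝ (coordChange x₀ x₁) (halfSpace n) y u) =
      fderivWithin ℝ (coordChange x₀ x₁) (halfSpace n) y (acc g x₀ y u) +
      fderivWithin ℝ (fderivWithin ℝ (coordChange x₀ x₁) (halfSpace n)) (halfSpace n) y u u := by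
  set φ := coordChange (n := n) x₀ x₁ with hφdef
  set φ₁ := fderivWithin ℝ φ (halfSpace n) with hφ₁def
  set φ₂ := fderivWithin ℝ φ₁ (halfSpace n) y with hφ₂def
  have hyH : y ∈ halfSpace n := extChartAt_target_subset_range x₀ hy.1
  have hU : UniqueDiffOn ℝ (halfSpace n) := (𝓡∂ n).uniqueDiffOn
  have hφ := contDiffWithinAt_coordChange hy
  have hφd : HasFDerivWithinAt φ (φ₁ y) (halfSpace n) y :=
    (hφ.differentiableWithinAt (by simp)).hasFDerivWithinAt
  have hφ₁ : HasFDerivWithinAt φ₁ φ₂ (halfSpace n) y :=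
    ((hφ.fderivWithin_right (m := 1) hU (by norm_cast) hyH).differentiableWithinAt
      (by simp)).hasFDerivWithinAt
  -- Boundary points are limits of interior points of the half-space, so the second derivative
  -- within it is symmetric there as well.
  have hsymm : ∀ v w, φ₂ v w = φ₂ w v :=
    hφ.isSymmSndFDerivWithinAt (by simp; norm_cast) hU (mem_closure_interior_halfSpace hyH) hyH
  have hpull := fderivWithin_pullback_form (hU y hyH) hyH hφd hφ₁
    (differentiableWithinAt_metricForm g x₀ hy.1).hasFDerivWithinAt
    (differentiableWithinAt_metricForm g x₁ (coordChange_mem_target hy)).hasFDerivWithinAt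
    (fun z _ ↦ mem_range_self _) (mem_of_superset (overlap_mem_nhdsWithin hy)
      (fun z hz ↦ metricForm_coordChange g hz))
  refine (eq_acc g x₁ (coordChange_mem_target hy) fun w ↦ ?_).symm
  -- The differential of the coordinate change is onto, so it suffices to test against its values.
  obtain ⟨w, rfl⟩ : ∃ w', φ₁ y w' = w := by
    obtain ⟨a, ha⟩ : ∃ a, chartDeriv x₁ ((extChartAt (𝓡∂ n) x₀).symm y) a = w := by
      refine ⟨frame x₁ (φ y) w, ?_⟩
      have := chartDeriv_frame x₁ (coordChange_mem_target hy) w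
      rwa [show (extChartAt (𝓡∂ n) x₁).symm (coordChange x₀ x₁ y) =
        (extChartAt (𝓡∂ n) x₀).symm y from (extChartAt (𝓡∂ n) x₁).left_inv hy.2] at this
    obtain ⟨b, hb⟩ := frame_surjective x₀ hy.1 a
    exact ⟨b, by rw [hφ₁def, fderivWithin_coordChange hy, hb, ha]⟩
  have h1 := metricForm_acc g x₀ hy.1 u w
  rw [metricForm_coordChange g hy] at h1
  -- In the Christoffel combination of these two derivatives the terms with `φ₂ u w` cancel by
  -- symmetry; only the term with `φ₂ u u` remains, which is the correction in the transformation
  -- rule.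
  have e1 := hpull u u w
  have e2 := hpull w u u
  have e3 := metricForm_symm g x₁ (φ y) (φ₂ w u) (φ₁ y u)
  rw [hsymm w u] at e2 e3
  simp only [christoffelForm, sub_apply, smul_apply,
    ContinuousLinearMap.flip_apply, smul_eq_mul, map_add, add_apply] at h1 ⊢
  linarith

theorem coords_eq_coordChange {x₀ x₁ : M} {v : TangentBundle (𝓡∂ n) M}
    (h₀ : v.1 ∈ (extChartAt (𝓡∂ n) x₀).source) (h₁ : v.1 ∈ (extChartAt (𝓡∂ n) x₁).source) :
    (coords x₀ v).1 ∈ overlap x₀ x₁ ∧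
    coords x₁ v = (coordChange x₀ x₁ (coords x₀ v).1,
      fderivWithin ℝ (coordChange x₀ x₁) (halfSpace n) (coords x₀ v).1 (coords x₀ v).2) := by
  have hl : (extChartAt (𝓡∂ n) x₀).symm (coords x₀ v).1 = v.1 :=
    (extChartAt (𝓡∂ n) x₀).left_inv h₀
  have hov : (coords x₀ v).1 ∈ overlap x₀ x₁ :=
    ⟨(extChartAt (𝓡∂ n) x₀).map_source h₀, by rw [hl]; exact h₁⟩
  refine ⟨hov, Prod.ext ?_ ?_⟩
  · simp only [coordChange, Function.comp, hl]
    rfl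
  · simp only
    rw [fderivWithin_coordChange hov, hl]
    have := frame_chartDeriv x₀ h₀ (vecOf v)
    simp only [coords]
    rw [this]

/-- The geodesic equation does not depend on the chart. -/
theorem hasDerivWithinAt_coords_change (g : LorentzMetric n M) {Z : ℝ → TangentBundle (𝓡∂ n) M}
    {s : Set ℝ} {t : ℝ} {x₀ x₁ : M} (hc : ContinuousWithinAt Z s t)
    (h₀ : (Z t).1 ∈ (extChartAt (𝓡∂ n) x₀).source) (h₁ : (Z t).1 ∈ (extChartAt (𝓡∂ n) x₁).source)
    (h : HasDerivWithinAt (fun r ↦ coords x₀ (Z r)) (spray g x₀ (coords x₀ (Z t))) s t) :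
    HasDerivWithinAt (fun r ↦ coords x₁ (Z r)) (spray g x₁ (coords x₁ (Z t))) s t := by
  have hyH : (coords x₀ (Z t)).1 ∈ halfSpace n := mem_range_self _
  have hU : UniqueDiffOn ℝ (halfSpace n) := (𝓡∂ n).uniqueDiffOn
  have hov := (coords_eq_coordChange h₀ h₁).1
  have hφ := contDiffWithinAt_coordChange hov
  have hφd := (hφ.differentiableWithinAt (by simp)).hasFDerivWithinAt
  have hφ₁ := ((hφ.fderivWithin_right (m := 1) hU (by norm_cast) hyH).differentiableWithinAt
      (by simp)).hasFDerivWithinAt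
  have e3 := hasDerivWithinAt_tangentMap (z := fun r ↦ coords x₀ (Z r)) hφd hφ₁ h
    (fun r _ ↦ mem_range_self _)
  have hev : ∀ᶠ r in 𝓝[s] t, coords x₁ (Z r) =
      (coordChange x₀ x₁ (coords x₀ (Z r)).1,
      fderivWithin ℝ (coordChange x₀ x₁) (halfSpace n) (coords x₀ (Z r)).1
        (coords x₀ (Z r)).2) := by
    filter_upwards [hc ((isOpen_chartDomain x₀).mem_nhds h₀),
      hc ((isOpen_chartDomain x₁).mem_nhds h₁)] with r hr₀ hr₁
    exact (coords_eq_coordChange hr₀ hr₁).2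
  have e4 := e3.congr_of_eventuallyEq hev (coords_eq_coordChange h₀ h₁).2
  refine e4.congr_deriv ?_
  rw [(coords_eq_coordChange h₀ h₁).2]
  refine Prod.ext rfl ?_
  refine Eq.trans ?_ (acc_coordChange g hov (coords x₀ (Z t)).2).symm
  exact add_comm _ _

end Change

/-! ### Geodesics as integral curves of the spray -/

section Integral

variable {n : ℕ} [NeZero n]
  {M : Type*} [TopologicalSpace M] [ChartedSpace (EuclideanHalfSpace n) M]
  [IsManifold (𝓡∂ n) ∞ M]

/-- A curve of tangent vectors is an integral curve of the geodesic spray. -/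
def IsIntegral (g : LorentzMetric n M) (Z : ℝ → TangentBundle (𝓡∂ n) M) (s : Set ℝ) : Prop :=
  ContinuousOn Z s ∧ ∀ t ∈ s, ∀ x₀ : M, (Z t).1 ∈ (extChartAt (𝓡∂ n) x₀).source →
    HasDerivWithinAt (fun r ↦ coords x₀ (Z r)) (spray g x₀ (coords x₀ (Z t))) s t

variable {g : LorentzMetric n M} {Z W : ℝ → TangentBundle (𝓡∂ n) M} {s : Set ℝ}

/-- The equation is invariant under coordinate changes, so one chart at each time suffices. -/
theorem IsIntegral.of_chart (hc : ContinuousOn Z s)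
    (h : ∀ t ∈ s, ∃ x₀ : M, (Z t).1 ∈ (extChartAt (𝓡∂ n) x₀).source ∧
      HasDerivWithinAt (fun r ↦ coords x₀ (Z r)) (spray g x₀ (coords x₀ (Z t))) s t) :
    IsIntegral g Z s := by
  refine ⟨hc, fun t ht x₁ hx₁ ↦ ?_⟩
  obtain ⟨x₀, hx₀, hd⟩ := h t ht
  exact hasDerivWithinAt_coords_change g (hc t ht) hx₀ hx₁ hd

theorem IsIntegral.congr (h : IsIntegral g Z s) (hs : EqOn W Z s) : IsIntegral g W s := by
  refine ⟨h.1.congr hs, fun t ht x₀ hx₀ ↦ ?_⟩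
  rw [hs ht] at hx₀ ⊢
  exact (h.2 t ht x₀ hx₀).congr (fun r hr ↦ by rw [hs hr]) (by rw [hs ht])

/-- Derivatives within a single point are unconstrained; this makes geodesics of length `0`
available. -/
theorem isIntegral_singleton (v : TangentBundle (𝓡∂ n) M) (t : ℝ) :
    IsIntegral g (fun _ ↦ v) {t} := by
  refine ⟨continuousOn_singleton _ _, fun r hr x₀ _ ↦ ?_⟩
  rw [mem_singleton_iff] at hr
  subst hr
  exact HasFDerivWithinAt.of_subsingleton subsingleton_singleton

/-- Scalar multiplication of tangent vectors. -/
def tsmul (c : ℝ) (v : TangentBundle (𝓡∂ n) M) : TangentBundle (𝓡∂ n) M := tvec v.1 (c • vecOf v)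

theorem coords_tsmul (x₀ : M) (c : ℝ) (v : TangentBundle (𝓡∂ n) M) :
    coords x₀ (tsmul c v) = ((coords x₀ v).1, c • (coords x₀ v).2) := by
  refine Prod.ext rfl ?_
  exact map_smul (chartDeriv x₀ v.1) c (vecOf v)

set_option synthInstance.maxHeartbeats 200000 in
theorem christoffelForm_smul (g : LorentzMetric n M) (x₀ : M) (c : ℝ) (y u : Vec n) :
    christoffelForm g x₀ y (c • u) = c ^ 2 • christoffelForm g x₀ y u := by
  ext w
  simp only [christoffelForm, sub_apply, smul_apply, ContinuousLinearMap.flip_apply, map_smul,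
    smul_eq_mul]
  ring

theorem acc_smul (g : LorentzMetric n M) (x₀ : M) (c : ℝ) (y u : Vec n) :
    acc g x₀ y (c • u) = c ^ 2 • acc g x₀ y u := by
  rw [acc, christoffelForm_smul, map_smul, acc, smul_neg]

theorem continuousAt_iff_coords {f : ℝ → TangentBundle (𝓡∂ n) M} {t : ℝ} {x₀ : M}
    (h : (f t).1 ∈ (extChartAt (𝓡∂ n) x₀).source)
    (hb : ∀ᶠ r in 𝓝[s] t, (f r).1 ∈ (extChartAt (𝓡∂ n) x₀).source)
    (hc : ContinuousWithinAt (fun r ↦ coords x₀ (f r)) s t) : ContinuousWithinAt f s t := by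
  have h1 := (continuousOn_ofCoords x₀ (coords x₀ (f t)) ((extChartAt (𝓡∂ n) x₀).map_source h))
  have h2 : Tendsto (fun r ↦ coords x₀ (f r)) (𝓝[s] t)
      (𝓝[{z | z.1 ∈ (extChartAt (𝓡∂ n) x₀).target}] (coords x₀ (f t))) :=
    tendsto_nhdsWithin_iff.2 ⟨hc, hb.mono fun r hr ↦ (extChartAt (𝓡∂ n) x₀).map_source hr⟩
  have h3 := h1.tendsto.comp h2
  rw [ofCoords_coords x₀ h] at h3
  exact h3.congr' (hb.mono fun r hr ↦ ofCoords_coords x₀ hr)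

theorem continuous_tsmul (c : ℝ) : Continuous (tsmul (n := n) (M := M) c) := by
  rw [continuous_iff_continuousAt]
  intro v
  have hv : v.1 ∈ (extChartAt (𝓡∂ n) v.1).source := mem_extChartAt_source v.1
  have h1 : ContinuousAt (coords v.1) v :=
    (continuousOn_coords v.1).continuousAt ((isOpen_chartDomain v.1).mem_nhds hv)
  have h2 := (continuousOn_ofCoords v.1 (coords v.1 (tsmul c v))
    ((extChartAt (𝓡∂ n) v.1).map_source hv))
  have h3 : Tendsto (fun w ↦ coords v.1 (tsmul c w)) (𝓝 v)
      (𝓝[{z | z.1 ∈ (extChartAt (𝓡∂ n) v.1).target}] (coords v.1 (tsmul c v))) := by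
    refine tendsto_nhdsWithin_iff.2 ⟨?_, ?_⟩
    · simp only [coords_tsmul]
      exact (h1.fst.prodMk (h1.snd.const_smul c))
    · filter_upwards [(isOpen_chartDomain v.1).mem_nhds hv] with w hw
      exact (extChartAt (𝓡∂ n) v.1).map_source hw
  have h4 := h2.tendsto.comp h3
  rw [ofCoords_coords v.1 (v := tsmul c v) hv] at h4
  refine Tendsto.congr' ?_ h4
  filter_upwards [(isOpen_chartDomain v.1).mem_nhds hv] with w hw
  exact ofCoords_coords v.1 (v := tsmul c w) hw

/-- Affine reparametrizations of integral curves. -/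
theorem IsIntegral.affine (h : IsIntegral g Z s) (c d : ℝ) {s' : Set ℝ}
    (hs : ∀ t ∈ s', c * t + d ∈ s) : IsIntegral g (fun t ↦ tsmul c (Z (c * t + d))) s' := by
  have hcont : ContinuousOn (fun t : ℝ ↦ c * t + d) s' := by fun_prop
  refine ⟨(continuous_tsmul c).comp_continuousOn (h.1.comp hcont hs), fun t ht x₀ hx₀ ↦ ?_⟩
  have h1 := h.2 (c * t + d) (hs t ht) x₀ hx₀
  have h2 : HasDerivWithinAt (fun t : ℝ ↦ c * t + d) c s' t := by
    simpa using (((hasDerivWithinAt_id t s').const_mul c).add_const d)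
  have h3 := h1.scomp t h2 hs
  have h4 : HasDerivWithinAt (fun r ↦ (coords x₀ (Z (c * r + d))).1)
      (c • (coords x₀ (Z (c * t + d))).2) s' t :=
    h3.hasFDerivWithinAt.fst.hasDerivWithinAt.congr_deriv (by simp [spray])
  have h5 : HasDerivWithinAt (fun r ↦ (coords x₀ (Z (c * r + d))).2)
      (c • acc g x₀ (coords x₀ (Z (c * t + d))).1 (coords x₀ (Z (c * t + d))).2) s' t :=
    h3.hasFDerivWithinAt.snd.hasDerivWithinAt.congr_deriv (by simp [spray])
  have h6 := h4.prodMk (h5.const_smul c)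
  simp only [coords_tsmul]
  refine h6.congr_deriv ?_
  rw [spray, acc_smul, smul_smul, pow_two]

/-- At the junction both one-sided derivatives are the spray at the common vector, so nothing beyond
`Z b = W b` has to match. -/
theorem IsIntegral.concat {a b c : ℝ} (hab : a ≤ b) (hbc : b ≤ c)
    (hZ : IsIntegral g Z (Icc a b)) (hW : IsIntegral g W (Icc b c)) (h : Z b = W b) :
    IsIntegral g (fun t ↦ if t ≤ b then Z t else W t) (Icc a c) := by
  set V : ℝ → TangentBundle (𝓡∂ n) M := fun t ↦ if t ≤ b then Z t else W t with hV
  have e1 : EqOn V Z (Icc a b) := fun t ht ↦ if_pos ht.2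
  have e2 : EqOn V W (Icc b c) := by
    intro t ht
    by_cases htb : t ≤ b
    · have : t = b := le_antisymm htb ht.1
      subst this
      simp [hV, h]
    · exact if_neg htb
  have i1 := hZ.congr e1
  have i2 := hW.congr e2
  rw [← Icc_union_Icc_eq_Icc hab hbc]
  refine ⟨?_, ?_⟩
  · exact i1.1.union_of_isClosed i2.1 isClosed_Icc isClosed_Icc
  · have key : ∀ t (S S' : Set ℝ), IsIntegral g V S → IsClosed S' → IsIntegral g V S' → t ∈ S →
        ∀ x₀ : M, (V t).1 ∈ (extChartAt (𝓡∂ n) x₀).source →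
        HasDerivWithinAt (fun r ↦ coords x₀ (V r)) (spray g x₀ (coords x₀ (V t))) (S ∪ S') t := by
      intro t S S' hS hS'c hS' ht x₀ hx₀
      by_cases ht' : t ∈ S'
      · exact (hS.2 t ht x₀ hx₀).union (hS'.2 t ht' x₀ hx₀)
      · refine (hS.2 t ht x₀ hx₀).mono_of_mem_nhdsWithin ?_
        rw [mem_nhdsWithin]
        exact ⟨S'ᶜ, hS'c.isOpen_compl, ht', fun r hr ↦ hr.2.resolve_right hr.1⟩
    rintro t (ht | ht) x₀ hx₀
    · exact key t _ _ i1 isClosed_Icc i2 ht x₀ hx₀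
    · rw [union_comm]
      exact key t _ _ i2 isClosed_Icc i1 ht x₀ hx₀

/-- A subinterval which is a neighborhood of a given time. -/
theorem exists_Icc_nhdsWithin {a b t : ℝ} (hab : a < b) (ht : t ∈ Icc a b) {p : ℝ → Prop}
    (hp : ∀ᶠ r in 𝓝[Icc a b] t, p r) :
    ∃ a' b', a' < b' ∧ Icc a' b' ⊆ Icc a b ∧ t ∈ Icc a' b' ∧ Icc a' b' ∈ 𝓝[Icc a b] t ∧
      ∀ r ∈ Icc a' b', p r := by
  obtain ⟨ε, hε, h⟩ := Metric.mem_nhdsWithin_iff.1 hp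
  refine ⟨max a (t - ε / 2), min b (t + ε / 2), ?_, ?_, ?_, ?_, ?_⟩
  · rw [max_lt_iff, lt_min_iff, lt_min_iff]
    exact ⟨⟨hab, by linarith [ht.1]⟩, by linarith [ht.2], by linarith⟩
  · exact Icc_subset_Icc (le_max_left _ _) (min_le_left _ _)
  · rw [mem_Icc, max_le_iff, le_min_iff]
    exact ⟨⟨ht.1, by linarith⟩, ht.2, by linarith⟩
  · rw [Metric.mem_nhdsWithin_iff]
    refine ⟨ε / 2, by linarith, fun r hr ↦ ?_⟩
    have h1 := hr.1
    rw [Metric.mem_ball, Real.dist_eq, abs_lt] at h1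
    rw [mem_Icc, max_le_iff, le_min_iff]
    exact ⟨⟨hr.2.1, by linarith [h1.1]⟩, hr.2.2, by linarith [h1.2]⟩
  · intro r hr
    rw [mem_Icc, max_le_iff, le_min_iff] at hr
    refine h ⟨?_, hr.1.1, hr.2.1⟩
    rw [Metric.mem_ball, Real.dist_eq, abs_lt]
    constructor <;> linarith [hr.1.2, hr.2.2]

/-- Regularity bootstrap: a solution of an equation with smooth right-hand side is smooth up to the
ends of its interval. -/
theorem IsIntegral.exists_contDiffOn {a b t : ℝ} (hab : a < b) (ht : t ∈ Icc a b)
    (h : IsIntegral g Z (Icc a b)) {x₀ : M} (hx₀ : (Z t).1 ∈ (extChartAt (𝓡∂ n) x₀).source) :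
    ∃ a' b', a' < b' ∧ Icc a' b' ⊆ Icc a b ∧ t ∈ Icc a' b' ∧ Icc a' b' ∈ 𝓝[Icc a b] t ∧
      (∀ r ∈ Icc a' b', (Z r).1 ∈ (extChartAt (𝓡∂ n) x₀).source) ∧
      ContDiffOn ℝ ∞ (fun r ↦ coords x₀ (Z r)) (Icc a' b') := by
  obtain ⟨a', b', hab', hsub, htJ, hJ, hsrc⟩ := exists_Icc_nhdsWithin hab ht
    (h.1 t ht ((isOpen_chartDomain x₀).mem_nhds hx₀))
  refine ⟨a', b', hab', hsub, htJ, hJ, hsrc, ?_⟩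
  refine ODE.contDiffOn_enat_Icc_of_hasDerivWithinAt (n := ⊤) (f := fun _ ↦ spray g x₀)
    (u := (extChartAt (𝓡∂ n) x₀).target ×ˢ univ) ?_ ?_ ?_
  · exact (contDiffOn_spray g x₀).comp contDiff_snd.contDiffOn (fun z hz ↦ hz.2)
  · exact fun r hr ↦ (h.2 r (hsub hr) x₀ (hsrc r hr)).mono hsub
  · exact fun r hr ↦ ⟨(extChartAt (𝓡∂ n) x₀).map_source (hsrc r hr), mem_univ _⟩

theorem chartDeriv_velocity {γ : ℝ → M} {a b t : ℝ} (hab : a < b) (ht : t ∈ Icc a b) {x₀ : M}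
    (hx₀ : γ t ∈ (extChartAt (𝓡∂ n) x₀).source)
    (hγ : MDifferentiableWithinAt 𝓘(ℝ, ℝ) (𝓡∂ n) γ (Icc a b) t) :
    coords x₀ (velocity (n := n) γ a b t) = (extChartAt (𝓡∂ n) x₀ (γ t),
      derivWithin (fun r ↦ extChartAt (𝓡∂ n) x₀ (γ r)) (Icc a b) t) := by
  refine Prod.ext rfl ?_
  rw [extChartAt_source] at hx₀
  have h := mfderiv_comp_mfderivWithin (I := 𝓘(ℝ, ℝ)) (I' := 𝓡∂ n) (I'' := 𝓘(ℝ, Vec n)) t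
    (mdifferentiableAt_extChartAt (I := 𝓡∂ n) hx₀) hγ
    ((uniqueDiffOn_Icc hab).uniqueMDiffOn t ht)
  rw [mfderivWithin_eq_fderivWithin] at h
  exact (DFunLike.congr_fun h 1).symm

/-- An integral curve of the geodesic spray projects to a geodesic. -/
theorem IsIntegral.isGeodesic {a b : ℝ} (hab : a < b) (h : IsIntegral g Z (Icc a b)) :
    IsGeodesic g (fun t ↦ (Z t).1) a b ∧
      ∀ t ∈ Icc a b, velocity (fun t ↦ (Z t).1) a b t = Z t := by
  have hU := uniqueDiffOn_Icc hab
  have hsmooth : ContMDiffOn 𝓘(ℝ, ℝ) (𝓡∂ n) ∞ (fun t ↦ (Z t).1) (Icc a b) := by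
    intro t ht
    have hx₀ := mem_extChartAt_source (I := 𝓡∂ n) (Z t).1
    obtain ⟨a', b', hab', hsub, htJ, hJ, hsrc, hcd⟩ := h.exists_contDiffOn hab ht hx₀
    rw [extChartAt_source] at hx₀
    refine (contMDiffWithinAt_iff_target_of_mem_source (I := 𝓘(ℝ, ℝ)) (n := ∞)
      (f := fun r ↦ (Z r).1) (x := t) hx₀).2 ⟨?_, ?_⟩
    · exact continuous_base.continuousAt.comp_continuousWithinAt (h.1 t ht)
    · rw [contMDiffWithinAt_iff_contDiffWithinAt]
      exact (hcd.fst t htJ).mono_of_mem_nhdsWithin hJ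
  have hderiv : ∀ t ∈ Icc a b, ∀ x₀ : M, (Z t).1 ∈ (extChartAt (𝓡∂ n) x₀).source →
      derivWithin (fun r ↦ extChartAt (𝓡∂ n) x₀ (Z r).1) (Icc a b) t = (coords x₀ (Z t)).2 := by
    intro t ht x₀ hx₀
    have h1 : HasDerivWithinAt (fun r ↦ extChartAt (𝓡∂ n) x₀ (Z r).1) (coords x₀ (Z t)).2
        (Icc a b) t :=
      (h.2 t ht x₀ hx₀).hasFDerivWithinAt.fst.hasDerivWithinAt.congr_deriv (by simp [spray])
    exact h1.derivWithin (hU t ht)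
  refine ⟨⟨hab, hsmooth, ?_⟩, ?_⟩
  · intro x₀ t ht hx₀ c c' c'' w
    have h1 : HasDerivWithinAt (fun r ↦ (coords x₀ (Z r)).2)
        (acc g x₀ (coords x₀ (Z t)).1 (coords x₀ (Z t)).2) (Icc a b) t :=
      (h.2 t ht x₀ hx₀).hasFDerivWithinAt.snd.hasDerivWithinAt.congr_deriv (by simp [spray])
    have h2 : HasDerivWithinAt c' (acc g x₀ (coords x₀ (Z t)).1 (coords x₀ (Z t)).2)
        (Icc a b) t := by
      refine h1.congr_of_eventuallyEq ?_ (hderiv t ht x₀ hx₀)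
      filter_upwards [self_mem_nhdsWithin, h.1 t ht ((isOpen_chartDomain x₀).mem_nhds hx₀)]
        with r hr hr2
      exact hderiv r hr x₀ hr2
    have h3 : c'' t = acc g x₀ (coords x₀ (Z t)).1 (coords x₀ (Z t)).2 := h2.derivWithin (hU t ht)
    have h4 : c' t = (coords x₀ (Z t)).2 := hderiv t ht x₀ hx₀
    have hy := (extChartAt (𝓡∂ n) x₀).map_source hx₀
    rw [← metricForm_apply, christoffel_eq g x₀ hy, h3, h4]
    have := metricForm_acc g x₀ hy (coords x₀ (Z t)).2 w
    simp only [coords] at this ⊢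
    rw [this]
    ring
  · intro t ht
    have hx₀ := mem_extChartAt_source (I := 𝓡∂ n) (Z t).1
    have h1 := chartDeriv_velocity hab ht hx₀ ((hsmooth t ht).mdifferentiableWithinAt (by simp))
    rw [hderiv t ht _ hx₀] at h1
    have h2 := ofCoords_coords (Z t).1 (v := velocity (n := n) (fun t ↦ (Z t).1) a b t) hx₀
    rw [h1] at h2
    rw [← h2]
    exact ofCoords_coords (Z t).1 hx₀

/-- The velocity of a geodesic is an integral curve of the geodesic spray. -/
theorem IsGeodesic.isIntegral {γ : ℝ → M} {a b : ℝ} (h : IsGeodesic g γ a b) :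
    IsIntegral g (velocity γ a b) (Icc a b) := by
  obtain ⟨hab, hsmooth, heq⟩ := h
  have hU := uniqueDiffOn_Icc hab
  have hcc : ∀ t ∈ Icc a b, ∀ x₀ : M, γ t ∈ (extChartAt (𝓡∂ n) x₀).source →
      coords x₀ (velocity (n := n) γ a b t) = (extChartAt (𝓡∂ n) x₀ (γ t),
        derivWithin (fun r ↦ extChartAt (𝓡∂ n) x₀ (γ r)) (Icc a b) t) := fun t ht x₀ hx₀ ↦
    chartDeriv_velocity hab ht hx₀ ((hsmooth t ht).mdifferentiableWithinAt (by simp))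
  have hcd : ∀ t ∈ Icc a b, ∀ x₀ : M, γ t ∈ (extChartAt (𝓡∂ n) x₀).source →
      ContDiffWithinAt ℝ ∞ (fun r ↦ extChartAt (𝓡∂ n) x₀ (γ r)) (Icc a b) t := by
    intro t ht x₀ hx₀
    rw [extChartAt_source] at hx₀
    have := ((contMDiffWithinAt_iff_target_of_mem_source hx₀).1 (hsmooth t ht)).2
    rwa [contMDiffWithinAt_iff_contDiffWithinAt] at this
  have hnear : ∀ t ∈ Icc a b, ∀ x₀ : M, γ t ∈ (extChartAt (𝓡∂ n) x₀).source →
      ∀ᶠ r in 𝓝[Icc a b] t, γ r ∈ (extChartAt (𝓡∂ n) x₀).source := fun t ht x₀ hx₀ ↦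
    hsmooth.continuousOn t ht ((isOpen_extChartAt_source x₀).mem_nhds hx₀)
  have hder : ∀ t ∈ Icc a b, ∀ x₀ : M, γ t ∈ (extChartAt (𝓡∂ n) x₀).source →
      HasDerivWithinAt (fun r ↦ coords x₀ (velocity (n := n) γ a b r))
        (spray g x₀ (coords x₀ (velocity (n := n) γ a b t))) (Icc a b) t := by
    intro t ht x₀ hx₀
    have h1 := ((hcd t ht x₀ hx₀).differentiableWithinAt (by simp)).hasDerivWithinAt
    have h2 : ContDiffWithinAt ℝ 1
        (derivWithin (fun r ↦ extChartAt (𝓡∂ n) x₀ (γ r)) (Icc a b)) (Icc a b) t :=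
      (hcd t ht x₀ hx₀).fderivWithin_right_apply (contDiffWithinAt_const (c := (1 : ℝ))) hU
        (by norm_cast) ht
    have h3 := (h2.differentiableWithinAt (by simp)).hasDerivWithinAt
    have h4 := (h1.prodMk h3).congr_of_eventuallyEq
      (f₁ := fun r ↦ coords x₀ (velocity (n := n) γ a b r)) (by
        filter_upwards [hnear t ht x₀ hx₀, self_mem_nhdsWithin] with r hr hr2
        exact hcc r hr2 x₀ hr) (hcc t ht x₀ hx₀)
    refine h4.congr_deriv ?_
    rw [hcc t ht x₀ hx₀]
    have hy := (extChartAt (𝓡∂ n) x₀).map_source hx₀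
    refine Prod.ext rfl (eq_acc g x₀ hy fun w ↦ ?_)
    have := heq x₀ t ht hx₀ w
    rwa [← metricForm_apply, christoffel_eq g x₀ hy] at this
  refine ⟨fun t ht ↦ ?_, hder⟩
  exact continuousAt_iff_coords (mem_extChartAt_source (I := 𝓡∂ n) (γ t))
    (hnear t ht _ (mem_extChartAt_source (I := 𝓡∂ n) (γ t)))
    (hder t ht _ (mem_extChartAt_source (I := 𝓡∂ n) (γ t))).continuousWithinAt

end Integral

/-! ### Local existence with control on the location -/

section ODE

variable {E : Type*} [NormedAddCommGroup E] [NormedSpace ℝ E] [CompleteSpace E]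

/-- The Picard-Lindelöf theorem for autonomous equations, with control on the location of the
solution. -/
theorem exists_solution_mem_closedBall {F : E → E} {z₀ z : E} {ρ A δ : ℝ} {K : ℝ≥0} (hρ : 0 ≤ ρ)
    (hA : 0 ≤ A) (hδ : 0 ≤ δ) (hAδ : A * δ ≤ ρ)
    (hK : LipschitzOnWith K F (Metric.closedBall z₀ (2 * ρ)))
    (hF : ∀ z ∈ Metric.closedBall z₀ (2 * ρ), ‖F z‖ ≤ A) (hz : z ∈ Metric.closedBall z₀ ρ) :
    ∃ α : ℝ → E, α 0 = z ∧ ∀ t ∈ Icc 0 δ, α t ∈ Metric.closedBall z₀ (2 * ρ) ∧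
      HasDerivWithinAt α (F (α t)) (Icc 0 δ) t := by
  set a : ℝ≥0 := ⟨2 * ρ, by positivity⟩
  set r : ℝ≥0 := ⟨ρ, hρ⟩
  set L : ℝ≥0 := ⟨A, hA⟩
  have hf : IsPicardLindelof (fun _ ↦ F) (tmin := 0) (tmax := δ) ⟨0, left_mem_Icc.2 hδ⟩ z₀ a r L K := by
    -- The initial value may be off center by `ρ` in a ball of radius `2 * ρ`, so a distance `ρ`
    -- remains, to be travelled with speed at most `A`.
    refine IsPicardLindelof.of_time_independent hF hK ?_
    change A * max (δ - 0) (0 - 0) ≤ 2 * ρ - ρ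
    rw [sub_zero, sub_zero, max_eq_left hδ]
    linarith
  have hz' : z ∈ Metric.closedBall z₀ (r : ℝ) := hz
  obtain ⟨α, hα⟩ := ODE.FunSpace.exists_isFixedPt_next hf hz'
  refine ⟨α.compProj, ?_, fun t ht ↦ ⟨α.compProj_mem_closedBall hf.mul_max_le, ?_⟩⟩
  · have : α.compProj ((⟨0, left_mem_Icc.2 hδ⟩ : Icc 0 δ) : ℝ) = z := by
      rw [ODE.FunSpace.compProj_val, ← hα, ODE.FunSpace.next_apply₀]
    exact this
  · apply ODE.hasDerivWithinAt_picard_Icc (left_mem_Icc.2 hδ) hf.continuousOn_uncurry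
      α.continuous_compProj.continuousOn (fun _ ht' ↦ α.compProj_mem_closedBall hf.mul_max_le)
      z ht |>.congr_of_mem _ ht
    intro t' ht'
    nth_rw 1 [← hα]
    rw [ODE.FunSpace.compProj_of_mem ht', ODE.FunSpace.next_apply]

end ODE

/-! ### Retraction onto the half-space -/

section HalfSpace

variable {n : ℕ} [NeZero n]

/-- A Lipschitz retraction onto the half-space. -/
def toHalfSpace (y : Vec n) : Vec n := y + max (-(y 0)) 0 • EuclideanSpace.single 0 1

theorem toHalfSpace_mem (y : Vec n) : toHalfSpace y ∈ halfSpace n := by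
  rw [mem_halfSpace]
  simp only [toHalfSpace, PiLp.add_apply, PiLp.smul_apply, PiLp.single_apply, if_true,
    smul_eq_mul, mul_one]
  linarith [le_max_left (-(y 0)) 0]

theorem toHalfSpace_of_mem {y : Vec n} (hy : y ∈ halfSpace n) : toHalfSpace y = y := by
  rw [mem_halfSpace] at hy
  rw [toHalfSpace, max_eq_right (by linarith), zero_smul, add_zero]

theorem lipschitzWith_toHalfSpace : LipschitzWith 2 (toHalfSpace (n := n)) := by
  refine LipschitzWith.of_dist_le_mul fun y y' ↦ ?_
  have h0 : |y 0 - y' 0| ≤ ‖y - y'‖ := by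
    have := PiLp.norm_apply_le (y - y') 0
    simpa using this
  have h1 : |max (-(y 0)) 0 - max (-(y' 0)) 0| ≤ |y 0 - y' 0| := by
    have := abs_max_sub_max_le_abs (-(y 0)) (-(y' 0)) 0
    rwa [neg_sub_neg, abs_sub_comm (y' 0)] at this
  rw [dist_eq_norm, dist_eq_norm]
  have h2 : toHalfSpace y - toHalfSpace y' = (y - y') +
      (max (-(y 0)) 0 - max (-(y' 0)) 0) • EuclideanSpace.single 0 1 := by
    simp only [toHalfSpace, sub_smul]
    abel
  rw [h2]
  refine (norm_add_le _ _).trans ?_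
  rw [norm_smul, PiLp.norm_single, Real.norm_eq_abs]
  simp only [norm_one, mul_one, NNReal.coe_ofNat]
  linarith

end HalfSpace

/-! ### Local control of geodesics in a chart -/

section Local

variable {n : ℕ} [NeZero n]
  {M : Type*} [TopologicalSpace M] [ChartedSpace (EuclideanHalfSpace n) M]
  [IsManifold (𝓡∂ n) ∞ M] {g : LorentzMetric n M}

theorem mem_futureLightlike_iff {T : TimeOrientation g} {v : TangentBundle (𝓡∂ n) M} :
    v ∈ futureLightlike T ↔ g.form v.1 (vecOf v) (vecOf v) = 0 ∧
      g.form v.1 (vecOf v) (T.field v.1 : Vec n) < 0 := by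
  constructor
  · exact fun h ↦ ⟨h.1.2, h.2⟩
  · refine fun h ↦ ⟨⟨fun h0 ↦ ?_, h.1⟩, h.2⟩
    have h2 := h.2
    rw [show vecOf v = 0 from h0, map_zero] at h2
    exact lt_irrefl _ h2

theorem mem_futureLightlike_iff_coords {T : TimeOrientation g} {v : TangentBundle (𝓡∂ n) M}
    {x₀ : M} (hv : v.1 ∈ (extChartAt (𝓡∂ n) x₀).source) :
    v ∈ futureLightlike T ↔
      metricForm g x₀ (coords x₀ v).1 (coords x₀ v).2 (coords x₀ v).2 = 0 ∧
      timeForm T x₀ (coords x₀ v).1 (coords x₀ v).2 < 0 := by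
  rw [mem_futureLightlike_iff, coords, metricForm_coords g x₀ hv, timeForm_coords T x₀ hv]

/-- The geodesic spray in the chart at `x₀`, extended to points outside of the half-space. -/
def extSpray (g : LorentzMetric n M) (x₀ : M) (z : Vec n × Vec n) : Vec n × Vec n :=
  spray g x₀ (toHalfSpace z.1, z.2)

theorem extSpray_of_mem (g : LorentzMetric n M) (x₀ : M) {z : Vec n × Vec n}
    (hz : z.1 ∈ halfSpace n) : extSpray g x₀ z = spray g x₀ z := by
  rw [extSpray, toHalfSpace_of_mem hz]

/-- Around each vector there is a ball in coordinates where the extended spray is bounded and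
Lipschitz continuous. -/
theorem exists_good_ball (g : LorentzMetric n M) (x₀ : M) {z₀ : Vec n × Vec n}
    (hz₀ : z₀.1 ∈ (extChartAt (𝓡∂ n) x₀).target) {p : Vec n × Vec n → Prop}
    (hp : ∀ᶠ z in 𝓝[{z | z.1 ∈ halfSpace n}] z₀, p z) :
    ∃ (ρ A : ℝ) (K : ℝ≥0), 0 < ρ ∧ 0 < A ∧
      LipschitzOnWith K (extSpray g x₀) (Metric.closedBall z₀ (2 * ρ)) ∧
      (∀ z ∈ Metric.closedBall z₀ (2 * ρ), ‖extSpray g x₀ z‖ ≤ A) ∧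
      ∀ z ∈ Metric.closedBall z₀ (2 * ρ), z.1 ∈ halfSpace n →
        z.1 ∈ (extChartAt (𝓡∂ n) x₀).target ∧ p z := by
  have hH : ∀ z : Vec n × Vec n, z.1 ∈ halfSpace n ↔ z ∈ halfSpace n ×ˢ (univ : Set (Vec n)) := by
    simp
  have hz₀H : z₀.1 ∈ halfSpace n := extChartAt_target_subset_range x₀ hz₀
  have htgt : (extChartAt (𝓡∂ n) x₀).target ×ˢ (univ : Set (Vec n)) ∈
      𝓝[halfSpace n ×ˢ univ] z₀ := by
    rw [← Prod.mk.eta (p := z₀), nhdsWithin_prod_eq]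
    exact prod_mem_prod (extChartAt_target_mem_nhdsWithin_of_mem hz₀) univ_mem
  have hcd : ContDiffWithinAt ℝ 1 (spray g x₀) (halfSpace n ×ˢ univ) z₀ :=
    (((contDiffOn_spray g x₀) z₀ ⟨hz₀, mem_univ _⟩).mono_of_mem_nhdsWithin htgt).of_le (by norm_cast)
  obtain ⟨K, t, ht, hK⟩ := hcd.exists_lipschitzOnWith ((convex_halfSpace n).prod convex_univ)
  -- `extSpray` is `spray` after this retraction, so bounds near `z₀` within the half-space become
  -- bounds on a full neighborhood.
  have hP : LipschitzWith 2 (fun z : Vec n × Vec n ↦ (toHalfSpace z.1, z.2)) := by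
    have h1 : LipschitzWith (2 * 1) (fun z : Vec n × Vec n ↦ toHalfSpace z.1) :=
      lipschitzWith_toHalfSpace.comp LipschitzWith.prod_fst
    have h2 : LipschitzWith 1 (fun z : Vec n × Vec n ↦ z.2) := LipschitzWith.prod_snd
    exact (h1.prodMk h2).weaken (by simp)
  have hPz : ((toHalfSpace z₀.1, z₀.2) : Vec n × Vec n) = z₀ := by rw [toHalfSpace_of_mem hz₀H]
  have hPt : Tendsto (fun z : Vec n × Vec n ↦ (toHalfSpace z.1, z.2)) (𝓝 z₀)
      (𝓝[halfSpace n ×ˢ univ] z₀) := by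
    refine tendsto_nhdsWithin_iff.2 ⟨?_, Eventually.of_forall fun z ↦ ⟨toHalfSpace_mem _, trivial⟩⟩
    have := hP.continuous.tendsto z₀
    rwa [hPz] at this
  have e1 : ∀ᶠ z in 𝓝 z₀, ((toHalfSpace z.1, z.2) : Vec n × Vec n) ∈ t := hPt ht
  have e2 : ∀ᶠ z in 𝓝 z₀, ‖extSpray g x₀ z‖ < ‖spray g x₀ z₀‖ + 1 := by
    have h1 : Tendsto (extSpray g x₀) (𝓝 z₀) (𝓝 (spray g x₀ z₀)) :=
      hcd.continuousWithinAt.tendsto.comp hPt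
    exact h1.norm.eventually_lt_const (by linarith)
  have e3 : ∀ᶠ z in 𝓝 z₀, z.1 ∈ halfSpace n → z.1 ∈ (extChartAt (𝓡∂ n) x₀).target ∧ p z := by
    have h1 : ∀ᶠ z in 𝓝[{z : Vec n × Vec n | z.1 ∈ halfSpace n}] z₀,
        z.1 ∈ (extChartAt (𝓡∂ n) x₀).target := by
      have h2 : {z : Vec n × Vec n | z.1 ∈ halfSpace n} = halfSpace n ×ˢ univ := by
        ext z; simp
      rw [h2]
      filter_upwards [htgt] with z hz using hz.1
    exact eventually_nhdsWithin_iff.1 (h1.and hp)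
  obtain ⟨ε, hε, hball⟩ := Metric.eventually_nhds_iff_ball.1 (e1.and (e2.and e3))
  have hsub : ∀ z ∈ Metric.closedBall z₀ (2 * (ε / 4)), z ∈ Metric.ball z₀ ε := fun z hz ↦
    Metric.closedBall_subset_ball (by linarith) hz
  refine ⟨ε / 4, ‖spray g x₀ z₀‖ + 1, K * 2, by linarith, by positivity, ?_, ?_, ?_⟩
  · exact hK.comp (t := t) (hP.lipschitzOnWith) (fun z hz ↦ (hball z (hsub z hz)).1)
  · exact fun z hz ↦ (hball z (hsub z hz)).2.1.le
  · exact fun z hz ↦ (hball z (hsub z hz)).2.2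

/-- A solution of the geodesic equation in coordinates which stays in the half-space gives an
integral curve of the geodesic spray. -/
theorem isIntegral_ofCoords {x₀ : M} {α : ℝ → Vec n × Vec n} {s : Set ℝ}
    (hα : ∀ t ∈ s, (α t).1 ∈ (extChartAt (𝓡∂ n) x₀).target)
    (hd : ∀ t ∈ s, HasDerivWithinAt α (extSpray g x₀ (α t)) s t) :
    IsIntegral g (fun t ↦ ofCoords x₀ (α t)) s := by
  have hsrc : ∀ t ∈ s, (ofCoords x₀ (α t)).1 ∈ (extChartAt (𝓡∂ n) x₀).source := fun t ht ↦
    (extChartAt (𝓡∂ n) x₀).map_target (hα t ht)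
  refine IsIntegral.of_chart ?_ ?_
  · exact (continuousOn_ofCoords x₀).comp (fun t ht ↦ (hd t ht).continuousWithinAt) hα
  · intro t ht
    refine ⟨x₀, hsrc t ht, ?_⟩
    rw [coords_ofCoords x₀ (hα t ht)]
    have := hd t ht
    rw [extSpray_of_mem g x₀ (extChartAt_target_subset_range x₀ (hα t ht))] at this
    exact this.congr (fun r hr ↦ coords_ofCoords x₀ (hα r hr)) (coords_ofCoords x₀ (hα t ht))

variable [T2Space M]

/-- Integral curves which start in a small ball stay in a larger ball for a while. -/
theorem IsIntegral.mem_closedBall {x₀ : M} {z₀ : Vec n × Vec n} {ρ A r : ℝ} {p : Vec n × Vec n → Prop}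
    (hρ : 0 < ρ) (hA : 0 < A) (hr : A * r ≤ ρ / 2)
    (hF : ∀ z ∈ Metric.closedBall z₀ (2 * ρ), ‖extSpray g x₀ z‖ ≤ A)
    (hp : ∀ z ∈ Metric.closedBall z₀ (2 * ρ), z.1 ∈ halfSpace n →
        z.1 ∈ (extChartAt (𝓡∂ n) x₀).target ∧ p z)
    {Z : ℝ → TangentBundle (𝓡∂ n) M} (hZ : IsIntegral g Z (Icc 0 r))
    (hsrc : (Z 0).1 ∈ (extChartAt (𝓡∂ n) x₀).source)
    (h0 : coords x₀ (Z 0) ∈ Metric.closedBall z₀ ρ) :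
    ∀ t ∈ Icc 0 r, (Z t).1 ∈ (extChartAt (𝓡∂ n) x₀).source ∧
      coords x₀ (Z t) ∈ Metric.closedBall z₀ (2 * ρ) := by
  -- The compact part of the chart domain over the closed ball. It is closed in the Hausdorff space
  -- `M`, so limits of points of the curve cannot leave the chart.
  set B : Set M := (extChartAt (𝓡∂ n) x₀).symm ''
    (Prod.fst '' (Metric.closedBall z₀ (2 * ρ) ∩ {z | z.1 ∈ halfSpace n})) with hB
  have hBsrc : B ⊆ (extChartAt (𝓡∂ n) x₀).source := by
    rintro _ ⟨_, ⟨z, hz, rfl⟩, rfl⟩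
    exact (extChartAt (𝓡∂ n) x₀).map_target (hp z hz.1 hz.2).1
  have hBclosed : IsClosed B := by
    refine IsCompact.isClosed (IsCompact.image_of_continuousOn ?_ ?_)
    · refine IsCompact.image ?_ continuous_fst
      exact (isCompact_closedBall _ _).inter_right ((isClosed_halfSpace n).preimage continuous_fst)
    · refine (continuousOn_extChartAt_symm x₀).mono ?_
      rintro _ ⟨z, hz, rfl⟩
      exact (hp z hz.1 hz.2).1
  have hBmem : ∀ t, (Z t).1 ∈ (extChartAt (𝓡∂ n) x₀).source →
      coords x₀ (Z t) ∈ Metric.closedBall z₀ (2 * ρ) → (Z t).1 ∈ B := by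
    intro t ht hc
    exact ⟨_, ⟨coords x₀ (Z t), ⟨hc, mem_range_self _⟩, rfl⟩, (extChartAt (𝓡∂ n) x₀).left_inv ht⟩
  have hcc : ∀ t ∈ Icc 0 r, (Z t).1 ∈ (extChartAt (𝓡∂ n) x₀).source →
      ContinuousWithinAt (fun t ↦ coords x₀ (Z t)) (Icc 0 r) t := fun t ht h ↦
    (hZ.2 t ht x₀ h).continuousWithinAt
  rcases lt_or_ge r 0 with hr0 | hr0
  · intro t ht
    exact absurd (ht.1.trans ht.2) (not_le.2 hr0)
  -- Continuous induction on the linear estimate, which up to time `r` permits only a distance `ρ /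
  -- 2` and so keeps the curve strictly inside the larger ball.
  set S : Set ℝ := {t | (Z t).1 ∈ (extChartAt (𝓡∂ n) x₀).source ∧
    dist (coords x₀ (Z t)) (coords x₀ (Z 0)) ≤ A * t} with hS
  have hSball : ∀ t ∈ Icc 0 r, dist (coords x₀ (Z t)) (coords x₀ (Z 0)) ≤ A * t →
      dist (coords x₀ (Z t)) z₀ ≤ ρ + ρ / 2 := by
    intro t ht hd
    have h1 := dist_triangle (coords x₀ (Z t)) (coords x₀ (Z 0)) z₀
    have h2 := Metric.mem_closedBall.1 h0
    have h3 : A * t ≤ A * r := mul_le_mul_of_nonneg_left ht.2 hA.le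
    linarith
  have hmain : Icc 0 r ⊆ S := by
    refine IsClosed.Icc_subset_of_forall_exists_gt ?_ ⟨hsrc, by simp⟩ ?_
    · rw [← isSeqClosed_iff_isClosed]
      intro u t hu hut
      have htI : t ∈ Icc 0 r := isClosed_Icc.mem_of_tendsto hut (Eventually.of_forall fun k ↦ (hu k).2)
      have hut' : Tendsto u atTop (𝓝[Icc 0 r] t) :=
        tendsto_nhdsWithin_iff.2 ⟨hut, Eventually.of_forall fun k ↦ (hu k).2⟩
      have hZt : Tendsto (fun k ↦ (Z (u k)).1) atTop (𝓝 (Z t).1) :=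
        (continuous_base.tendsto _).comp ((hZ.1 t htI).tendsto.comp hut')
      have hmem : (Z t).1 ∈ (extChartAt (𝓡∂ n) x₀).source := by
        refine hBsrc (hBclosed.mem_of_tendsto hZt (Eventually.of_forall fun k ↦ ?_))
        refine hBmem _ (hu k).1.1 (Metric.mem_closedBall.2 ?_)
        linarith [hSball _ (hu k).2 (hu k).1.2]
      refine ⟨⟨hmem, ?_⟩, htI⟩
      have h1 := ((hcc t htI hmem).tendsto.comp hut').dist
        (tendsto_const_nhds (x := coords x₀ (Z 0)))
      exact le_of_tendsto_of_tendsto' h1 (hut.const_mul A) fun k ↦ (hu k).1.2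
    · rintro t ⟨⟨hmem, hd⟩, ht⟩ y hy
      have htI : t ∈ Icc 0 r := ⟨ht.1, ht.2.le⟩
      have e1 : ∀ᶠ s in 𝓝[Icc 0 r] t, (Z s).1 ∈ (extChartAt (𝓡∂ n) x₀).source ∧
          dist (coords x₀ (Z s)) z₀ < 2 * ρ := by
        refine Eventually.and (hZ.1 t htI ((isOpen_chartDomain x₀).mem_nhds hmem)) ?_
        have h1 := (hcc t htI hmem).tendsto.dist (tendsto_const_nhds (x := z₀))
        exact h1.eventually_lt_const (by linarith [hSball t htI hd])
      obtain ⟨ε, hε, h⟩ := Metric.mem_nhdsWithin_iff.1 e1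
      set t' := min (min y r) (t + ε / 2) with ht'
      have htt' : t < t' := by
        rw [ht', lt_min_iff, lt_min_iff]
        exact ⟨⟨hy, ht.2⟩, by linarith⟩
      have ht'y : t' ≤ y := (min_le_left _ _).trans (min_le_left _ _)
      have ht'r : t' ≤ r := (min_le_left _ _).trans (min_le_right _ _)
      have ht'ε : t' ≤ t + ε / 2 := min_le_right _ _
      have hin : ∀ s ∈ Icc t t', (Z s).1 ∈ (extChartAt (𝓡∂ n) x₀).source ∧
          dist (coords x₀ (Z s)) z₀ < 2 * ρ := by
        intro s hs
        refine h ⟨?_, htI.1.trans hs.1, hs.2.trans ht'r⟩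
        rw [Metric.mem_ball, Real.dist_eq, abs_lt]
        constructor <;> linarith [hs.1, hs.2]
      refine ⟨t', ⟨(hin t' ⟨htt'.le, le_rfl⟩).1, ?_⟩, htt', ht'y⟩
      have hsubI : Icc t t' ⊆ Icc 0 r := Icc_subset_Icc ht.1 ht'r
      have hbound := (convex_Icc t t').norm_image_sub_le_of_norm_hasDerivWithin_le
        (f := fun s ↦ coords x₀ (Z s)) (f' := fun s ↦ spray g x₀ (coords x₀ (Z s))) (C := A)
        (fun s hs ↦ (hZ.2 s (hsubI hs) x₀ (hin s hs).1).mono hsubI) (by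
          intro s hs
          have h1 := hF (coords x₀ (Z s)) (hin s hs).2.le
          rwa [extSpray_of_mem g x₀ (mem_range_self _)] at h1)
        (left_mem_Icc.2 htt'.le) (right_mem_Icc.2 htt'.le)
      rw [Real.norm_of_nonneg (by linarith), ← dist_eq_norm] at hbound
      have := dist_triangle (coords x₀ (Z t')) (coords x₀ (Z t)) (coords x₀ (Z 0))
      linarith
  intro t ht
  refine ⟨(hmain ht).1, Metric.mem_closedBall.2 ?_⟩
  linarith [hSball t ht (hmain ht).2]

end Local

/-! ### The lightlike geodesic flow as a relation -/

section Flow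

variable {n : ℕ} [NeZero n]
  {M : Type*} [TopologicalSpace M] [ChartedSpace (EuclideanHalfSpace n) M]
  [IsManifold (𝓡∂ n) ∞ M] {g : LorentzMetric n M} {T : TimeOrientation g}

/-- There is a future-directed lightlike geodesic, parametrized by `[0, s]`, which has initial
velocity `x` and final velocity `y`; the case `s = 0` is allowed. -/
def Flow (T : TimeOrientation g) (s : ℝ) (x y : TangentBundle (𝓡∂ n) M) : Prop :=
  0 ≤ s ∧ ∃ Z : ℝ → TangentBundle (𝓡∂ n) M, IsIntegral g Z (Icc 0 s) ∧
    (∀ t ∈ Icc 0 s, Z t ∈ futureLightlike T) ∧ Z 0 = x ∧ Z s = y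

theorem tsmul_one (v : TangentBundle (𝓡∂ n) M) : tsmul 1 v = v := by
  simp only [tsmul, one_smul]
  rfl

theorem tsmul_tsmul (c d : ℝ) (v : TangentBundle (𝓡∂ n) M) :
    tsmul c (tsmul d v) = tsmul (c * d) v := by
  simp only [tsmul, mul_smul]
  rfl

theorem vecOf_tsmul (c : ℝ) (v : TangentBundle (𝓡∂ n) M) : vecOf (tsmul c v) = c • vecOf v := rfl

theorem tsmul_mem_futureLightlike {c : ℝ} (hc : 0 < c) {v : TangentBundle (𝓡∂ n) M}
    (hv : v ∈ futureLightlike T) : tsmul c v ∈ futureLightlike T := by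
  rw [mem_futureLightlike_iff] at hv ⊢
  rw [vecOf_tsmul]
  simp only [map_smul, smul_apply, smul_eq_mul]
  change c * (c * g.form v.1 (vecOf v) (vecOf v)) = 0 ∧
    c * g.form v.1 (vecOf v) (T.field v.1 : Vec n) < 0
  exact ⟨by rw [hv.1]; simp, mul_neg_of_pos_of_neg hc hv.2⟩

theorem Flow.refl {x : TangentBundle (𝓡∂ n) M} (hx : x ∈ futureLightlike T) : Flow T 0 x x := by
  refine ⟨le_rfl, fun _ ↦ x, ?_, fun _ _ ↦ hx, rfl, rfl⟩
  rw [Icc_self]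
  exact isIntegral_singleton x 0

theorem Flow.nonneg {s : ℝ} {x y : TangentBundle (𝓡∂ n) M} (h : Flow T s x y) : 0 ≤ s := h.1

theorem Flow.left_mem {s : ℝ} {x y : TangentBundle (𝓡∂ n) M} (h : Flow T s x y) :
    x ∈ futureLightlike T := by
  obtain ⟨hs, Z, _, hZ, rfl, _⟩ := h
  exact hZ 0 (left_mem_Icc.2 hs)

theorem Flow.right_mem {s : ℝ} {x y : TangentBundle (𝓡∂ n) M} (h : Flow T s x y) :
    y ∈ futureLightlike T := by
  obtain ⟨hs, Z, _, hZ, _, rfl⟩ := h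
  exact hZ s (right_mem_Icc.2 hs)

theorem Flow.eq_of_zero {x y : TangentBundle (𝓡∂ n) M} (h : Flow T 0 x y) : x = y := by
  obtain ⟨_, Z, _, _, rfl, rfl⟩ := h
  rfl

theorem IsIntegral.flow {Z : ℝ → TangentBundle (𝓡∂ n) M} {a b t t' : ℝ}
    (hZ : IsIntegral g Z (Icc a b)) (hX : ∀ t ∈ Icc a b, Z t ∈ futureLightlike T) (hat : a ≤ t)
    (htt' : t ≤ t') (htb : t' ≤ b) : Flow T (t' - t) (Z t) (Z t') := by
  have hmem : ∀ r ∈ Icc 0 (t' - t), 1 * r + t ∈ Icc a b := fun r hr ↦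
    ⟨by linarith [hr.1], by linarith [hr.2]⟩
  refine ⟨by linarith, _, hZ.affine 1 t hmem, fun r hr ↦ ?_, ?_, ?_⟩
  · rw [tsmul_one]
    exact hX _ (hmem r hr)
  · simp [tsmul_one]
  · simp [tsmul_one]

theorem Flow.split {s r : ℝ} {x y : TangentBundle (𝓡∂ n) M} (h : Flow T s x y) (hr : r ∈ Icc 0 s) :
    ∃ z, Flow T r x z ∧ Flow T (s - r) z y := by
  obtain ⟨hs, Z, hZ, hX, rfl, rfl⟩ := h
  refine ⟨Z r, ?_, hZ.flow hX hr.1 hr.2 le_rfl⟩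
  simpa using hZ.flow hX le_rfl hr.1 hr.2

theorem Flow.trans {s t : ℝ} {x y z : TangentBundle (𝓡∂ n) M} (h : Flow T s x y)
    (h' : Flow T t y z) : Flow T (s + t) x z := by
  obtain ⟨hs, Z, hZ, hX, rfl, rfl⟩ := h
  obtain ⟨ht, W, hW, hX', hW0, rfl⟩ := h'
  have hmem : ∀ r ∈ Icc s (s + t), 1 * r + (-s) ∈ Icc 0 t := fun r hr ↦
    ⟨by linarith [hr.1], by linarith [hr.2]⟩
  have hW' := hW.affine 1 (-s) hmem
  have e0 : tsmul 1 (W (1 * s + (-s))) = W 0 := by rw [tsmul_one]; congr 1; ring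
  refine ⟨by linarith, _, hZ.concat hs (by linarith) hW' (by rw [e0, hW0]), fun r hr ↦ ?_, ?_, ?_⟩
  · by_cases hrs : r ≤ s
    · simp only [hrs, if_true]
      exact hX r ⟨hr.1, hrs⟩
    · simp only [hrs, if_false, tsmul_one]
      exact hX' _ (hmem r ⟨(not_le.1 hrs).le, hr.2⟩)
  · simp [hs]
  · by_cases hst : s + t ≤ s
    · have ht0 : t = 0 := by linarith
      subst ht0
      simp [hW0]
    · simp only [hst, if_false, tsmul_one]
      congr 1
      ring

theorem Flow.smul {s c : ℝ} {x y : TangentBundle (𝓡∂ n) M} (h : Flow T s x y) (hc : 0 < c) :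
    Flow T (s / c) (tsmul c x) (tsmul c y) := by
  obtain ⟨hs, Z, hZ, hX, rfl, rfl⟩ := h
  have hmem : ∀ r ∈ Icc 0 (s / c), c * r + 0 ∈ Icc 0 s := by
    intro r hr
    refine ⟨by have := mul_nonneg hc.le hr.1; linarith, ?_⟩
    have := (le_div_iff₀ hc).1 hr.2
    linarith
  refine ⟨div_nonneg hs hc.le, _, hZ.affine c 0 hmem, fun r hr ↦
    tsmul_mem_futureLightlike hc (hX _ (hmem r hr)), by simp, ?_⟩
  simp only [add_zero]
  rw [mul_div_cancel₀ _ hc.ne']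

/-- The opposite time orientation. -/
def TimeOrientation.reverse (T : TimeOrientation g) : TimeOrientation g where
  field := fun p ↦ -T.field p
  timelike := fun p ↦ by simpa using T.timelike p
  contMDiff := T.contMDiff.neg_section

theorem TimeOrientation.reverse_reverse (T : TimeOrientation g) : T.reverse.reverse = T := by
  obtain ⟨f, h1, h2⟩ := T
  simp [TimeOrientation.reverse]

theorem form_reverse_field (T : TimeOrientation g) (p : M) (v : Vec n) :
    g.form p v (T.reverse.field p : Vec n) = -g.form p v (T.field p : Vec n) :=
  map_neg (g.form p v) (T.field p)

theorem neg_mem_futureLightlike {v : TangentBundle (𝓡∂ n) M} (hv : v ∈ futureLightlike T) :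
    tsmul (-1) v ∈ futureLightlike T.reverse := by
  rw [mem_futureLightlike_iff] at hv ⊢
  rw [form_reverse_field, vecOf_tsmul]
  simp only [map_smul, smul_apply, smul_eq_mul]
  change -1 * (-1 * g.form v.1 (vecOf v) (vecOf v)) = 0 ∧
    -(-1 * g.form v.1 (vecOf v) (T.field v.1 : Vec n)) < 0
  exact ⟨by rw [hv.1]; simp, by linarith [hv.2]⟩

/-- Negated velocities are future-directed for the opposite orientation; statements about the past
thus follow from those about the future. -/
theorem Flow.reverse {s : ℝ} {x y : TangentBundle (𝓡∂ n) M} (h : Flow T s x y) :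
    Flow T.reverse s (tsmul (-1) y) (tsmul (-1) x) := by
  obtain ⟨hs, Z, hZ, hX, rfl, rfl⟩ := h
  have hmem : ∀ r ∈ Icc 0 s, -1 * r + s ∈ Icc 0 s := fun r hr ↦
    ⟨by linarith [hr.2], by linarith [hr.1]⟩
  refine ⟨hs, _, hZ.affine (-1) s hmem, fun r hr ↦ neg_mem_futureLightlike (hX _ (hmem r hr)),
    by simp, by simp⟩

theorem Flow.of_reverse {s : ℝ} {x y : TangentBundle (𝓡∂ n) M}
    (h : Flow T.reverse s (tsmul (-1) y) (tsmul (-1) x)) : Flow T s x y := by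
  have := h.reverse
  rwa [T.reverse_reverse, tsmul_tsmul, tsmul_tsmul, show (-1 : ℝ) * -1 = 1 by norm_num, tsmul_one,
    tsmul_one] at this

theorem flow_of_geodesic {γ : ℝ → M} {a b t t' : ℝ} (h : IsFutureLightlikeGeodesic T γ a b)
    (hat : a ≤ t) (htt' : t ≤ t') (htb : t' ≤ b) :
    Flow T (t' - t) (velocity γ a b t) (velocity γ a b t') :=
  h.1.isIntegral.flow h.2 hat htt' htb

theorem Flow.exists_geodesic {s : ℝ} {x y : TangentBundle (𝓡∂ n) M} (h : Flow T s x y)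
    (hs : 0 < s) : ∃ γ : ℝ → M, IsFutureLightlikeGeodesic T γ 0 s ∧ velocity γ 0 s 0 = x ∧
      velocity γ 0 s s = y := by
  obtain ⟨_, Z, hZ, hX, rfl, rfl⟩ := h
  obtain ⟨h1, h2⟩ := hZ.isGeodesic hs
  refine ⟨_, ⟨h1, fun t ht ↦ ?_⟩, h2 0 (left_mem_Icc.2 hs.le), h2 s (right_mem_Icc.2 hs.le)⟩
  rw [h2 t ht]
  exact hX t ht

theorem eq_of_coords {x₀ : M} {v w : TangentBundle (𝓡∂ n) M}
    (hv : v.1 ∈ (extChartAt (𝓡∂ n) x₀).source) (hw : w.1 ∈ (extChartAt (𝓡∂ n) x₀).source)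
    (h : coords x₀ v = coords x₀ w) : v = w := by
  rw [← ofCoords_coords x₀ hv, h, ofCoords_coords x₀ hw]

theorem continuousAt_coords {x₀ : M} {v : TangentBundle (𝓡∂ n) M}
    (hv : v.1 ∈ (extChartAt (𝓡∂ n) x₀).source) : ContinuousAt (coords x₀) v :=
  (continuousOn_coords x₀).continuousAt ((isOpen_chartDomain x₀).mem_nhds hv)

/-- Two limits have the same base point, since `M` is Hausdorff, and then the same coordinates in a
chart at this point. -/
theorem t2Space_tangentBundle [T2Space M] : T2Space (TangentBundle (𝓡∂ n) M) := by
  refine t2_iff_ultrafilter.2 fun {v w} f hv hw ↦ ?_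
  have h1 : Tendsto (fun u : TangentBundle (𝓡∂ n) M ↦ u.1) f (𝓝 v.1) :=
    (continuous_base.tendsto v).mono_left hv
  have h2 : Tendsto (fun u : TangentBundle (𝓡∂ n) M ↦ u.1) f (𝓝 w.1) :=
    (continuous_base.tendsto w).mono_left hw
  have hvw := tendsto_nhds_unique h1 h2
  have hv' := mem_extChartAt_source (I := 𝓡∂ n) v.1
  have hw' : w.1 ∈ (extChartAt (𝓡∂ n) v.1).source := hvw ▸ hv'
  exact eq_of_coords hv' hw' (tendsto_nhds_unique ((continuousAt_coords hv').tendsto.mono_left hv)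
    ((continuousAt_coords hw').tendsto.mono_left hw))

theorem eventually_timeForm_neg {x₀ : M} {z₀ : Vec n × Vec n}
    (hz₀ : z₀.1 ∈ (extChartAt (𝓡∂ n) x₀).target) (h : timeForm T x₀ z₀.1 z₀.2 < 0) :
    ∀ᶠ z in 𝓝[{z : Vec n × Vec n | z.1 ∈ halfSpace n}] z₀, timeForm T x₀ z.1 z.2 < 0 := by
  have h1 : ContinuousWithinAt (timeForm T x₀) (halfSpace n) z₀.1 :=
    ((contDiffOn_timeForm T x₀).continuousOn z₀.1 hz₀).mono_of_mem_nhdsWithin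
      (extChartAt_target_mem_nhdsWithin_of_mem hz₀)
  have h2 : ContinuousWithinAt (fun z : Vec n × Vec n ↦ timeForm T x₀ z.1 z.2)
      {z : Vec n × Vec n | z.1 ∈ halfSpace n} z₀ :=
    (h1.comp continuous_fst.continuousWithinAt (fun z hz ↦ hz)).clm_apply
      continuous_snd.continuousWithinAt
  exact h2.tendsto.eventually_lt_const h

theorem continuousOn_metricForm_apply (g : LorentzMetric n M) (x₀ : M) :
    ContinuousOn (fun z : Vec n × Vec n ↦ metricForm g x₀ z.1 z.2 z.2)
      {z | z.1 ∈ (extChartAt (𝓡∂ n) x₀).target} :=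
  ((((contDiffOn_metricForm g x₀).continuousOn.comp continuous_fst.continuousOn
    (fun _ hz ↦ hz)).clm_apply continuous_snd.continuousOn)).clm_apply continuous_snd.continuousOn

variable [T2Space M]

/-- Limits of short future-directed lightlike geodesics. -/
theorem exists_local_flow_limit {x : TangentBundle (𝓡∂ n) M} (hx : x ∈ futureLightlike T) :
    ∃ O ∈ 𝓝 x, ∃ δ > 0, ∀ (u w : ℕ → TangentBundle (𝓡∂ n) M) (r : ℕ → ℝ)
      (y : TangentBundle (𝓡∂ n) M) (r' : ℝ), y ∈ O → Tendsto u atTop (𝓝 y) →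
      Tendsto r atTop (𝓝 r') → (∀ k, r k ≤ δ) → (∀ k, Flow T (r k) (u k) (w k)) →
      ∃ z, Flow T r' y z ∧ Tendsto w atTop (𝓝 z) := by
  set x₀ := x.1 with hx₀
  have hxs : x.1 ∈ (extChartAt (𝓡∂ n) x₀).source := mem_extChartAt_source x₀
  have hxc := (mem_futureLightlike_iff_coords hxs).1 hx
  set z₀ := coords x₀ x with hz₀
  have hz₀t : z₀.1 ∈ (extChartAt (𝓡∂ n) x₀).target := (extChartAt (𝓡∂ n) x₀).map_source hxs
  obtain ⟨ρ, A, K, hρ, hA, hK, hF, hp⟩ := exists_good_ball g x₀ hz₀t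
    (eventually_timeForm_neg (T := T) hz₀t hxc.2)
  set O : Set (TangentBundle (𝓡∂ n) M) := {v | v.1 ∈ (extChartAt (𝓡∂ n) x₀).source} ∩
    coords x₀ ⁻¹' Metric.ball z₀ ρ with hO
  have hOo : IsOpen O := (continuousOn_coords x₀).isOpen_inter_preimage (isOpen_chartDomain x₀)
    Metric.isOpen_ball
  refine ⟨O, hOo.mem_nhds ⟨hxs, Metric.mem_ball_self hρ⟩, ρ / (2 * A), by positivity, ?_⟩
  intro u w r y r' hy hu hr hrδ hfl
  have hδ0 : 0 ≤ ρ / (2 * A) := by positivity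
  have hAδ : A * (ρ / (2 * A)) = ρ / 2 := by field_simp
  -- `α` solves the extended equation and might leave the half-space; only its closeness to the
  -- given geodesics will show that it does not.
  obtain ⟨α, hα0, hα⟩ := exists_solution_mem_closedBall hρ.le hA.le hδ0 (by linarith) hK hF
    (Metric.ball_subset_closedBall hy.2)
  have hr0 : ∀ k, 0 ≤ r k := fun k ↦ (hfl k).1
  have hr'0 : 0 ≤ r' := ge_of_tendsto' hr hr0
  have hr'δ : r' ≤ ρ / (2 * A) := le_of_tendsto' hr hrδ
  choose Z hZ hX hZ0 hZr using fun k ↦ (hfl k).2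
  have huO : ∀ᶠ k in atTop, u k ∈ O := hu (hOo.mem_nhds hy)
  have hstay : ∀ᶠ k in atTop, ∀ t ∈ Icc 0 (r k), (Z k t).1 ∈ (extChartAt (𝓡∂ n) x₀).source ∧
      coords x₀ (Z k t) ∈ Metric.closedBall z₀ (2 * ρ) := by
    filter_upwards [huO] with k hk
    refine IsIntegral.mem_closedBall hρ hA ?_ hF hp (hZ k) ?_ ?_
    · have := mul_le_mul_of_nonneg_left (hrδ k) hA.le
      linarith
    · rw [hZ0]; exact hk.1
    · rw [hZ0]; exact Metric.ball_subset_closedBall hk.2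
  -- Grönwall's inequality: the distance to `α` is controlled by that of the initial vectors,
  -- uniformly in time.
  have hgron : ∀ᶠ k in atTop, ∀ t ∈ Icc 0 (r k), dist (coords x₀ (Z k t)) (α t) ≤
      dist (coords x₀ (u k)) (coords x₀ y) * Real.exp (K * (ρ / (2 * A))) := by
    filter_upwards [hstay] with k hk t ht
    have hsub : Icc 0 (r k) ⊆ Icc 0 (ρ / (2 * A)) := Icc_subset_Icc_right (hrδ k)
    have h1 := dist_le_of_trajectories_ODE_of_mem (v := fun _ ↦ extSpray g x₀)
      (s := fun _ ↦ Metric.closedBall z₀ (2 * ρ)) (K := K) (a := 0) (b := r k)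
      (f := fun t ↦ coords x₀ (Z k t)) (g := α) (δ := dist (coords x₀ (u k)) (coords x₀ y))
      (fun _ _ ↦ hK)
      (fun t ht ↦ ((hZ k).2 t ht x₀ (hk t ht).1).continuousWithinAt)
      (by
        intro t ht
        have h2 := (hZ k).2 t (Ico_subset_Icc_self ht) x₀ (hk t (Ico_subset_Icc_self ht)).1
        rw [extSpray_of_mem g x₀ (mem_range_self _)]
        exact h2.mono_of_mem_nhdsWithin (Icc_mem_nhdsGE_of_mem ht))
      (fun t ht ↦ (hk t (Ico_subset_Icc_self ht)).2)
      (fun t ht ↦ ((hα t (hsub ht)).2.continuousWithinAt).mono hsub)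
      (by
        intro t ht
        exact ((hα t (hsub (Ico_subset_Icc_self ht))).2.mono hsub).mono_of_mem_nhdsWithin
          (Icc_mem_nhdsGE_of_mem ht))
      (fun t ht ↦ (hα t (hsub (Ico_subset_Icc_self ht))).1)
      (by rw [hZ0, hα0]) t ht
    refine h1.trans (mul_le_mul_of_nonneg_left (Real.exp_le_exp.2 ?_) dist_nonneg)
    refine mul_le_mul_of_nonneg_left ?_ K.2
    linarith [ht.2, hrδ k]
  have hcu : Tendsto (fun k ↦ coords x₀ (u k)) atTop (𝓝 (coords x₀ y)) :=
    (continuousAt_coords hy.1).tendsto.comp hu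
  have hlim : ∀ (t : ℕ → ℝ) (t' : ℝ), (∀ k, t k ∈ Icc 0 (r k)) → Tendsto t atTop (𝓝 t') →
      Tendsto (fun k ↦ coords x₀ (Z k (t k))) atTop (𝓝 (α t')) := by
    intro t t' ht htt'
    have htδ : ∀ k, t k ∈ Icc 0 (ρ / (2 * A)) := fun k ↦ ⟨(ht k).1, (ht k).2.trans (hrδ k)⟩
    have ht'δ : t' ∈ Icc 0 (ρ / (2 * A)) :=
      isClosed_Icc.mem_of_tendsto htt' (Eventually.of_forall htδ)
    have h1 : Tendsto (fun k ↦ α (t k)) atTop (𝓝 (α t')) :=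
      (hα t' ht'δ).2.continuousWithinAt.tendsto.comp
        (tendsto_nhdsWithin_iff.2 ⟨htt', Eventually.of_forall htδ⟩)
    have h2 : Tendsto (fun k ↦ dist (coords x₀ (u k)) (coords x₀ y) *
        Real.exp (K * (ρ / (2 * A)))) atTop (𝓝 0) := by
      have := (tendsto_iff_dist_tendsto_zero.1 hcu).mul_const (Real.exp (K * (ρ / (2 * A))))
      rwa [zero_mul] at this
    have h3 : Tendsto (fun k ↦ dist (α (t k)) (coords x₀ (Z k (t k)))) atTop (𝓝 0) := by
      refine squeeze_zero' (Eventually.of_forall fun k ↦ dist_nonneg) ?_ h2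
      filter_upwards [hgron] with k hk
      rw [dist_comm]
      exact hk (t k) (ht k)
    exact (tendsto_iff_of_dist h3).1 h1
  -- The `k`-th geodesic is available only up to time `r k`, hence the truncation of `t`.
  have hlim' : ∀ t ∈ Icc 0 r', Tendsto (fun k ↦ coords x₀ (Z k (min t (r k)))) atTop
      (𝓝 (α t)) := by
    intro t ht
    refine hlim _ t (fun k ↦ ⟨le_min ht.1 (hr0 k), min_le_right _ _⟩) ?_
    have := (tendsto_const_nhds (x := t)).min hr
    rwa [min_eq_left ht.2] at this
  have hsub' : Icc 0 r' ⊆ Icc 0 (ρ / (2 * A)) := Icc_subset_Icc_right hr'δ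
  -- As a limit of points of the closed half-space, `α` stays in it up to time `r'`.
  have hαH : ∀ t ∈ Icc 0 r', (α t).1 ∈ halfSpace n := fun t ht ↦
    (isClosed_halfSpace n).mem_of_tendsto ((continuous_fst.tendsto _).comp (hlim' t ht))
      (Eventually.of_forall fun k ↦ mem_range_self _)
  have hαt : ∀ t ∈ Icc 0 r', (α t).1 ∈ (extChartAt (𝓡∂ n) x₀).target ∧
      timeForm T x₀ (α t).1 (α t).2 < 0 := fun t ht ↦
    hp (α t) (hα t (hsub' ht)).1 (hαH t ht)
  have hαnull : ∀ t ∈ Icc 0 r', metricForm g x₀ (α t).1 (α t).2 (α t).2 = 0 := by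
    intro t ht
    have h1 := (continuousOn_metricForm_apply g x₀ (α t) (hαt t ht).1)
    have hmem : ∀ k, min t (r k) ∈ Icc 0 (r k) := fun k ↦ ⟨le_min ht.1 (hr0 k), min_le_right _ _⟩
    have h2 : Tendsto (fun k ↦ coords x₀ (Z k (min t (r k)))) atTop
        (𝓝[{z | z.1 ∈ (extChartAt (𝓡∂ n) x₀).target}] (α t)) := by
      refine tendsto_nhdsWithin_iff.2 ⟨hlim' t ht, ?_⟩
      filter_upwards [hstay] with k hk
      exact (extChartAt (𝓡∂ n) x₀).map_source (hk _ (hmem k)).1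
    refine tendsto_nhds_unique (h1.tendsto.comp h2) (tendsto_const_nhds.congr' ?_)
    filter_upwards [hstay] with k hk
    exact ((mem_futureLightlike_iff_coords (hk _ (hmem k)).1).1 (hX k _ (hmem k))).1.symm
  refine ⟨ofCoords x₀ (α r'), ⟨hr'0, fun t ↦ ofCoords x₀ (α t), ?_, ?_, ?_, rfl⟩, ?_⟩
  · exact isIntegral_ofCoords (fun t ht ↦ (hαt t ht).1) (fun t ht ↦ (hα t (hsub' ht)).2.mono hsub')
  · intro t ht
    rw [mem_futureLightlike_iff_coords (x₀ := x₀)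
      ((extChartAt (𝓡∂ n) x₀).map_target (hαt t ht).1), coords_ofCoords x₀ (hαt t ht).1]
    exact ⟨hαnull t ht, (hαt t ht).2⟩
  · simp only [hα0]
    exact ofCoords_coords x₀ hy.1
  · have h1 := continuousOn_ofCoords x₀ (α r') (hαt r' (right_mem_Icc.2 hr'0)).1
    have hmem : ∀ k, r k ∈ Icc 0 (r k) := fun k ↦ right_mem_Icc.2 (hr0 k)
    have h2 : Tendsto (fun k ↦ coords x₀ (Z k (r k))) atTop
        (𝓝[{z | z.1 ∈ (extChartAt (𝓡∂ n) x₀).target}] (α r')) := by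
      refine tendsto_nhdsWithin_iff.2 ⟨hlim r r' hmem hr, ?_⟩
      filter_upwards [hstay] with k hk
      exact (extChartAt (𝓡∂ n) x₀).map_source (hk _ (hmem k)).1
    refine (h1.tendsto.comp h2).congr' ?_
    filter_upwards [hstay] with k hk
    have := ofCoords_coords x₀ (hk _ (hmem k)).1
    rw [hZr] at this
    simp only [Function.comp, hZr]
    exact this

/-- Geodesics are determined by their initial velocities. -/
theorem Flow.unique {s : ℝ} {x y y' : TangentBundle (𝓡∂ n) M} (h : Flow T s x y)
    (h' : Flow T s x y') : y = y' := by
  have := t2Space_tangentBundle (n := n) (M := M)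
  obtain ⟨hs, Z, hZ, hX, hZ0, rfl⟩ := h
  obtain ⟨_, Z', hZ', hX', hZ0', rfl⟩ := h'
  have hmain : Icc 0 s ⊆ {t | Z t = Z' t} := by
    refine IsClosed.Icc_subset_of_forall_exists_gt ?_ (by simp [hZ0, hZ0']) ?_
    · have h1 : IsClosed (Icc 0 s ∩ {t | Z t = Z' t}) := by
        have := (hZ.1.prodMk hZ'.1).preimage_isClosed_of_isClosed isClosed_Icc
          (isClosed_diagonal (X := TangentBundle (𝓡∂ n) M))
        exact this
      rwa [inter_comm] at h1
    · rintro t ⟨heq, ht⟩ r hr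
      have htI : t ∈ Icc 0 s := Ico_subset_Icc_self ht
      obtain ⟨O, hO, δ, hδ, hloc⟩ := exists_local_flow_limit (hX t htI)
      set t' := min (min r s) (t + δ)
      have htt' : t < t' := lt_min (lt_min hr ht.2) (by linarith)
      have ht's : t' ≤ s := (min_le_left _ _).trans (min_le_right _ _)
      refine ⟨t', ?_, htt', (min_le_left _ _).trans (min_le_left _ _)⟩
      have f1 := hZ.flow hX htI.1 htt'.le ht's
      have f2 := hZ'.flow hX' htI.1 htt'.le ht's
      rw [← show Z t = Z' t from heq] at f2
      -- The sequence alternating between the two end vectors must converge, so they coincide.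
      obtain ⟨_, _, hz⟩ := hloc (fun _ ↦ Z t) (fun k ↦ if Even k then Z t' else Z' t')
        (fun _ ↦ t' - t) (Z t) (t' - t) (mem_of_mem_nhds hO) tendsto_const_nhds tendsto_const_nhds
        (fun _ ↦ by linarith [min_le_right (min r s) (t + δ)])
        (fun k ↦ by
          by_cases hk : Even k
          · simpa [hk] using f1
          · simpa [hk] using f2)
      have h1 : Tendsto (fun k : ℕ ↦ 2 * k) atTop atTop :=
        tendsto_atTop_mono (fun k ↦ by simp only [id]; omega) tendsto_id
      have h2 : Tendsto (fun k : ℕ ↦ 2 * k + 1) atTop atTop :=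
        tendsto_atTop_mono (fun k ↦ by simp only [id]; omega) tendsto_id
      have e1 := hz.comp h1
      have e2 := hz.comp h2
      simp only [Function.comp_def, even_two_mul, if_true, Nat.not_even_two_mul_add_one,
        if_false] at e1 e2
      exact (tendsto_nhds_unique tendsto_const_nhds e1).trans
        (tendsto_nhds_unique tendsto_const_nhds e2).symm
  exact hmain (right_mem_Icc.2 hs)

/-- The length of the velocity vector of a geodesic is constant. -/
theorem metricForm_const_of_solution {x₀ : M} {α : ℝ → Vec n × Vec n} {δ : ℝ} (hδ : 0 ≤ δ)
    (hα : ∀ t ∈ Icc 0 δ, (α t).1 ∈ (extChartAt (𝓡∂ n) x₀).target)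
    (hd : ∀ t ∈ Icc 0 δ, HasDerivWithinAt α (extSpray g x₀ (α t)) (Icc 0 δ) t) :
    metricForm g x₀ (α δ).1 (α δ).2 (α δ).2 = metricForm g x₀ (α 0).1 (α 0).2 (α 0).2 := by
  have hderiv : ∀ t ∈ Icc 0 δ, HasDerivWithinAt
      (fun t ↦ metricForm g x₀ (α t).1 (α t).2 (α t).2) 0 (Icc 0 δ) t := by
    intro t ht
    have h0 := hd t ht
    rw [extSpray_of_mem g x₀ (extChartAt_target_subset_range x₀ (hα t ht))] at h0
    have h1 : HasDerivWithinAt (fun r ↦ (α r).1) (α t).2 (Icc 0 δ) t :=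
      h0.hasFDerivWithinAt.fst.hasDerivWithinAt.congr_deriv (by simp [spray])
    have h2 : HasDerivWithinAt (fun r ↦ (α r).2) (acc g x₀ (α t).1 (α t).2) (Icc 0 δ) t :=
      h0.hasFDerivWithinAt.snd.hasDerivWithinAt.congr_deriv (by simp [spray])
    have h3 : HasDerivWithinAt (fun r ↦ metricForm g x₀ (α r).1)
        (fderivWithin ℝ (metricForm g x₀) (halfSpace n) (α t).1 (α t).2) (Icc 0 δ) t :=
      HasFDerivWithinAt.comp_hasDerivWithinAt (F := Vec n) (E := Vec n →L[ℝ] Vec n →L[ℝ] ℝ)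
        (l := metricForm g x₀) (f := fun r ↦ (α r).1) (t := halfSpace n) t
        (differentiableWithinAt_metricForm g x₀ (hα t ht)).hasFDerivWithinAt h1
        (fun r hr ↦ extChartAt_target_subset_range x₀ (hα r hr))
    have h4 := (h3.clm_apply h2).clm_apply h2
    refine h4.congr_deriv ?_
    -- On equal arguments the Christoffel form is half the derivative of the metric, so the two
    -- acceleration terms cancel this derivative.
    have e1 := metricForm_acc g x₀ (hα t ht) (α t).2 (α t).2
    have e2 := metricForm_symm g x₀ (α t).1 (α t).2 (acc g x₀ (α t).1 (α t).2)
    simp only [christoffelForm, sub_apply, smul_apply, ContinuousLinearMap.flip_apply,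
      smul_eq_mul, add_apply] at e1 ⊢
    linarith
  have := (convex_Icc 0 δ).norm_image_sub_le_of_norm_hasDerivWithin_le (C := 0) hderiv
    (fun t _ ↦ by simp) (left_mem_Icc.2 hδ) (right_mem_Icc.2 hδ)
  rw [zero_mul] at this
  exact sub_eq_zero.1 (norm_le_zero_iff.1 this)

/-- A future-directed lightlike vector at a point of the interior, or pointing into the interior, is
the initial velocity of a geodesic. -/
theorem exists_flow {x : TangentBundle (𝓡∂ n) M} (hx : x ∈ futureLightlike T)
    (h : 0 < extChartAt (𝓡∂ n) x.1 x.1 0 ∨ 0 < vecOf x 0) : ∃ δ > 0, ∃ y, Flow T δ x y := by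
  set x₀ := x.1 with hx₀
  have hxs : x.1 ∈ (extChartAt (𝓡∂ n) x₀).source := mem_extChartAt_source x₀
  have hxc := (mem_futureLightlike_iff_coords hxs).1 hx
  have hz1 : (coords x₀ x).1 = extChartAt (𝓡∂ n) x₀ x₀ := rfl
  have hz2 : (coords x₀ x).2 = vecOf x := chartDeriv_self x₀ (vecOf x)
  set z₀ := coords x₀ x with hz₀
  have hz₀t : z₀.1 ∈ (extChartAt (𝓡∂ n) x₀).target := (extChartAt (𝓡∂ n) x₀).map_source hxs
  obtain ⟨ρ, A, K, hρ, hA, hK, hF, hp⟩ := exists_good_ball g x₀ hz₀t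
    (eventually_timeForm_neg (T := T) hz₀t hxc.2)
  have hδ0 : 0 < ρ / A := by positivity
  obtain ⟨α, hα0, hα⟩ := exists_solution_mem_closedBall hρ.le hA.le hδ0.le
    (by field_simp; exact le_rfl) hK hF (Metric.mem_closedBall_self hρ.le)
  have h0I : (0 : ℝ) ∈ Icc 0 (ρ / A) := left_mem_Icc.2 hδ0.le
  have hd0 : HasDerivWithinAt (fun t ↦ (α t).1 0) (vecOf x 0) (Icc 0 (ρ / A)) 0 := by
    have h1 := (hα 0 h0I).2
    rw [hα0, extSpray_of_mem g x₀ (mem_range_self _)] at h1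
    have h2 : HasDerivWithinAt (fun r ↦ (α r).1) (vecOf x) (Icc 0 (ρ / A)) 0 :=
      h1.hasFDerivWithinAt.fst.hasDerivWithinAt.congr_deriv (by simp [spray, hz2])
    exact (EuclideanSpace.proj (𝕜 := ℝ) (0 : Fin n)).hasFDerivAt.comp_hasDerivWithinAt 0 h2
  have hnonneg : 0 ≤ (α 0).1 0 := by
    rw [hα0]
    exact mem_halfSpace.1 (extChartAt_target_subset_range x₀ hz₀t)
  -- The boundary coordinate starts positive, or has positive initial derivative; either way the
  -- extended solution stays in the half-space for a short time.
  have hpos : ∀ᶠ t in 𝓝[Icc 0 (ρ / A)] 0, 0 ≤ (α t).1 0 := by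
    rcases h with h | h
    · have h1 : 0 < (α 0).1 0 := by rw [hα0, hz1]; exact h
      exact (hd0.continuousWithinAt.tendsto.eventually_const_lt h1).mono fun t ht ↦ ht.le
    · have h1 := (hasDerivWithinAt_iff_tendsto_slope.1 hd0).eventually_const_lt h
      rw [eventually_nhdsWithin_iff] at h1 ⊢
      filter_upwards [h1] with t ht htI
      rcases eq_or_ne t 0 with rfl | ht0
      · exact hnonneg
      · have h2 := ht ⟨htI, ht0⟩
        have h3 : 0 < t := lt_of_le_of_ne htI.1 ht0.symm
        rw [slope_def_field, sub_zero] at h2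
        have := (div_pos_iff_of_pos_right h3).1 h2
        linarith
  obtain ⟨ε, hε, hball⟩ := Metric.mem_nhdsWithin_iff.1 hpos
  set δ := min (ρ / A) (ε / 2)
  have hδ : 0 < δ := lt_min hδ0 (by linarith)
  have hsub : Icc 0 δ ⊆ Icc 0 (ρ / A) := Icc_subset_Icc_right (min_le_left _ _)
  have hαt : ∀ t ∈ Icc 0 δ, (α t).1 ∈ (extChartAt (𝓡∂ n) x₀).target ∧
      timeForm T x₀ (α t).1 (α t).2 < 0 := by
    intro t ht
    refine hp (α t) (hα t (hsub ht)).1 (mem_halfSpace.2 (hball ⟨?_, hsub ht⟩))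
    rw [Metric.mem_ball, Real.dist_eq, sub_zero, abs_of_nonneg ht.1]
    linarith [ht.2, min_le_right (ρ / A) (ε / 2)]
  refine ⟨δ, hδ, ofCoords x₀ (α δ), hδ.le, fun t ↦ ofCoords x₀ (α t), ?_, ?_, ?_, rfl⟩
  · exact isIntegral_ofCoords (fun t ht ↦ (hαt t ht).1) (fun t ht ↦ (hα t (hsub ht)).2.mono hsub)
  · intro t ht
    rw [mem_futureLightlike_iff_coords (x₀ := x₀)
      ((extChartAt (𝓡∂ n) x₀).map_target (hαt t ht).1), coords_ofCoords x₀ (hαt t ht).1]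
    refine ⟨?_, (hαt t ht).2⟩
    have hsub2 : Icc 0 t ⊆ Icc 0 δ := Icc_subset_Icc_right ht.2
    rw [metricForm_const_of_solution (g := g) (x₀ := x₀) ht.1 (fun r hr ↦ (hαt r (hsub2 hr)).1)
      (fun r hr ↦ (hα r (hsub (hsub2 hr))).2.mono (hsub2.trans hsub)), hα0]
    exact hxc.1
  · simp only [hα0]
    exact ofCoords_coords x₀ hxs

end Flow

/-! ### Piecewise smooth curves and causality -/

section Curves

variable {n : ℕ} [NeZero n]
  {M : Type*} [TopologicalSpace M] [ChartedSpace (EuclideanHalfSpace n) M]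
  [IsManifold (𝓡∂ n) ∞ M] {g : LorentzMetric n M} {T : TimeOrientation g}
  {P : Set (TangentBundle (𝓡∂ n) M)} {γ σ : ℝ → M} {a b c d t : ℝ} {p q r : M}

theorem velocity_congr (h : EqOn γ σ (Icc a b)) (ht : t ∈ Icc a b) :
    velocity (n := n) γ a b t = velocity σ a b t := by
  have h1 : mfderivWithin 𝓘(ℝ, ℝ) (𝓡∂ n) γ (Icc a b) t =
    (mfderivWithin 𝓘(ℝ, ℝ) (𝓡∂ n) σ (Icc a b) t : ℝ →L[ℝ] Vec n) := mfderivWithin_congr h (h ht)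
  change tvec (γ t) ((mfderivWithin 𝓘(ℝ, ℝ) (𝓡∂ n) γ (Icc a b) t : ℝ →L[ℝ] Vec n) 1) =
    tvec (σ t) ((mfderivWithin 𝓘(ℝ, ℝ) (𝓡∂ n) σ (Icc a b) t : ℝ →L[ℝ] Vec n) 1)
  rw [h1, h ht]

theorem velocity_affine {a' b' : ℝ} (k m : ℝ) (hab' : a' < b')
    (hmaps : ∀ t ∈ Icc a' b', k * t + m ∈ Icc a b) (ht : t ∈ Icc a' b')
    (hγ : MDifferentiableWithinAt 𝓘(ℝ, ℝ) (𝓡∂ n) γ (Icc a b) (k * t + m)) :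
    velocity (n := n) (fun t ↦ γ (k * t + m)) a' b' t =
      tsmul k (velocity γ a b (k * t + m)) := by
  have hd : HasDerivAt (fun t : ℝ ↦ k * t + m) k t := by
    simpa using ((hasDerivAt_id t).const_mul k).add_const m
  have hU : UniqueMDiffWithinAt 𝓘(ℝ, ℝ) (Icc a' b') t :=
    (uniqueDiffOn_Icc hab').uniqueMDiffOn t ht
  have h1 := mfderivWithin_comp (I := 𝓘(ℝ, ℝ)) (I' := 𝓘(ℝ, ℝ)) (I'' := 𝓡∂ n) t (g := γ)
    (f := fun t : ℝ ↦ k * t + m) (s := Icc a' b') (u := Icc a b) hγ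
    hd.differentiableAt.mdifferentiableAt.mdifferentiableWithinAt (fun t ht ↦ hmaps t ht) hU
  rw [mfderivWithin_eq_fderivWithin] at h1
  have h2 : (mfderivWithin 𝓘(ℝ, ℝ) (𝓡∂ n) (γ ∘ fun t : ℝ ↦ k * t + m) (Icc a' b') t :
      ℝ →L[ℝ] Vec n) 1 = k • (mfderivWithin 𝓘(ℝ, ℝ) (𝓡∂ n) γ (Icc a b) (k * t + m) :
      ℝ →L[ℝ] Vec n) 1 := by
    refine (DFunLike.congr_fun h1 1).trans ?_
    have h3 : fderivWithin ℝ (fun t : ℝ ↦ k * t + m) (Icc a' b') t 1 = k := by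
      exact hd.hasDerivWithinAt.derivWithin (uniqueDiffOn_Icc hab' t ht)
    change (mfderivWithin 𝓘(ℝ, ℝ) (𝓡∂ n) γ (Icc a b) (k * t + m) : ℝ →L[ℝ] Vec n)
      (fderivWithin ℝ (fun t : ℝ ↦ k * t + m) (Icc a' b') t 1) = _
    rw [h3]
    have key : ∀ D : ℝ →L[ℝ] Vec n, D k = k • D 1 := fun D ↦ by
      rw [← map_smul, smul_eq_mul, mul_one]
    exact key _
  exact congrArg (tvec (γ (k * t + m))) h2

/-- A smooth curve with velocity vectors in `P`. -/
def IsPiece (P : Set (TangentBundle (𝓡∂ n) M)) (γ : ℝ → M) (a b : ℝ) : Prop :=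
  a < b ∧ ContMDiffOn 𝓘(ℝ, ℝ) (𝓡∂ n) ∞ γ (Icc a b) ∧ ∀ t ∈ Icc a b, velocity γ a b t ∈ P

theorem IsPiece.congr (h : IsPiece P γ a b) (hs : EqOn σ γ (Icc a b)) : IsPiece P σ a b :=
  ⟨h.1, h.2.1.congr hs, fun t ht ↦ by rw [velocity_congr hs ht]; exact h.2.2 t ht⟩

theorem IsPiece.affine (h : IsPiece P γ a b) {a' b' : ℝ} (k m : ℝ) (hab' : a' < b')
    (hmaps : ∀ t ∈ Icc a' b', k * t + m ∈ Icc a b) :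
    IsPiece {v | ∃ w ∈ P, v = tsmul k w} (fun t ↦ γ (k * t + m)) a' b' := by
  refine ⟨hab', h.2.1.comp (t := Icc a b) ?_ (fun t ht ↦ hmaps t ht), fun t ht ↦ ?_⟩
  · exact (by fun_prop : ContDiff ℝ ∞ (fun t : ℝ ↦ k * t + m)).contMDiff.contMDiffOn
  · refine ⟨_, h.2.2 _ (hmaps t ht), velocity_affine k m hab' hmaps ht ?_⟩
    exact (h.2.1 _ (hmaps t ht)).mdifferentiableWithinAt (by simp)

theorem IsPiece.shift (h : IsPiece P γ a b) (m : ℝ) :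
    IsPiece P (fun t ↦ γ (t + m)) (a - m) (b - m) := by
  have h1 := h.affine (a' := a - m) (b' := b - m) 1 m (by linarith [h.1])
    (fun t ht ↦ ⟨by linarith [ht.1], by linarith [ht.2]⟩)
  simp only [one_mul] at h1
  refine ⟨h1.1, h1.2.1, fun t ht ↦ ?_⟩
  obtain ⟨w, hw, hvw⟩ := h1.2.2 t ht
  rw [hvw, tsmul_one]
  exact hw

theorem isPiecewiseCurve_iff : IsPiecewiseCurve P γ a b ↔ a < b ∧ ContinuousOn γ (Icc a b) ∧
    ∃ (N : ℕ) (τ : ℕ → ℝ), τ 0 = a ∧ τ N = b ∧ ∀ i < N, IsPiece P γ (τ i) (τ (i + 1)) :=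
  Iff.rfl

/-- There is a smooth curve from `p` to `q` with velocity vectors in `P`. -/
def SmoothReach (P : Set (TangentBundle (𝓡∂ n) M)) (p q : M) : Prop :=
  ∃ (γ : ℝ → M) (a b : ℝ), IsPiece P γ a b ∧ γ a = p ∧ γ b = q

theorem IsPiecewiseCurve.transGen (h : IsPiecewiseCurve P γ a b) :
    Relation.TransGen (SmoothReach P) (γ a) (γ b) := by
  obtain ⟨hab, -, N, τ, rfl, rfl, hτ⟩ := isPiecewiseCurve_iff.1 h
  have hN : N ≠ 0 := by rintro rfl; exact lt_irrefl _ hab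
  have key : ∀ i, i + 1 ≤ N → Relation.TransGen (SmoothReach P) (γ (τ 0)) (γ (τ (i + 1))) := by
    intro i
    induction i with
    | zero => exact fun h ↦ .single ⟨γ, _, _, hτ 0 (by omega), rfl, rfl⟩
    | succ i ih => exact fun h ↦ (ih (by omega)).tail ⟨γ, _, _, hτ (i + 1) (by omega), rfl, rfl⟩
  obtain ⟨k, rfl⟩ := Nat.exists_eq_succ_of_ne_zero hN
  exact key k le_rfl

theorem IsPiecewiseCurve.append (h : IsPiecewiseCurve P γ a b) (hσ : IsPiece P σ c d)
    (hbc : γ b = σ c) : ∃ ρ e, IsPiecewiseCurve P ρ a e ∧ ρ a = γ a ∧ ρ e = σ d := by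
  obtain ⟨hab, hcont, N, τ, rfl, rfl, hτ⟩ := isPiecewiseCurve_iff.1 h
  have hcd := hσ.1
  set b := τ N
  set e := b + (d - c)
  have hbe : b < e := by simp only [e]; linarith
  have hle : ∀ k i, i + k = N → τ i ≤ b := by
    intro k
    induction k with
    | zero => intro i hi; rw [show i = N by omega]
    | succ k ih => exact fun i hi ↦ (hτ i (by omega)).1.le.trans (ih (i + 1) (by omega))
  have hσ' := hσ.shift (c - b)
  rw [show c - (c - b) = b by ring, show d - (c - b) = e by simp only [e]; ring] at hσ'
  set ρ : ℝ → M := fun t ↦ if t ≤ b then γ t else σ (t + (c - b)) with hρ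
  have e1 : EqOn ρ γ (Iic b) := fun t ht ↦ if_pos ht
  have e2 : EqOn ρ (fun t ↦ σ (t + (c - b))) (Icc b e) := by
    intro t ht
    rcases eq_or_lt_of_le ht.1 with rfl | h1
    · simp only [hρ, le_refl, if_true, hbc]
      congr 1
      ring
    · exact if_neg (not_le.2 h1)
  refine ⟨ρ, e, isPiecewiseCurve_iff.2 ⟨hab.trans hbe, ?_, N + 1,
    fun i ↦ if i ≤ N then τ i else e, by simp, by simp, fun i hi ↦ ?_⟩, e1 hab.le, ?_⟩
  · rw [← Icc_union_Icc_eq_Icc hab.le hbe.le]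
    exact (hcont.congr (e1.mono Icc_subset_Iic_self)).union_of_isClosed
      ((hσ'.congr e2).2.1.continuousOn) isClosed_Icc isClosed_Icc
  · rcases Nat.lt_or_ge i N with h1 | h1
    · simp only [show i ≤ N by omega, show i + 1 ≤ N by omega, if_true]
      exact (hτ i h1).congr fun t ht ↦ e1 (ht.2.trans (hle (N - (i + 1)) (i + 1) (by omega)))
    · simp only [show i = N by omega, le_refl, if_true, show ¬ N + 1 ≤ N by omega, if_false]
      exact hσ'.congr e2
  · rw [e2 (right_mem_Icc.2 hbe.le)]
    simp only [e]
    congr 1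
    ring

theorem exists_isPiecewiseCurve_of_transGen (h : Relation.TransGen (SmoothReach P) p q) :
    ∃ γ a b, IsPiecewiseCurve P γ a b ∧ γ a = p ∧ γ b = q := by
  induction h with
  | single h =>
    obtain ⟨γ, a, b, h, rfl, rfl⟩ := h
    refine ⟨γ, a, b, isPiecewiseCurve_iff.2 ⟨h.1, h.2.1.continuousOn, 1,
      fun i ↦ if i = 0 then a else b, by simp, by simp, fun i hi ↦ ?_⟩, rfl, rfl⟩
    obtain rfl : i = 0 := by omega
    simpa using h
  | tail _ h ih =>
    obtain ⟨γ, a, b, h1, rfl, hb⟩ := ih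
    obtain ⟨σ, c, d, h2, rfl, rfl⟩ := h
    obtain ⟨ρ, e, h3, h4, h5⟩ := h1.append h2 hb
    exact ⟨ρ, a, e, h3, h4, h5⟩

/-- Reparametrization and concatenation of piecewise curves are absorbed, once and for all, into
transitivity. -/
theorem chronological_iff :
    Chronological T p q ↔ Relation.TransGen (SmoothReach (futureTimelike T)) p q :=
  ⟨fun ⟨_, _, _, h, hp, hq⟩ ↦ hp ▸ hq ▸ h.transGen, exists_isPiecewiseCurve_of_transGen⟩

theorem Flow.smoothReach {s : ℝ} {x y : TangentBundle (𝓡∂ n) M} (h : Flow T s x y) (hs : 0 < s) :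
    SmoothReach (futureCausal T) x.1 y.1 := by
  obtain ⟨γ, hγ, rfl, rfl⟩ := h.exists_geodesic hs
  exact ⟨γ, 0, s, ⟨hs, hγ.1.2.1, fun t ht ↦ Or.inr (hγ.2 t ht)⟩, rfl, rfl⟩

theorem vecOf_ne_zero_of_mem_futureCausal {v : TangentBundle (𝓡∂ n) M}
    (hv : v ∈ futureCausal T) : vecOf v ≠ 0 := by
  intro h0
  rcases hv with hv | hv
  · have h := hv.1
    change g.form v.1 (vecOf v) (vecOf v) < 0 at h
    simp [h0] at h
  · exact hv.1.1 h0

/-- There are no closed causal curves. -/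
theorem StronglyCausal.not_transGen [T2Space M] (hc : StronglyCausal T) (p : M) :
    ¬ Relation.TransGen (SmoothReach (futureCausal T)) p p := by
  intro h
  obtain ⟨γ, a, b, hγ, ha, hb⟩ := exists_isPiecewiseCurve_of_transGen h
  -- A causal curve is not constant because causal vectors are nonzero.
  have hne : ∃ t ∈ Icc a b, γ t ≠ p := by
    by_contra! hconst
    obtain ⟨hab, -, N, τ, rfl, rfl, hτ⟩ := isPiecewiseCurve_iff.1 hγ
    have hN : 0 < N := by
      rcases Nat.eq_zero_or_pos N with rfl | h
      · exact absurd hab (lt_irrefl _)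
      · exact h
    have hle : ∀ k i, i + k = N → τ i ≤ τ N := by
      intro k
      induction k with
      | zero => intro i hi; rw [show i = N by omega]
      | succ k ih => exact fun i hi ↦ (hτ i (by omega)).1.le.trans (ih (i + 1) (by omega))
    have h1 := hτ 0 hN
    have h2 := h1.congr (σ := fun _ ↦ p) fun t ht ↦
      (hconst t ⟨ht.1, ht.2.trans (hle (N - (0 + 1)) (0 + 1) (by omega))⟩).symm
    have h3 := vecOf_ne_zero_of_mem_futureCausal (h2.2.2 _ (left_mem_Icc.2 h1.1.le))
    apply h3
    change (mfderivWithin 𝓘(ℝ, ℝ) (𝓡∂ n) (fun _ : ℝ ↦ p) (Icc (τ 0) (τ (0 + 1))) (τ 0) :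
      ℝ →L[ℝ] Vec n) 1 = 0
    rw [mfderivWithin_const]
    rfl
  obtain ⟨t, ht, htp⟩ := hne
  -- The closed curve is in `V` at both ends but not at time `t`, against strong causality.
  obtain ⟨V, hV, hVU, hord⟩ := hc p {γ t}ᶜ (isOpen_compl_singleton.mem_nhds htp.symm)
  have hpV := mem_of_mem_nhds hV
  have h1 := (hord γ a b hγ).out (x := a) ⟨left_mem_Icc.2 hγ.1.le, by rw [mem_preimage, ha]; exact hpV⟩
    (y := b) ⟨right_mem_Icc.2 hγ.1.le, by rw [mem_preimage, hb]; exact hpV⟩ ht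
  exact hVU h1.2 rfl

theorem IsPiece.neg (h : IsPiece P γ a b) :
    IsPiece {v | tsmul (-1) v ∈ P} (fun t ↦ γ (-t)) (-b) (-a) := by
  have h1 := h.affine (a' := -b) (b' := -a) (-1) 0 (by linarith [h.1])
    (fun t ht ↦ ⟨by linarith [ht.2], by linarith [ht.1]⟩)
  simp only [neg_mul, one_mul, add_zero] at h1
  refine ⟨h1.1, h1.2.1, fun t ht ↦ ?_⟩
  obtain ⟨w, hw, hvw⟩ := h1.2.2 t ht
  rw [hvw, mem_ofPred_eq, tsmul_tsmul, show (-1 : ℝ) * -1 = 1 by norm_num, tsmul_one]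
  exact hw

theorem neg_mem_futureTimelike {v : TangentBundle (𝓡∂ n) M} (hv : v ∈ futureTimelike T) :
    tsmul (-1) v ∈ futureTimelike T.reverse := by
  obtain ⟨h1, h2⟩ := hv
  change g.form v.1 (vecOf v) (vecOf v) < 0 at h1
  change g.form v.1 (vecOf v) (T.field v.1 : Vec n) < 0 at h2
  change g.form v.1 ((-1 : ℝ) • vecOf v) ((-1 : ℝ) • vecOf v) < 0 ∧
    g.form v.1 ((-1 : ℝ) • vecOf v) (T.reverse.field v.1 : Vec n) < 0
  rw [form_reverse_field]
  simp only [map_smul, smul_apply, smul_eq_mul]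
  change -1 * (-1 * g.form v.1 (vecOf v) (vecOf v)) < 0 ∧
    -(-1 * g.form v.1 (vecOf v) (T.field v.1 : Vec n)) < 0
  exact ⟨by linarith, by linarith⟩

theorem neg_mem_futureCausal {v : TangentBundle (𝓡∂ n) M} (hv : v ∈ futureCausal T) :
    tsmul (-1) v ∈ futureCausal T.reverse :=
  hv.imp neg_mem_futureTimelike neg_mem_futureLightlike

theorem tsmul_neg_neg (v : TangentBundle (𝓡∂ n) M) : tsmul (-1) (tsmul (-1) v) = v := by
  rw [tsmul_tsmul, show (-1 : ℝ) * -1 = 1 by norm_num, tsmul_one]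

theorem StronglyCausal.reverse (hc : StronglyCausal T) : StronglyCausal T.reverse := by
  intro p U hU
  obtain ⟨V, hV, hVU, hord⟩ := hc p U hU
  refine ⟨V, hV, hVU, fun γ a b hγ ↦ ?_⟩
  obtain ⟨hab, hcont, N, τ, h0, h1, hτ⟩ := isPiecewiseCurve_iff.1 hγ
  have hγ' : IsPiecewiseCurve (futureCausal T) (fun t ↦ γ (-t)) (-b) (-a) := by
    refine isPiecewiseCurve_iff.2 ⟨by linarith, ?_, N, fun i ↦ -τ (N - i), by simp [h1],
      by simp [h0], fun i hi ↦ ?_⟩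
    · exact hcont.comp continuousOn_neg fun t ht ↦ ⟨by linarith [ht.2], by linarith [ht.1]⟩
    · have h2 := (hτ (N - (i + 1)) (by omega)).neg
      rw [show N - (i + 1) + 1 = N - i by omega] at h2
      refine ⟨h2.1, h2.2.1, fun t ht ↦ ?_⟩
      have := neg_mem_futureCausal (h2.2.2 t ht)
      rwa [tsmul_neg_neg, T.reverse_reverse] at this
  have h2 := (hord _ _ _ hγ').out
  refine ⟨fun x hx y hy z hz ↦ ?_⟩
  have h3 := h2 (x := -y) ⟨⟨by linarith [hy.1.2], by linarith [hy.1.1]⟩, by simpa using hy.2⟩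
    (y := -x) ⟨⟨by linarith [hx.1.2], by linarith [hx.1.1]⟩, by simpa using hx.2⟩
    (show -z ∈ Icc (-y) (-x) from ⟨by linarith [hz.2], by linarith [hz.1]⟩)
  exact ⟨⟨by linarith [hz.1, hx.1.1], by linarith [hz.2, hy.1.2]⟩, by simpa using h3.2⟩

theorem Chronological.reverse (h : Chronological T p q) : Chronological T.reverse q p := by
  rw [chronological_iff] at h ⊢
  rw [← Relation.transGen_swap]
  refine Relation.TransGen.mono ?_ _ _ h
  rintro p q ⟨γ, a, b, hγ, rfl, rfl⟩
  refine ⟨fun t ↦ γ (-t), -b, -a, ⟨hγ.neg.1, hγ.neg.2.1, fun t ht ↦ ?_⟩, by simp, by simp⟩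
  have := neg_mem_futureTimelike (hγ.neg.2.2 t ht)
  rwa [tsmul_neg_neg] at this

end Curves

/-! ### A scalar growth estimate -/

/-- A bounded function with positive derivative `w`, where the derivative of `w` is controlled by
the square of `w`, has a domain of bounded length, on which `w` is controlled by its initial
value. -/
theorem growth_bounds {a w w' : ℝ → ℝ} {s K B : ℝ} (hs : 0 ≤ s) (hK : 0 ≤ K)
    (ha : ∀ t ∈ Icc 0 s, HasDerivWithinAt a (w t) (Icc 0 s) t)
    (hw : ∀ t ∈ Icc 0 s, HasDerivWithinAt w (w' t) (Icc 0 s) t)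
    (hpos : ∀ t ∈ Icc 0 s, 0 < w t) (hw' : ∀ t ∈ Icc 0 s, |w' t| ≤ K * w t ^ 2)
    (hB : ∀ t ∈ Icc 0 s, |a t| ≤ B) :
    w s ≤ w 0 * Real.exp (2 * K * B) ∧ w 0 * Real.exp (-(2 * K * B)) ≤ w s ∧
      w 0 * Real.exp (-(2 * K * B)) * s ≤ 2 * B := by
  have hint : interior (Icc 0 s) ⊆ Icc 0 s := interior_subset
  have hE : ∀ c : ℝ, ∀ t ∈ Icc 0 s, HasDerivWithinAt (fun t ↦ w t * Real.exp (c * a t))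
      (w' t * Real.exp (c * a t) + w t * (Real.exp (c * a t) * (c * w t))) (Icc 0 s) t :=
    fun c t ht ↦ (hw t ht).mul (((ha t ht).const_mul c).exp)
  have h0 : (0 : ℝ) ∈ Icc 0 s := left_mem_Icc.2 hs
  -- The bound on `w'` makes `w * exp (-K * a)` nonincreasing and `w * exp (K * a)` nondecreasing.
  -- As `a` is bounded, `w` stays comparable to its initial value.
  have h1 : AntitoneOn (fun t ↦ w t * Real.exp (-K * a t)) (Icc 0 s) := by
    refine antitoneOn_of_hasDerivWithinAt_nonpos (convex_Icc 0 s)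
      (fun t ht ↦ (hE _ t ht).continuousWithinAt)
      (fun t ht ↦ (hE _ t (hint ht)).mono hint) fun t ht ↦ ?_
    have h2 := (abs_le.1 (hw' t (hint ht))).2
    have h3 : w' t * Real.exp (-K * a t) + w t * (Real.exp (-K * a t) * (-K * w t)) =
      (w' t - K * w t ^ 2) * Real.exp (-K * a t) := by ring
    rw [h3]
    exact mul_nonpos_of_nonpos_of_nonneg (by linarith) (Real.exp_pos _).le
  have h2 : MonotoneOn (fun t ↦ w t * Real.exp (K * a t)) (Icc 0 s) := by
    refine monotoneOn_of_hasDerivWithinAt_nonneg (convex_Icc 0 s)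
      (fun t ht ↦ (hE _ t ht).continuousWithinAt)
      (fun t ht ↦ (hE _ t (hint ht)).mono hint) fun t ht ↦ ?_
    have h2 := (abs_le.1 (hw' t (hint ht))).1
    have h3 : w' t * Real.exp (K * a t) + w t * (Real.exp (K * a t) * (K * w t)) =
      (w' t + K * w t ^ 2) * Real.exp (K * a t) := by ring
    rw [h3]
    exact mul_nonneg (by linarith) (Real.exp_pos _).le
  have hup : ∀ t ∈ Icc 0 s, w t ≤ w 0 * Real.exp (2 * K * B) := by
    intro t ht
    have h3 : w t * Real.exp (-K * a t) ≤ w 0 * Real.exp (-K * a 0) := h1 h0 ht ht.1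
    have h4 : w t = w t * Real.exp (-K * a t) * Real.exp (K * a t) := by
      rw [mul_assoc, ← Real.exp_add]; simp
    rw [h4]
    refine (mul_le_mul_of_nonneg_right h3 (Real.exp_pos _).le).trans ?_
    rw [mul_assoc, ← Real.exp_add]
    refine mul_le_mul_of_nonneg_left (Real.exp_le_exp.2 ?_) (hpos 0 h0).le
    nlinarith [abs_le.1 (hB t ht), abs_le.1 (hB 0 h0)]
  have hlow : ∀ t ∈ Icc 0 s, w 0 * Real.exp (-(2 * K * B)) ≤ w t := by
    intro t ht
    have h3 : w 0 * Real.exp (K * a 0) ≤ w t * Real.exp (K * a t) := h2 h0 ht ht.1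
    have h4 : w t = w t * Real.exp (K * a t) * Real.exp (-K * a t) := by
      rw [mul_assoc, ← Real.exp_add]; simp
    rw [h4]
    refine le_trans ?_ (mul_le_mul_of_nonneg_right h3 (Real.exp_pos _).le)
    rw [mul_assoc (w 0), ← Real.exp_add]
    refine mul_le_mul_of_nonneg_left (Real.exp_le_exp.2 ?_) (hpos 0 h0).le
    nlinarith [abs_le.1 (hB t ht), abs_le.1 (hB 0 h0)]
  have hsI : s ∈ Icc 0 s := right_mem_Icc.2 hs
  refine ⟨hup s hsI, hlow s hsI, ?_⟩
  -- `m` bounds the derivative `w` of `a` from below, and `a` can grow by at most `2 * B`; this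
  -- limits `s`.
  set m := w 0 * Real.exp (-(2 * K * B))
  have hD : ∀ t ∈ Icc 0 s, HasDerivWithinAt (fun t ↦ a t - m * t) (w t - m * 1) (Icc 0 s) t :=
    fun t ht ↦ (ha t ht).sub ((hasDerivWithinAt_id t _).const_mul m)
  have h3 : MonotoneOn (fun t ↦ a t - m * t) (Icc 0 s) :=
    monotoneOn_of_hasDerivWithinAt_nonneg (convex_Icc 0 s)
      (fun t ht ↦ (hD t ht).continuousWithinAt) (fun t ht ↦ (hD t (hint ht)).mono hint)
      fun t ht ↦ by linarith [hlow t (hint ht)]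
  have h4 : a 0 - m * 0 ≤ a s - m * s := h3 h0 hsI hs
  linarith [(abs_le.1 (hB s hsI)).2, (abs_le.1 (hB 0 h0)).1]

/-! ### Lorentzian algebra, uniform estimates, and nontrapping -/

section Nontrapping

variable {n : ℕ} [NeZero n]
  {M : Type*} [TopologicalSpace M] [ChartedSpace (EuclideanHalfSpace n) M]
  [IsManifold (𝓡∂ n) ∞ M] {g : LorentzMetric n M} {T : TimeOrientation g}

theorem form_symm (g : LorentzMetric n M) (p : M) (u v : Vec n) :
    g.form p u v = g.form p v u := g.symm p u v

/-- The orthogonal complement of a timelike vector is spacelike. -/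
theorem form_pos_of_orthogonal (g : LorentzMetric n M) (p : M) {t w : Vec n}
    (ht : g.form p t t < 0) (hw : g.form p w t = 0) (hw0 : w ≠ 0) : 0 < g.form p w w := by
  obtain ⟨e, he, hpos⟩ := g.lorentzian p
  change g.form p e e < 0 at he
  have hpos' : ∀ v : Vec n, g.form p e v = 0 → v ≠ 0 → 0 < g.form p v v := hpos
  by_contra! hneg
  set α := g.form p e t
  set β := g.form p e w
  have hα : α ≠ 0 := by
    intro h0
    have ht0 : t ≠ 0 := by rintro rfl; simp at ht
    exact absurd (hpos' t h0 ht0) (not_lt.2 ht.le)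
  -- This combination is orthogonal to the reference vector `e`, hence spacelike or zero, while its
  -- square would be nonpositive.
  have h1 : g.form p e (β • t - α • w) = 0 := by
    simp only [map_sub, map_smul, smul_eq_mul]
    ring
  have h2 : g.form p (β • t - α • w) (β • t - α • w) =
      β ^ 2 * g.form p t t + α ^ 2 * g.form p w w := by
    simp only [map_sub, map_smul, sub_apply, smul_apply, smul_eq_mul, hw, form_symm g p t w]
    ring
  have h3 : β • t - α • w = 0 := by
    by_contra hne
    have := hpos' _ h1 hne
    rw [h2] at this
    nlinarith [sq_nonneg β, sq_nonneg α]
  have h4 : g.form p (β • t - α • w) t = β * g.form p t t := by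
    simp only [map_sub, map_smul, sub_apply, smul_apply, smul_eq_mul, hw]
    ring
  rw [h3, map_zero] at h4
  have hβ : β = 0 := by
    rcases mul_eq_zero.1 (show β * g.form p t t = 0 from h4.symm) with h | h
    · exact h
    · exact absurd h ht.ne
  rw [hβ, zero_smul, zero_sub, neg_eq_zero, smul_eq_zero] at h3
  exact h3.elim hα hw0

theorem form_field_ne_zero {p : M} {v : Vec n} (hv : g.form p v v = 0) (hv0 : v ≠ 0) :
    g.form p v (T.field p : Vec n) ≠ 0 := fun h ↦
  absurd hv (form_pos_of_orthogonal g p (T.timelike p) h hv0).ne'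

/-- Two future-directed lightlike vectors which are not proportional have a negative product. -/
theorem form_neg_of_ne_smul {p : M} {u w t : Vec n} (ht : g.form p t t < 0)
    (hu : g.form p u u = 0) (hw : g.form p w w = 0) (hut : g.form p u t < 0)
    (hwt : g.form p w t < 0) (h : ∀ c : ℝ, 0 < c → w ≠ c • u) : g.form p u w < 0 := by
  set α := g.form p u t
  set β := g.form p w t
  -- The combination orthogonal to `t` is spacelike, and its square is a negative multiple of `g (u,
  -- w)`.
  have h1 : g.form p (β • u - α • w) t = 0 := by
    simp only [map_sub, map_smul, sub_apply, smul_apply, smul_eq_mul]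
    ring
  have h2 : β • u - α • w ≠ 0 := by
    intro h0
    refine h (β / α) (div_pos_of_neg_of_neg hwt hut) ?_
    rw [div_eq_inv_mul, mul_smul, sub_eq_zero.1 h0, smul_smul, inv_mul_cancel₀ hut.ne, one_smul]
  have h3 := form_pos_of_orthogonal g p ht h1 h2
  have h4 : g.form p (β • u - α • w) (β • u - α • w) = -(2 * (α * β) * g.form p u w) := by
    simp only [map_sub, map_smul, sub_apply, smul_apply, smul_eq_mul, hu, hw, form_symm g p w u]
    ring
  rw [h4] at h3
  have h5 : 0 < α * β := mul_pos_of_neg_of_neg hut hwt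
  by_contra! h6
  nlinarith [mul_nonneg h5.le h6]

theorem timeForm_ne_zero {x₀ : M} {y u : Vec n} (hy : y ∈ (extChartAt (𝓡∂ n) x₀).target)
    (hu : metricForm g x₀ y u u = 0) (hu0 : u ≠ 0) : timeForm T x₀ y u ≠ 0 := by
  rw [metricForm_eq] at hu
  rw [timeForm_apply]
  refine form_field_ne_zero hu fun h ↦ hu0 ?_
  have := chartDeriv_frame x₀ hy u
  rwa [h, map_zero, eq_comm] at this

theorem exists_closedBall_subset_target (x₀ : M) :
    ∃ r > 0, Metric.closedBall (extChartAt (𝓡∂ n) x₀ x₀) r ∩ halfSpace n ⊆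
      (extChartAt (𝓡∂ n) x₀).target := by
  obtain ⟨ε, hε, h⟩ := Metric.mem_nhdsWithin_iff.1 (extChartAt_target_mem_nhdsWithin
    (I := 𝓡∂ n) x₀)
  exact ⟨ε / 2, by linarith, fun y hy ↦ h ⟨Metric.closedBall_subset_ball (by linarith) hy.1, hy.2⟩⟩

theorem isCompact_closedBall_inter_halfSpace (y : Vec n) (r : ℝ) :
    IsCompact (Metric.closedBall y r ∩ halfSpace n) :=
  (isCompact_closedBall y r).inter_right (isClosed_halfSpace n)

theorem acc_zero (g : LorentzMetric n M) (x₀ : M) (y : Vec n) : acc g x₀ y 0 = 0 := by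
  have := acc_smul g x₀ 0 y 0
  simpa using this

/-- Accelerations are quadratic in the velocity, so a bound over the compact unit sphere bundle is
enough. -/
theorem exists_acc_bound (g : LorentzMetric n M) (x₀ : M) {C : Set (Vec n)} (hC : IsCompact C)
    (hCt : C ⊆ (extChartAt (𝓡∂ n) x₀).target) :
    ∃ A, 0 ≤ A ∧ ∀ y ∈ C, ∀ u, ‖acc g x₀ y u‖ ≤ A * ‖u‖ ^ 2 := by
  have h1 : IsCompact (C ×ˢ Metric.sphere (0 : Vec n) 1) := hC.prod (isCompact_sphere 0 1)
  have h2 : ContinuousOn (spray g x₀) (C ×ˢ Metric.sphere (0 : Vec n) 1) :=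
    (contDiffOn_spray g x₀).continuousOn.mono (prod_mono hCt (subset_univ _))
  obtain ⟨A, hA⟩ := (h1.image_of_continuousOn h2).isBounded.exists_norm_le
  refine ⟨max A 0, le_max_right _ _, fun y hy u ↦ ?_⟩
  rcases eq_or_ne u 0 with rfl | hu
  · simp [acc_zero]
  have hu' : 0 < ‖u‖ := norm_pos_iff.2 hu
  have h3 : ‖spray g x₀ (y, ‖u‖⁻¹ • u)‖ ≤ A := by
    refine hA _ ⟨(y, ‖u‖⁻¹ • u), ⟨hy, ?_⟩, rfl⟩
    rw [mem_sphere_zero_iff_norm, norm_smul, norm_inv, norm_norm, inv_mul_cancel₀ hu'.ne']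
  have h4 : ‖acc g x₀ y (‖u‖⁻¹ • u)‖ ≤ A := (norm_snd_le (spray g x₀ (y, ‖u‖⁻¹ • u))).trans h3
  have h5 : acc g x₀ y u = ‖u‖ ^ 2 • acc g x₀ y (‖u‖⁻¹ • u) := by
    rw [← acc_smul, smul_smul, mul_inv_cancel₀ hu'.ne', one_smul]
  rw [h5, norm_smul, norm_pow, norm_norm, mul_comm]
  exact mul_le_mul_of_nonneg_right (h4.trans (le_max_left _ _)) (by positivity)

/-- The time form does not vanish on the compact set of lightlike unit vectors over `C`; homogeneity
does the rest. -/
theorem exists_timeForm_bound (T : TimeOrientation g) (x₀ : M) {C : Set (Vec n)} (hC : IsCompact C)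
    (hCt : C ⊆ (extChartAt (𝓡∂ n) x₀).target) :
    ∃ κ > 0, ∀ y ∈ C, ∀ u, metricForm g x₀ y u u = 0 → κ * ‖u‖ ≤ |timeForm T x₀ y u| := by
  set D := C ×ˢ Metric.sphere (0 : Vec n) 1 with hD
  have h1 : IsCompact D := hC.prod (isCompact_sphere 0 1)
  have h2 : ContinuousOn (fun z : Vec n × Vec n ↦ metricForm g x₀ z.1 z.2 z.2) D :=
    (continuousOn_metricForm_apply g x₀).mono fun z hz ↦ hCt hz.1
  have h3 : IsCompact (D ∩ (fun z : Vec n × Vec n ↦ metricForm g x₀ z.1 z.2 z.2) ⁻¹' {0}) :=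
    h1.of_isClosed_subset (h2.preimage_isClosed_of_isClosed h1.isClosed isClosed_singleton)
      inter_subset_left
  have h4 : ContinuousOn (fun z : Vec n × Vec n ↦ |timeForm T x₀ z.1 z.2|)
      (D ∩ (fun z : Vec n × Vec n ↦ metricForm g x₀ z.1 z.2 z.2) ⁻¹' {0}) := by
    refine ContinuousOn.abs (ContinuousOn.clm_apply ?_ continuous_snd.continuousOn)
    exact (contDiffOn_timeForm T x₀).continuousOn.comp continuous_fst.continuousOn
      fun z hz ↦ hCt hz.1.1
  have h5 : ∃ κ > 0, ∀ z ∈ D ∩ (fun z : Vec n × Vec n ↦ metricForm g x₀ z.1 z.2 z.2) ⁻¹' {0},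
      κ ≤ |timeForm T x₀ z.1 z.2| := by
    rcases (D ∩ (fun z : Vec n × Vec n ↦ metricForm g x₀ z.1 z.2 z.2) ⁻¹' {0}).eq_empty_or_nonempty
      with h | h
    · exact ⟨1, one_pos, by simp [h]⟩
    · obtain ⟨z, hz, hmin⟩ := h3.exists_isMinOn h h4
      refine ⟨_, abs_pos.2 (timeForm_ne_zero (T := T) (hCt hz.1.1) hz.2 ?_), fun w hw ↦ hmin hw⟩
      intro h0
      have := mem_sphere_zero_iff_norm.1 hz.1.2
      simp [h0] at this
  obtain ⟨κ, hκ, h6⟩ := h5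
  refine ⟨κ, hκ, fun y hy u hu ↦ ?_⟩
  rcases eq_or_ne u 0 with rfl | hu0
  · simp
  have hu' : 0 < ‖u‖ := norm_pos_iff.2 hu0
  have h7 := h6 (y, ‖u‖⁻¹ • u) ⟨⟨hy, by
    rw [mem_sphere_zero_iff_norm, norm_smul, norm_inv, norm_norm, inv_mul_cancel₀ hu'.ne']⟩, by
    simp [hu]⟩
  simp only [map_smul, smul_eq_mul, abs_mul, abs_inv, abs_norm] at h7
  rw [inv_mul_eq_div, le_div_iff₀ hu'] at h7
  exact h7

/-- Each point has a neighborhood where future-directed lightlike vectors are controlled by a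
linear functional, and the accelerations of geodesics by its square. -/
theorem exists_uniform_chart (T : TimeOrientation g) (x₀ : M) :
    ∃ U ∈ 𝓝 x₀, ∃ (C : Set (Vec n)) (τ : Vec n →L[ℝ] ℝ) (κ K B : ℝ), IsCompact C ∧
      C ⊆ (extChartAt (𝓡∂ n) x₀).target ∧ 0 < κ ∧ 0 ≤ K ∧
      ∀ v ∈ futureLightlike T, v.1 ∈ U → v.1 ∈ (extChartAt (𝓡∂ n) x₀).source ∧
        (coords x₀ v).1 ∈ C ∧ κ * ‖(coords x₀ v).2‖ ≤ -timeForm T x₀ (coords x₀ v).1 (coords x₀ v).2 ∧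
        κ * ‖(coords x₀ v).2‖ ≤ τ (coords x₀ v).2 ∧
        |τ (acc g x₀ (coords x₀ v).1 (coords x₀ v).2)| ≤ K * τ (coords x₀ v).2 ^ 2 ∧
        |τ (coords x₀ v).1| ≤ B := by
  obtain ⟨r, hr, hrt⟩ := exists_closedBall_subset_target (n := n) x₀
  set y₀ := extChartAt (𝓡∂ n) x₀ x₀
  have hy₀ : y₀ ∈ (extChartAt (𝓡∂ n) x₀).target := mem_extChartAt_target x₀
  obtain ⟨κ, hκ, hbound⟩ := exists_timeForm_bound T x₀ (isCompact_closedBall_inter_halfSpace y₀ r)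
    hrt
  have hcont : ContinuousWithinAt (timeForm T x₀) (halfSpace n) y₀ :=
    ((contDiffOn_timeForm T x₀).continuousOn y₀ hy₀).mono_of_mem_nhdsWithin
      (extChartAt_target_mem_nhdsWithin_of_mem hy₀)
  obtain ⟨r', hr', hclose⟩ := Metric.mem_nhdsWithin_iff.1
    (hcont (Metric.ball_mem_nhds _ (half_pos hκ)))
  -- On this ball the time form differs from its value at the center by less than `κ / 2`, so
  -- freezing it at the center costs half of `κ`.
  set ρ := min r (r' / 2)
  have hρ : 0 < ρ := lt_min hr (half_pos hr')
  set C := Metric.closedBall y₀ ρ ∩ halfSpace n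
  have hC : IsCompact C := isCompact_closedBall_inter_halfSpace y₀ ρ
  have hCr : C ⊆ Metric.closedBall y₀ r ∩ halfSpace n :=
    inter_subset_inter_left _ (Metric.closedBall_subset_closedBall (min_le_left _ _))
  have hCt := hCr.trans hrt
  obtain ⟨A, hA, hacc⟩ := exists_acc_bound g x₀ hC hCt
  set τ : Vec n →L[ℝ] ℝ := -timeForm T x₀ y₀ with hτ
  obtain ⟨B, hB⟩ := (hC.image τ.continuous).isBounded.exists_norm_le
  -- The constant `‖τ‖ * A * (4 / κ ^ 2)` results from inserting `‖u‖ ≤ 2 / κ * τ u` into the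
  -- quadratic bound on accelerations.
  refine ⟨(extChartAt (𝓡∂ n) x₀).source ∩ extChartAt (𝓡∂ n) x₀ ⁻¹' Metric.closedBall y₀ ρ,
    inter_mem (extChartAt_source_mem_nhds x₀)
      ((continuousAt_extChartAt x₀) (Metric.closedBall_mem_nhds _ hρ)), C, τ, κ / 2,
    ‖τ‖ * A * (4 / κ ^ 2), B, hC, hCt, half_pos hκ, by positivity, fun v hv hvU ↦ ?_⟩
  have hvs := hvU.1
  obtain ⟨h1, h2⟩ := (mem_futureLightlike_iff_coords hvs).1 hv
  have hvC : (coords x₀ v).1 ∈ C := ⟨hvU.2, extChartAt_target_subset_range x₀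
    ((extChartAt (𝓡∂ n) x₀).map_source hvs)⟩
  set y := (coords x₀ v).1
  set u := (coords x₀ v).2
  have h3 : κ * ‖u‖ ≤ -timeForm T x₀ y u := by
    have := hbound y (hCr hvC) u h1
    rwa [abs_of_neg h2] at this
  have h4 : κ / 2 * ‖u‖ ≤ τ u := by
    have h5 : y ∈ Metric.ball y₀ r' ∩ halfSpace n := ⟨Metric.closedBall_subset_ball
      (by linarith [min_le_right r (r' / 2)]) hvC.1, hvC.2⟩
    have h6 := hclose h5
    rw [mem_preimage, Metric.mem_ball, dist_eq_norm] at h6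
    have h7 := ((timeForm T x₀ y - timeForm T x₀ y₀).le_opNorm u).trans
      (mul_le_mul_of_nonneg_right h6.le (norm_nonneg u))
    rw [sub_apply, Real.norm_eq_abs] at h7
    have h8 := (abs_le.1 h7).1
    change κ / 2 * ‖u‖ ≤ -timeForm T x₀ y₀ u
    linarith
  refine ⟨hvs, hvC, ?_, h4, ?_, hB _ ⟨_, hvC, rfl⟩⟩
  · have := mul_nonneg hκ.le (norm_nonneg u)
    linarith
  · have h5 : |τ (acc g x₀ y u)| ≤ ‖τ‖ * (A * ‖u‖ ^ 2) := (τ.le_opNorm _).trans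
      (mul_le_mul_of_nonneg_left (hacc y hvC u) (norm_nonneg _))
    refine h5.trans ?_
    have h6 : ‖u‖ ≤ 2 / κ * τ u := by
      rw [div_mul_eq_mul_div, le_div_iff₀ hκ]
      linarith
    have h7 : ‖u‖ ^ 2 ≤ 4 / κ ^ 2 * τ u ^ 2 := by
      have := pow_le_pow_left₀ (norm_nonneg u) h6 2
      rw [mul_pow, div_pow] at this
      norm_num at this ⊢
      exact this
    calc ‖τ‖ * (A * ‖u‖ ^ 2) ≤ ‖τ‖ * (A * (4 / κ ^ 2 * τ u ^ 2)) := by gcongr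
      _ = _ := by ring

theorem tendsto_tsmul {ι : Type*} {l : Filter ι} {f : ι → TangentBundle (𝓡∂ n) M}
    {v : TangentBundle (𝓡∂ n) M} (c : ℝ) (h : Tendsto f l (𝓝 v)) :
    Tendsto (fun i ↦ tsmul c (f i)) l (𝓝 (tsmul c v)) :=
  ((continuous_tsmul c).tendsto v).comp h

variable [T2Space M]

/-- A geodesic whose velocity vectors converge can be extended. -/
theorem flow_of_tendsto {x y : TangentBundle (𝓡∂ n) M} {u : ℕ → TangentBundle (𝓡∂ n) M}
    {s : ℕ → ℝ} {L : ℝ} (hy : y ∈ futureLightlike T) (hu : ∀ k, Flow T (s k) x (u k))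
    (hsL : ∀ k, s k < L) (hs : Tendsto s atTop (𝓝 L)) (huy : Tendsto u atTop (𝓝 y)) :
    Flow T L x y := by
  have := t2Space_tangentBundle (n := n) (M := M)
  -- Run backwards from the limit vector: the reversed geodesics from later vectors to a fixed `u
  -- k₀` have convergent initial vectors and lengths at most `δ`.
  obtain ⟨O, hO, δ, hδ, hloc⟩ := exists_local_flow_limit (neg_mem_futureLightlike hy)
  obtain ⟨k₀, hk₀⟩ := (hs.eventually_const_lt (show L - δ < L by linarith)).exists
  obtain ⟨k₁, hk₁⟩ := eventually_atTop.1 (hs.eventually_const_lt (hsL k₀))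
  obtain ⟨z, hz, hlim⟩ := hloc (fun k ↦ tsmul (-1) (u (k + k₁))) (fun _ ↦ tsmul (-1) (u k₀))
    (fun k ↦ s (k + k₁) - s k₀) (tsmul (-1) y) (L - s k₀) (mem_of_mem_nhds hO)
    (tendsto_tsmul _ (huy.comp (tendsto_add_atTop_nat k₁)))
    ((hs.comp (tendsto_add_atTop_nat k₁)).sub_const _)
    (fun k ↦ by linarith [hsL (k + k₁)]) (fun k ↦ by
      have hle : s k₀ ≤ s (k + k₁) := (hk₁ (k + k₁) (by omega)).le
      obtain ⟨w, hw1, hw2⟩ := (hu (k + k₁)).split ⟨(hu k₀).nonneg, hle⟩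
      rw [hw1.unique (hu k₀)] at hw2
      exact hw2.reverse)
  rw [← tendsto_nhds_unique tendsto_const_nhds hlim] at hz
  have := (hu k₀).trans hz.of_reverse
  rwa [add_sub_cancel] at this

/-- This is `growth_bounds` with `a` and `w` the values of `τ` on positions and on velocities. -/
theorem Flow.bounds_of_chart {x₀ : M} {U : Set M} {C : Set (Vec n)} {τ : Vec n →L[ℝ] ℝ}
    {κ K B : ℝ} (hκ : 0 < κ) (hK : 0 ≤ K)
    (hU : ∀ v ∈ futureLightlike T, v.1 ∈ U → v.1 ∈ (extChartAt (𝓡∂ n) x₀).source ∧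
        (coords x₀ v).1 ∈ C ∧ κ * ‖(coords x₀ v).2‖ ≤ -timeForm T x₀ (coords x₀ v).1 (coords x₀ v).2 ∧
        κ * ‖(coords x₀ v).2‖ ≤ τ (coords x₀ v).2 ∧
        |τ (acc g x₀ (coords x₀ v).1 (coords x₀ v).2)| ≤ K * τ (coords x₀ v).2 ^ 2 ∧
        |τ (coords x₀ v).1| ≤ B) {s : ℝ} {x y : TangentBundle (𝓡∂ n) M} (h : Flow T s x y)
    (hmem : ∀ r z, r ≤ s → Flow T r x z → z.1 ∈ U) :
    τ (coords x₀ y).2 ≤ τ (coords x₀ x).2 * Real.exp (2 * K * B) ∧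
      τ (coords x₀ x).2 * Real.exp (-(2 * K * B)) ≤ τ (coords x₀ y).2 ∧
      τ (coords x₀ x).2 * Real.exp (-(2 * K * B)) * s ≤ 2 * B := by
  obtain ⟨hs, Z, hZ, hX, rfl, rfl⟩ := h
  have hZU : ∀ t ∈ Icc 0 s, (Z t).1 ∈ U := fun t ht ↦ hmem (t - 0) _ (by linarith [ht.2])
    (hZ.flow hX le_rfl ht.1 ht.2)
  have hmain := fun t ht ↦ hU (Z t) (hX t ht) (hZU t ht)
  have hd : ∀ t ∈ Icc 0 s, HasDerivWithinAt (fun r ↦ coords x₀ (Z r))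
      (spray g x₀ (coords x₀ (Z t))) (Icc 0 s) t := fun t ht ↦ hZ.2 t ht x₀ (hmain t ht).1
  refine growth_bounds (a := fun t ↦ τ (coords x₀ (Z t)).1) (w := fun t ↦ τ (coords x₀ (Z t)).2)
    (w' := fun t ↦ τ (acc g x₀ (coords x₀ (Z t)).1 (coords x₀ (Z t)).2)) hs hK ?_ ?_ ?_ ?_ ?_
  · exact fun t ht ↦ τ.hasFDerivAt.comp_hasDerivWithinAt t
      ((hd t ht).hasFDerivWithinAt.fst.hasDerivWithinAt.congr_deriv (by simp [spray]))
  · exact fun t ht ↦ τ.hasFDerivAt.comp_hasDerivWithinAt t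
      ((hd t ht).hasFDerivWithinAt.snd.hasDerivWithinAt.congr_deriv (by simp [spray]))
  · intro t ht
    refine lt_of_lt_of_le (mul_pos hκ (norm_pos_iff.2 fun h0 ↦ ?_)) (hmain t ht).2.2.2.1
    have := ((mem_futureLightlike_iff_coords (hmain t ht).1).1 (hX t ht)).2
    rw [h0, map_zero] at this
    exact lt_irrefl _ this
  · exact fun t ht ↦ (hmain t ht).2.2.2.2.1
  · exact fun t ht ↦ (hmain t ht).2.2.2.2.2

/-- In a compact strongly causal manifold, each future-directed lightlike vector is the initial
velocity of a geodesic which can not be extended into the future. -/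
theorem exists_maximal_flow [CompactSpace M] (hc : StronglyCausal T) {x : TangentBundle (𝓡∂ n) M}
    (hx : x ∈ futureLightlike T) :
    ∃ L y, Flow T L x y ∧ ∀ r z, Flow T r y z → r = 0 := by
  set S : Set ℝ := {s | ∃ y, Flow T s x y} with hS
  have h0S : (0 : ℝ) ∈ S := ⟨x, Flow.refl hx⟩
  by_contra! hcon
  have hmax : ∀ s ∈ S, ∃ s' ∈ S, s < s' := by
    rintro s ⟨y, hy⟩
    obtain ⟨r, z, hz, hr⟩ := hcon s y hy
    exact ⟨s + r, ⟨z, hy.trans hz⟩, by linarith [lt_of_le_of_ne hz.nonneg hr.symm]⟩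
  have : Nonempty (TangentBundle (𝓡∂ n) M) := ⟨x⟩
  choose! Y hY using (fun s (hs : s ∈ S) ↦ hs)
  have hYX : ∀ s ∈ S, Y s ∈ futureLightlike T := fun s hs ↦ (hY s hs).right_mem
  have : Nonempty S := ⟨⟨0, h0S⟩⟩
  -- Without a last time, the base points still accumulate somewhere as the time increases in `S`.
  obtain ⟨p, hp⟩ := exists_clusterPt_of_compactSpace (map (fun s : S ↦ (Y s).1) atTop)
  have hfreq : ∀ V ∈ 𝓝 p, ∃ᶠ s : S in atTop, (Y s).1 ∈ V := mapClusterPt_iff_frequently.1 hp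
  obtain ⟨U, hUp, C, τ, κ, K, B, hC, hCt, hκ, hK, hU⟩ := exists_uniform_chart T p
  obtain ⟨V, hV, hVU, hord⟩ := hc p U hUp
  obtain ⟨⟨s₀, hs₀⟩, hs₀V⟩ := (hfreq V hV).exists
  -- A causal curve meets `V` in an interval of times. Since this one returns to `V` at arbitrarily
  -- late times, it never leaves `V` after `s₀`.
  have hin : ∀ s ∈ S, s₀ ≤ s → (Y s).1 ∈ V := by
    intro s hs hle
    obtain ⟨⟨s', hs'⟩, hss', hs'V⟩ := frequently_atTop.1 (hfreq V hV) ⟨s, hs⟩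
    change s ≤ s' at hss'
    rcases eq_or_lt_of_le (show 0 ≤ s' from (hY s' hs').nonneg) with h0 | h0
    · have := (hY s hs).nonneg
      rwa [show s = s' by linarith]
    · obtain ⟨γ, hγ, hγ0, hγs⟩ := (hY s' hs').exists_geodesic h0
      have hcurve : IsPiecewiseCurve (futureCausal T) γ 0 s' := isPiecewiseCurve_iff.2 ⟨h0,
        hγ.1.2.1.continuousOn, 1, fun i ↦ if i = 0 then 0 else s', by simp, by simp,
        fun i hi ↦ by
          obtain rfl : i = 0 := by omega
          simpa using ⟨h0, hγ.1.2.1, fun t ht ↦ Or.inr (hγ.2 t ht)⟩⟩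
      have hγY : ∀ t ∈ S, t ≤ s' → γ t = (Y t).1 := by
        intro t ht hts
        have h1 := flow_of_geodesic hγ le_rfl (hY t ht).nonneg hts
        rw [hγ0, sub_zero] at h1
        rw [← h1.unique (hY t ht)]
        rfl
      have h2 := (hord γ 0 s' hcurve).out (x := s₀)
        ⟨⟨(hY s₀ hs₀).nonneg, hle.trans hss'⟩, by
          rw [mem_preimage, hγY s₀ hs₀ (hle.trans hss')]; exact hs₀V⟩ (y := s')
        ⟨⟨h0.le, le_rfl⟩, by rw [mem_preimage, hγY s' hs' le_rfl]; exact hs'V⟩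
        (show s ∈ Icc s₀ s' from ⟨hle, hss'⟩)
      rw [← hγY s hs hss']
      exact h2.2
  have hsub : ∀ s ∈ S, s₀ ≤ s → Flow T (s - s₀) (Y s₀) (Y s) := by
    intro s hs hle
    obtain ⟨w, hw1, hw2⟩ := (hY s hs).split ⟨(hY s₀ hs₀).nonneg, hle⟩
    rwa [hw1.unique (hY s₀ hs₀)] at hw2
  have hb : ∀ s ∈ S, s₀ ≤ s → τ (coords p (Y s)).2 ≤ τ (coords p (Y s₀)).2 * Real.exp (2 * K * B) ∧
      τ (coords p (Y s₀)).2 * Real.exp (-(2 * K * B)) ≤ τ (coords p (Y s)).2 ∧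
      τ (coords p (Y s₀)).2 * Real.exp (-(2 * K * B)) * (s - s₀) ≤ 2 * B := by
    refine fun s hs hle ↦ (hsub s hs hle).bounds_of_chart hκ hK hU fun r z _ hz ↦ ?_
    have h1 : s₀ + r ∈ S := ⟨z, (hY s₀ hs₀).trans hz⟩
    rw [((hY s₀ hs₀).trans hz).unique (hY _ h1)]
    exact hVU (hin _ h1 (by linarith [hz.nonneg]))
  have hmainU := fun s hs hle ↦ hU (Y s) (hYX s hs) (hVU (hin s hs hle))
  have hw₀ : 0 < τ (coords p (Y s₀)).2 := by
    have h1 := hmainU s₀ hs₀ le_rfl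
    refine lt_of_lt_of_le (mul_pos hκ (norm_pos_iff.2 fun h0 ↦ ?_)) h1.2.2.2.1
    have := ((mem_futureLightlike_iff_coords h1.1).1 (hYX s₀ hs₀)).2
    rw [h0, map_zero] at this
    exact lt_irrefl _ this
  set m := τ (coords p (Y s₀)).2 * Real.exp (-(2 * K * B))
  have hm : 0 < m := mul_pos hw₀ (Real.exp_pos _)
  -- The coordinate `τ` is bounded on `U` and grows at rate at least `m`, so the total time is
  -- finite.
  have hbdd : BddAbove S := by
    refine ⟨s₀ + |2 * B / m|, fun s hs ↦ ?_⟩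
    rcases le_total s s₀ with h | h
    · linarith [abs_nonneg (2 * B / m)]
    · have h1 := (hb s hs h).2.2
      have h2 : s - s₀ ≤ 2 * B / m := by rw [le_div_iff₀ hm]; linarith
      linarith [le_abs_self (2 * B / m)]
  obtain ⟨s₁, hs₁, hs₀₁⟩ := hmax s₀ hs₀
  have hs₁L : s₁ ≤ sSup S := le_csSup hbdd hs₁
  obtain ⟨q, hqmono, hqL, hqS⟩ := exists_seq_tendsto_sSup ⟨0, h0S⟩ hbdd
  have hqlt : ∀ k, q k < sSup S := fun k ↦ by
    obtain ⟨s', hs', hlt⟩ := hmax _ (hqS k)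
    exact hlt.trans_le (le_csSup hbdd hs')
  obtain ⟨k₀, hk₀⟩ := eventually_atTop.1 (hqL.eventually_const_lt (hs₀₁.trans_le hs₁L))
  have hqk : ∀ k, s₀ ≤ q (k + k₀) := fun k ↦ (hk₀ (k + k₀) (by omega)).le
  -- The late velocities lie in a fixed compact set in coordinates, and the lower bound `m` on `τ`
  -- prevents their limit from vanishing.
  set R := τ (coords p (Y s₀)).2 * Real.exp (2 * K * B) / κ
  have hcpt : IsCompact (C ×ˢ Metric.closedBall (0 : Vec n) R) :=
    hC.prod (isCompact_closedBall 0 R)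
  have hmemc : ∀ k, coords p (Y (q (k + k₀))) ∈ C ×ˢ Metric.closedBall (0 : Vec n) R := by
    intro k
    have h1 := hmainU _ (hqS (k + k₀)) (hqk k)
    refine ⟨h1.2.1, ?_⟩
    rw [mem_closedBall_zero_iff, le_div_iff₀ hκ, mul_comm]
    exact h1.2.2.2.1.trans (hb _ (hqS (k + k₀)) (hqk k)).1
  obtain ⟨z, hz, φ, hφ, hlim⟩ := hcpt.tendsto_subseq hmemc
  have hzt : z.1 ∈ (extChartAt (𝓡∂ n) p).target := hCt hz.1
  have hlim' : Tendsto (fun k ↦ coords p (Y (q (φ k + k₀)))) atTop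
      (𝓝[{z | z.1 ∈ (extChartAt (𝓡∂ n) p).target}] z) :=
    tendsto_nhdsWithin_iff.2 ⟨hlim, Eventually.of_forall fun k ↦ hCt (hmemc _).1⟩
  have hG : metricForm g p z.1 z.2 z.2 = 0 := by
    refine tendsto_nhds_unique (((continuousOn_metricForm_apply g p) z hzt).tendsto.comp hlim')
      (tendsto_const_nhds.congr fun k ↦ ?_)
    exact ((mem_futureLightlike_iff_coords (hmainU _ (hqS _) (hqk _)).1).1 (hYX _ (hqS _))).1.symm
  have hθ : κ * ‖z.2‖ ≤ -timeForm T p z.1 z.2 := by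
    have h1 : ContinuousOn (fun z : Vec n × Vec n ↦ timeForm T p z.1 z.2)
        {z | z.1 ∈ (extChartAt (𝓡∂ n) p).target} :=
      ((contDiffOn_timeForm T p).continuousOn.comp continuous_fst.continuousOn
        (fun z hz ↦ hz)).clm_apply continuous_snd.continuousOn
    have h2 := ((h1 z hzt).tendsto.comp hlim').neg
    have h3 := ((continuous_snd.tendsto z).comp hlim).norm.const_mul κ
    exact le_of_tendsto_of_tendsto' h3 h2 fun k ↦ (hmainU _ (hqS _) (hqk _)).2.2.1
  have hτz : m ≤ τ z.2 := by
    have h3 := (τ.continuous.tendsto z.2).comp ((continuous_snd.tendsto z).comp hlim)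
    exact ge_of_tendsto' h3 fun k ↦ (hb _ (hqS _) (hqk _)).2.1
  have hz2 : z.2 ≠ 0 := by
    intro h0
    rw [h0, map_zero] at hτz
    linarith
  have hyX : ofCoords p z ∈ futureLightlike T := by
    rw [mem_futureLightlike_iff_coords (x₀ := p) ((extChartAt (𝓡∂ n) p).map_target hzt),
      coords_ofCoords p hzt]
    exact ⟨hG, by linarith [mul_pos hκ (norm_pos_iff.2 hz2)]⟩
  have hYlim : Tendsto (fun k ↦ Y (q (φ k + k₀))) atTop (𝓝 (ofCoords p z)) := by
    refine ((continuousOn_ofCoords p z hzt).tendsto.comp hlim').congr fun k ↦ ?_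
    exact ofCoords_coords p (hmainU _ (hqS _) (hqk _)).1
  -- The geodesic extends to the supremum, which then belongs to `S` although `S` has no maximum.
  have hfl := flow_of_tendsto (L := sSup S) hyX (fun k ↦ hY _ (hqS (φ k + k₀)))
    (fun k ↦ hqlt _) (hqL.comp ((tendsto_add_atTop_nat k₀).comp hφ.tendsto_atTop)) hYlim
  obtain ⟨s', hs', hlt⟩ := hmax _ ⟨_, hfl⟩
  exact absurd (le_csSup hbdd hs') (not_le.2 hlt)

end Nontrapping

/-! ### Order and proportionality along lightlike geodesics -/

section Lines

variable {n : ℕ} [NeZero n]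
  {M : Type*} [TopologicalSpace M] [ChartedSpace (EuclideanHalfSpace n) M]
  [IsManifold (𝓡∂ n) ∞ M] {g : LorentzMetric n M} {T : TimeOrientation g}
  {x y z x' y' : TangentBundle (𝓡∂ n) M}

/-- `x` and `y` are velocity vectors, in this order, of a future-directed lightlike geodesic. -/
def Le (T : TimeOrientation g) (x y : TangentBundle (𝓡∂ n) M) : Prop := ∃ s, Flow T s x y

theorem Le.left_mem (h : Le T x y) : x ∈ futureLightlike T := h.choose_spec.left_mem

theorem Le.right_mem (h : Le T x y) : y ∈ futureLightlike T := h.choose_spec.right_mem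

theorem Le.refl (hx : x ∈ futureLightlike T) : Le T x x := ⟨0, Flow.refl hx⟩

theorem Le.trans (h : Le T x y) (h' : Le T y z) : Le T x z := by
  obtain ⟨s, hs⟩ := h
  obtain ⟨t, ht⟩ := h'
  exact ⟨s + t, hs.trans ht⟩

theorem Le.smul (h : Le T x y) {c : ℝ} (hc : 0 < c) : Le T (tsmul c x) (tsmul c y) :=
  ⟨_, h.choose_spec.smul hc⟩

theorem Le.reverse (h : Le T x y) : Le T.reverse (tsmul (-1) y) (tsmul (-1) x) :=
  ⟨_, h.choose_spec.reverse⟩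

theorem Le.of_reverse (h : Le T.reverse (tsmul (-1) y) (tsmul (-1) x)) : Le T x y :=
  ⟨_, h.choose_spec.of_reverse⟩

theorem Le.of_reverse' (h : Le T.reverse x y) : Le T (tsmul (-1) y) (tsmul (-1) x) := by
  have := h.reverse
  rwa [T.reverse_reverse] at this

theorem Le.transGen (h : Le T x y) (hxy : x ≠ y) :
    Relation.TransGen (SmoothReach (futureCausal T)) x.1 y.1 := by
  obtain ⟨s, hs⟩ := h
  refine .single (hs.smoothReach (lt_of_le_of_ne hs.nonneg ?_))
  rintro rfl
  exact hxy hs.eq_of_zero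

/-- The vectors are proportional by a positive factor. -/
def Par (x y : TangentBundle (𝓡∂ n) M) : Prop := ∃ c : ℝ, 0 < c ∧ y = tsmul c x

theorem Par.symm (h : Par x y) : Par y x := by
  obtain ⟨c, hc, rfl⟩ := h
  exact ⟨c⁻¹, inv_pos.2 hc, by rw [tsmul_tsmul, inv_mul_cancel₀ hc.ne', tsmul_one]⟩

theorem Par.trans (h : Par x y) (h' : Par y z) : Par x z := by
  obtain ⟨c, hc, rfl⟩ := h
  obtain ⟨d, hd, rfl⟩ := h'
  exact ⟨d * c, mul_pos hd hc, tsmul_tsmul d c x⟩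

/-- `x` and `y` are velocity vectors of the same future-directed lightlike geodesic. -/
def Cmp (T : TimeOrientation g) (x y : TangentBundle (𝓡∂ n) M) : Prop := Le T x y ∨ Le T y x

theorem Le.cmp (h : Le T x y) : Cmp T x y := Or.inl h

theorem Le.cmp' (h : Le T x y) : Cmp T y x := Or.inr h

theorem Cmp.symm (h : Cmp T x y) : Cmp T y x := h.elim Or.inr Or.inl

theorem Cmp.smul (h : Cmp T x y) {c : ℝ} (hc : 0 < c) : Cmp T (tsmul c x) (tsmul c y) :=
  h.imp (fun h ↦ h.smul hc) (fun h ↦ h.smul hc)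

theorem Cmp.reverse (h : Cmp T x y) : Cmp T.reverse (tsmul (-1) x) (tsmul (-1) y) :=
  h.elim (fun h ↦ Or.inr h.reverse) (fun h ↦ Or.inl h.reverse)

/-- A lightlike geodesic which is not a point is a lightlike geodesic in the sense of curves. -/
theorem Le.exists_geodesic (h : Le T x y) (hxy : x ≠ y) :
    ∃ (γ : ℝ → M) (s : ℝ), 0 < s ∧ IsFutureLightlikeGeodesic T γ 0 s ∧ velocity γ 0 s 0 = x ∧
      velocity γ 0 s s = y := by
  obtain ⟨s, hs⟩ := h
  have hs0 : 0 < s := by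
    refine lt_of_le_of_ne hs.nonneg ?_
    rintro rfl
    exact hxy hs.eq_of_zero
  obtain ⟨γ, hγ, h0, h1⟩ := hs.exists_geodesic hs0
  exact ⟨γ, s, hs0, hγ, h0, h1⟩

theorem le_of_geodesic {γ : ℝ → M} {a b t t' : ℝ} (h : IsFutureLightlikeGeodesic T γ a b)
    (hat : a ≤ t) (htt' : t ≤ t') (htb : t' ≤ b) :
    Le T (velocity γ a b t) (velocity γ a b t') := ⟨_, flow_of_geodesic h hat htt' htb⟩

theorem IsFutureLightlikeGeodesic.isLightlikeGeodesic {γ : ℝ → M} {a b : ℝ}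
    (h : IsFutureLightlikeGeodesic T γ a b) : IsLightlikeGeodesic g γ a b :=
  ⟨h.1, fun t ht ↦ (h.2 t ht).1⟩

variable [T2Space M]

/-- By uniqueness, the longer geodesic passes through the end vector of the shorter one. -/
theorem Le.total_right (h : Le T x y) (h' : Le T x z) : Cmp T y z := by
  obtain ⟨s, hs⟩ := h
  obtain ⟨t, ht⟩ := h'
  rcases le_total s t with hst | hst
  · obtain ⟨w, hw, hw'⟩ := ht.split ⟨hs.nonneg, hst⟩
    rw [hw.unique hs] at hw'
    exact Or.inl ⟨_, hw'⟩
  · obtain ⟨w, hw, hw'⟩ := hs.split ⟨ht.nonneg, hst⟩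
    rw [hw.unique ht] at hw'
    exact Or.inr ⟨_, hw'⟩

theorem Le.total_left (h : Le T y x) (h' : Le T z x) : Cmp T y z := by
  have := (h.reverse.total_right h'.reverse).reverse
  rwa [tsmul_neg_neg, tsmul_neg_neg, T.reverse_reverse] at this

theorem Cmp.trans (h : Cmp T x y) (h' : Cmp T y z) : Cmp T x z := by
  rcases h with h | h <;> rcases h' with h' | h'
  · exact (h.trans h').cmp
  · exact h.total_left h'
  · exact h.total_right h'
  · exact (h'.trans h).cmp'

/-- Otherwise the geodesic would be a closed causal curve. -/
theorem Le.eq_of_base (hc : StronglyCausal T) (h : Le T x y) (hxy : x.1 = y.1) : x = y := by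
  by_contra hne
  have := h.transGen hne
  rw [← hxy] at this
  exact hc.not_transGen _ this

theorem Cmp.eq_of_base (hc : StronglyCausal T) (h : Cmp T x y) (hxy : x.1 = y.1) : x = y :=
  h.elim (fun h ↦ h.eq_of_base hc hxy) (fun h ↦ (h.eq_of_base hc hxy.symm).symm)

theorem Le.not_loop (hc : StronglyCausal T) (h : Le T x y) (h' : Le T x' y') (h1 : y.1 = x'.1)
    (h2 : y'.1 = x.1) : x = y := by
  by_contra hne
  have h3 := h.transGen hne
  rcases eq_or_ne x' y' with rfl | hne'
  · rw [← h2, h1] at h3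
    exact hc.not_transGen _ h3
  · have h4 := h'.transGen hne'
    rw [← h1, h2] at h4
    exact hc.not_transGen _ (h3.trans h4)

theorem Le.antisymm (hc : StronglyCausal T) (h : Le T x y) (h' : Le T y x) : x = y :=
  h.not_loop hc h' rfl rfl

/-- Geodesics with the same initial point and the same image have proportional initial
velocities. -/
theorem par_of_image_eq (hc : StronglyCausal T) {γ σ : ℝ → M} {s s' : ℝ}
    (hγ : IsFutureLightlikeGeodesic T γ 0 s) (hσ : IsFutureLightlikeGeodesic T σ 0 s')
    (h0 : γ 0 = σ 0) (him : γ '' Icc 0 s ⊆ σ '' Icc 0 s') :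
    Par (velocity (n := n) γ 0 s 0) (velocity σ 0 s' 0) := by
  have hs : 0 < s := hγ.1.1
  have hs' : 0 < s' := hσ.1.1
  have hinj : ∀ {ρ : ℝ → M} {r t t' : ℝ}, IsFutureLightlikeGeodesic T ρ 0 r → 0 ≤ t → t < t' →
      t' ≤ r → ρ t ≠ ρ t' := by
    intro ρ r t t' hρ h1 h2 h3 heq
    have h4 := (flow_of_geodesic hρ h1 h2.le h3).smoothReach (by linarith)
    change SmoothReach _ (ρ t) (ρ t') at h4
    rw [← heq] at h4
    exact hc.not_transGen _ (.single h4)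
  set p := γ 0 with hp
  -- The points of `γ` at these times are points of `σ` at times `t' k`. Their difference quotients
  -- in a chart converge to the two initial velocities.
  set t : ℕ → ℝ := fun k ↦ s / (k + 1) with ht
  have htpos : ∀ k, 0 < t k := fun k ↦ by positivity
  have hts : ∀ k, t k ≤ s := fun k ↦ div_le_self hs.le (by linarith [k.cast_nonneg (α := ℝ)])
  have htI : ∀ k, t k ∈ Icc 0 s := fun k ↦ ⟨(htpos k).le, hts k⟩
  have htlim : Tendsto t atTop (𝓝 0) := by
    have := tendsto_one_div_add_atTop_nhds_zero_nat (𝕜 := ℝ)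
    have := this.const_mul s
    simpa [ht, div_eq_mul_inv] using this
  choose t' ht'I ht'eq using fun k ↦ him ⟨t k, htI k, rfl⟩
  have hγc : ContinuousOn γ (Icc 0 s) := hγ.1.2.1.continuousOn
  have hσc : ContinuousOn σ (Icc 0 s') := hσ.1.2.1.continuousOn
  have ht'pos : ∀ k, 0 < t' k := by
    refine fun k ↦ lt_of_le_of_ne (ht'I k).1 fun h ↦ ?_
    have h1 := ht'eq k
    rw [← h, ← h0] at h1
    exact hinj hγ le_rfl (htpos k) (hts k) h1
  have hγlim : Tendsto (fun k ↦ γ (t k)) atTop (𝓝 p) :=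
    (hγc 0 (left_mem_Icc.2 hs.le)).tendsto.comp
      (tendsto_nhdsWithin_iff.2 ⟨htlim, Eventually.of_forall htI⟩)
  -- The image of `[ε, s']` under `σ` is closed and misses `p`, since the causal curve `σ` does not
  -- return.
  have ht'lim : Tendsto t' atTop (𝓝 0) := by
    refine tendsto_order.2 ⟨fun a ha ↦ Eventually.of_forall fun k ↦ ha.trans (ht'pos k),
      fun ε hε ↦ ?_⟩
    have h1 : IsClosed (σ '' Icc ε s') :=
      (isCompact_Icc.image_of_continuousOn (hσc.mono (Icc_subset_Icc_left hε.le))).isClosed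
    have h2 : p ∉ σ '' Icc ε s' := by
      rintro ⟨r, hr, hrp⟩
      exact hinj hσ le_rfl (hε.trans_le hr.1) hr.2 (by rw [hrp, ← h0])
    filter_upwards [hγlim (h1.isOpen_compl.mem_nhds h2)] with k hk
    by_contra! hcon
    exact hk ⟨t' k, ⟨hcon, (ht'I k).2⟩, ht'eq k⟩
  have hderiv : ∀ {ρ : ℝ → M} {r : ℝ} {q : ℕ → ℝ}, IsFutureLightlikeGeodesic T ρ 0 r → ρ 0 = p →
      (∀ k, 0 < q k) → (∀ k, q k ∈ Icc 0 r) → Tendsto q atTop (𝓝 0) →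
      Tendsto (fun k ↦ (q k)⁻¹ • (extChartAt (𝓡∂ n) p (ρ (q k)) - extChartAt (𝓡∂ n) p p)) atTop
        (𝓝 (coords p (velocity ρ 0 r 0)).2) := by
    intro ρ r q hρ hρ0 hq hqI hqlim
    have h0r : (0 : ℝ) ∈ Icc 0 r := left_mem_Icc.2 hρ.1.1.le
    have h1 := hρ.1.isIntegral.2 0 h0r p (by
      change ρ 0 ∈ _
      rw [hρ0]
      exact mem_extChartAt_source p)
    have h2 : HasDerivWithinAt (fun r' ↦ extChartAt (𝓡∂ n) p (ρ r'))
        (coords p (velocity ρ 0 r 0)).2 (Icc 0 r) 0 :=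
      h1.hasFDerivWithinAt.fst.hasDerivWithinAt.congr_deriv (by simp [spray])
    have h3 := (hasDerivWithinAt_iff_tendsto_slope.1 h2).comp (tendsto_nhdsWithin_iff.2 ⟨hqlim,
      Eventually.of_forall fun k ↦ ⟨hqI k, (hq k).ne'⟩⟩)
    refine h3.congr fun k ↦ ?_
    simp only [Function.comp, slope_def_module, sub_zero, hρ0]
  have hu := hderiv hγ rfl htpos htI htlim
  have hw := hderiv hσ h0.symm ht'pos ht'I ht'lim
  have hsrc1 : (velocity (n := n) γ 0 s 0).1 ∈ (extChartAt (𝓡∂ n) p).source :=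
    mem_extChartAt_source p
  have hsrc2 : (velocity (n := n) σ 0 s' 0).1 ∈ (extChartAt (𝓡∂ n) p).source := by
    change σ 0 ∈ _
    rw [← h0]
    exact mem_extChartAt_source p
  have hne : ∀ {v : TangentBundle (𝓡∂ n) M}, v ∈ futureLightlike T →
      v.1 ∈ (extChartAt (𝓡∂ n) p).source → 0 < ‖(coords p v).2‖ := by
    intro v hv hvs
    refine norm_pos_iff.2 fun h ↦ ?_
    have := ((mem_futureLightlike_iff_coords hvs).1 hv).2
    rw [h, map_zero] at this
    exact lt_irrefl _ this
  set u := (coords p (velocity (n := n) γ 0 s 0)).2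
  set w := (coords p (velocity (n := n) σ 0 s' 0)).2
  have hu0 : 0 < ‖u‖ := hne (hγ.2 0 (left_mem_Icc.2 hs.le)) hsrc1
  have hw0 : 0 < ‖w‖ := hne (hσ.2 0 (left_mem_Icc.2 hs'.le)) hsrc2
  -- Both difference quotients are positive multiples of the same vector; equality of directions
  -- survives in the limit.
  have key : ‖w‖ • u = ‖u‖ • w := by
    refine tendsto_nhds_unique (hw.norm.smul hu) ((hu.norm.smul hw).congr fun k ↦ ?_)
    rw [ht'eq k, norm_smul, norm_smul, smul_smul, smul_smul, norm_inv, norm_inv,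
      Real.norm_of_nonneg (htpos k).le, Real.norm_of_nonneg (ht'pos k).le]
    congr 1
    ring
  refine ⟨‖w‖ / ‖u‖, div_pos hw0 hu0, ?_⟩
  refine eq_of_coords (x₀ := p) hsrc2 (by exact hsrc1) ?_
  rw [coords_tsmul]
  refine Prod.ext ?_ ?_
  · exact congrArg (extChartAt (𝓡∂ n) p) h0.symm
  · change w = (‖w‖ / ‖u‖) • u
    rw [div_eq_inv_mul, mul_smul, key, smul_smul, inv_mul_cancel₀ hu0.ne', one_smul]

/-- No refocusing gives equal images, hence proportional initial vectors. The rescaled `y` is then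
comparable with `y'` over the same base point, so they agree. -/
theorem Le.par_of_base (hc : StronglyCausal T) (hr : NoRefocusing g) (h : Le T x y)
    (h' : Le T x' y') (h1 : x.1 = x'.1) (h2 : y.1 = y'.1) (hne : x.1 ≠ y.1) :
    ∃ c : ℝ, 0 < c ∧ x' = tsmul c x ∧ y' = tsmul c y := by
  obtain ⟨γ, s, hs, hγ, rfl, rfl⟩ := h.exists_geodesic (by rintro rfl; exact hne rfl)
  obtain ⟨σ, s', hs', hσ, rfl, rfl⟩ := h'.exists_geodesic (by
    rintro rfl; exact hne (h1.trans h2.symm))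
  have him := hr γ σ 0 s 0 s' hγ.isLightlikeGeodesic hσ.isLightlikeGeodesic h1 h2
  obtain ⟨c, hc0, hcx⟩ := par_of_image_eq hc hγ hσ h1 him.subset
  refine ⟨c, hc0, hcx, ?_⟩
  have h3 := h.smul hc0
  rw [← hcx] at h3
  exact (h'.total_right h3).eq_of_base hc h2.symm

/-- If two lightlike geodesics have two points in common, then they agree. -/
theorem Cmp.par_of_base (hc : StronglyCausal T) (hr : NoRefocusing g) (h : Cmp T x y)
    (h' : Cmp T x' y') (h1 : x.1 = x'.1) (h2 : y.1 = y'.1) (hne : x.1 ≠ y.1) :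
    ∃ c : ℝ, 0 < c ∧ x' = tsmul c x ∧ y' = tsmul c y := by
  rcases h with h | h <;> rcases h' with h' | h'
  · exact h.par_of_base hc hr h' h1 h2 hne
  -- Geodesics running in opposite orders would close up to a causal loop.
  · exact absurd (congrArg (·.1) (h.not_loop hc h' h2 h1.symm)) hne
  · exact absurd (congrArg (·.1) (h.not_loop hc h' h1 h2.symm)).symm hne
  · obtain ⟨c, hc0, h3, h4⟩ := h.par_of_base hc hr h' h2 h1 hne.symm
    exact ⟨c, hc0, h4, h3⟩

/-- A vector which is the final velocity of any geodesic with this velocity vector. -/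
def IsEnd (T : TimeOrientation g) (x : TangentBundle (𝓡∂ n) M) : Prop := ∀ y, Le T x y → y = x

theorem mem_interior_iff {p : M} :
    p ∈ (𝓡∂ n).interior M ↔ 0 < extChartAt (𝓡∂ n) p p 0 := by
  change extChartAt (𝓡∂ n) p p ∈ interior (range (𝓡∂ n)) ↔ _
  rw [interior_range_modelWithCornersEuclideanHalfSpace]
  rfl

theorem mem_interior_or_boundary (p : M) : p ∈ (𝓡∂ n).interior M ∨ p ∈ (𝓡∂ n).boundary M :=
  (𝓡∂ n).isInteriorPoint_or_isBoundaryPoint p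

theorem not_mem_boundary {p : M} (h : p ∈ (𝓡∂ n).interior M) : p ∉ (𝓡∂ n).boundary M :=
  fun h' ↦ disjoint_left.1 (𝓡∂ n).disjoint_interior_boundary h h'

theorem not_isEnd (hx : x ∈ futureLightlike T) (hc : StronglyCausal T)
    (h : x.1 ∈ (𝓡∂ n).interior M ∨ 0 < vecOf x 0) :
    ∃ y, Le T x y ∧ x ≠ y := by
  obtain ⟨δ, hδ, y, hy⟩ := exists_flow hx (h.imp_left mem_interior_iff.1)
  refine ⟨y, ⟨δ, hy⟩, ?_⟩
  rintro rfl
  exact hc.not_transGen _ (.single (hy.smoothReach hδ))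

theorem exists_lt (hx : x ∈ futureLightlike T) (hc : StronglyCausal T)
    (h : x.1 ∈ (𝓡∂ n).interior M ∨ vecOf x 0 < 0) :
    ∃ y, Le T y x ∧ y ≠ x := by
  obtain ⟨y, hy, hne⟩ := not_isEnd (neg_mem_futureLightlike hx) hc.reverse
    (h.imp_right fun h ↦ by
      rw [vecOf_tsmul]
      change 0 < (-1 : ℝ) * vecOf x 0
      linarith)
  refine ⟨tsmul (-1) y, ?_, ?_⟩
  · have := hy.of_reverse'
    rwa [tsmul_neg_neg] at this
  · rintro rfl
    exact hne (tsmul_neg_neg y)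

theorem IsEnd.boundary (hc : StronglyCausal T) (hx : x ∈ futureLightlike T) (h : IsEnd T x) :
    x.1 ∈ (𝓡∂ n).boundary M := by
  refine (mem_interior_or_boundary x.1).resolve_left fun hi ↦ ?_
  obtain ⟨y, hy, hne⟩ := not_isEnd hx hc (Or.inl hi)
  exact hne (h y hy).symm

variable [CompactSpace M]

theorem exists_isEnd (hc : StronglyCausal T) (hx : x ∈ futureLightlike T) :
    ∃ y, Le T x y ∧ IsEnd T y := by
  obtain ⟨L, y, hy, hmax⟩ := exists_maximal_flow hc hx
  refine ⟨y, ⟨L, hy⟩, ?_⟩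
  rintro z ⟨r, hr⟩
  obtain rfl := hmax r z hr
  exact hr.eq_of_zero.symm

/-- The first vector at the boundary on a lightlike geodesic. -/
theorem exists_first_boundary (hc : StronglyCausal T) (hx : x ∈ futureLightlike T) :
    ∃ y, y ∈ boundaryTangent n M ∧ Le T x y ∧ ∀ z ∈ boundaryTangent n M, Le T x z → Le T y z := by
  obtain ⟨y, hxy, hy⟩ := exists_isEnd hc hx
  have hyb := hy.boundary hc hxy.right_mem
  obtain ⟨L, hL, Z, hZ, hX, rfl, rfl⟩ := hxy
  have hcl : IsClosed (Icc 0 L ∩ (fun t ↦ (Z t).1) ⁻¹' (𝓡∂ n).boundary M) :=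
    (continuous_base.comp_continuousOn hZ.1).preimage_isClosed_of_isClosed isClosed_Icc
      ((𝓡∂ n).isClosed_boundary (n := ∞) (by simp))
  have hcpt := isCompact_Icc.of_isClosed_subset hcl inter_subset_left
  obtain ⟨t, ht, hmin⟩ := hcpt.exists_isLeast ⟨L, right_mem_Icc.2 hL, hyb⟩
  refine ⟨Z t, ht.2, ⟨_, hZ.flow hX le_rfl ht.1.1 ht.1.2⟩, fun z hz hxz ↦ ?_⟩
  obtain ⟨r, hr⟩ := hxz
  -- `Z L` is an end, so `z` cannot come strictly after it.
  have hrL : r ≤ L := by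
    by_contra! h
    obtain ⟨w, hw, hw'⟩ := hr.split ⟨hL, h.le⟩
    have h1 := hZ.flow hX le_rfl hL le_rfl
    rw [sub_zero] at h1
    rw [hw.unique h1] at hw'
    have h2 := hy z ⟨_, hw'⟩
    have h3 := hw'.smoothReach (by linarith)
    rw [h2] at h3
    exact hc.not_transGen _ (.single h3)
  have h1 := hZ.flow hX le_rfl hr.nonneg hrL
  rw [sub_zero] at h1
  rw [← h1.unique hr] at hz ⊢
  exact ⟨_, hZ.flow hX ht.1.1 (hmin ⟨⟨hr.nonneg, hrL⟩, hz⟩) hrL⟩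

/-- The last vector at the boundary on a lightlike geodesic up to a given vector. -/
theorem exists_last_boundary (hc : StronglyCausal T) (hx : x ∈ futureLightlike T) :
    ∃ y, y ∈ boundaryTangent n M ∧ Le T y x ∧ ∀ z ∈ boundaryTangent n M, Le T z x → Le T z y := by
  obtain ⟨y, hy, hxy, hmin⟩ := exists_first_boundary hc.reverse (neg_mem_futureLightlike hx)
  refine ⟨tsmul (-1) y, hy, ?_, fun z hz hzx ↦ ?_⟩
  · have := hxy.of_reverse'
    rwa [tsmul_neg_neg] at this
  · have := (hmin (tsmul (-1) z) hz hzx.reverse).of_reverse'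
    rwa [tsmul_neg_neg] at this

end Lines

/-! ### Limits of long geodesics -/

section Limits

variable {n : ℕ} [NeZero n]
  {M : Type*} [TopologicalSpace M] [ChartedSpace (EuclideanHalfSpace n) M]
  [IsManifold (𝓡∂ n) ∞ M] {g : LorentzMetric n M} {T : TimeOrientation g}
  {v x y : TangentBundle (𝓡∂ n) M}

/-- Geodesics of lengths at most `t` whose initial velocities converge to `v` converge. -/
def ConvergesUpTo (T : TimeOrientation g) (v : TangentBundle (𝓡∂ n) M) (t : ℝ) : Prop :=
  ∀ (u w : ℕ → TangentBundle (𝓡∂ n) M) (r : ℕ → ℝ) (r' : ℝ), Tendsto u atTop (𝓝 v) →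
    Tendsto r atTop (𝓝 r') → (∀ k, r k ≤ t) → (∀ k, Flow T (r k) (u k) (w k)) →
    ∃ z, Flow T r' v z ∧ Tendsto w atTop (𝓝 z)

theorem ConvergesUpTo.mono {t t' : ℝ} (h : ConvergesUpTo T v t) (ht : t' ≤ t) :
    ConvergesUpTo T v t' := fun u w r r' h1 h2 h3 h4 ↦ h u w r r' h1 h2 (fun k ↦ (h3 k).trans ht) h4

variable [T2Space M]

/-- Split the `k`-th geodesic at `min (r k) t`. The first parts converge, and so do the rests,
started near `y`; if `r' < t`, the rests eventually have length `0`. -/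
theorem ConvergesUpTo.add {t δ : ℝ} (hδ : 0 ≤ δ) (h : ConvergesUpTo T v t)
    (hy : Flow T t v y) (h' : ConvergesUpTo T y δ) : ConvergesUpTo T v (t + δ) := by
  intro u w r r' hu hr hrt hfl
  have hr1 : Tendsto (fun k ↦ min (r k) t) atTop (𝓝 (min r' t)) := hr.min tendsto_const_nhds
  choose m hm hm' using fun k ↦ (hfl k).split (r := min (r k) t)
    ⟨le_min (hfl k).nonneg hy.nonneg, min_le_left _ _⟩
  obtain ⟨m', hm'1, hm'2⟩ := h u m _ _ hu hr1 (fun k ↦ min_le_right _ _) hm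
  rcases lt_or_ge r' t with hlt | hge
  · refine ⟨m', by rwa [min_eq_left hlt.le] at hm'1, hm'2.congr' ?_⟩
    filter_upwards [hr.eventually_lt_const hlt] with k hk
    have := hm' k
    rw [min_eq_left hk.le, sub_self] at this
    exact this.eq_of_zero
  · rw [min_eq_right hge] at hm'1 hr1
    obtain rfl := hm'1.unique hy
    obtain ⟨z, hz, hwz⟩ := h' m w _ _ hm'2 (hr.sub hr1) (fun k ↦ by
      rcases le_total (r k) t with h1 | h1
      · rw [min_eq_left h1, sub_self]
        exact hδ
      · rw [min_eq_right h1]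
        linarith [hrt k]) hm'
    exact ⟨z, by simpa using hy.trans hz, hwz⟩

theorem exists_nhds_convergesUpTo (hx : x ∈ futureLightlike T) :
    ∃ O ∈ 𝓝 x, ∃ δ > 0, ∀ y ∈ O, ConvergesUpTo T y δ := by
  obtain ⟨O, hO, δ, hδ, h⟩ := exists_local_flow_limit hx
  exact ⟨O, hO, δ, hδ, fun y hy u w r r' h1 h2 h3 h4 ↦ h u w r y r' hy h1 h2 h3 h4⟩

/-- At the supremum of the admissible times in `[0, L]`, a step of length `δ` is allowed from all
nearby vectors of the geodesic. It leads beyond the supremum, so the supremum is `L` and is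
surpassed. -/
theorem exists_convergesUpTo_gt {L : ℝ} (h : Flow T L v y) : ∃ ε > 0, ConvergesUpTo T v (L + ε) := by
  obtain ⟨hL, Z, hZ, hX, rfl, rfl⟩ := h
  set A : Set ℝ := {t | t ∈ Icc 0 L ∧ ConvergesUpTo T (Z 0) t} with hA
  have hZf : ∀ t ∈ Icc 0 L, Flow T t (Z 0) (Z t) := fun t ht ↦ by
    simpa using hZ.flow hX le_rfl ht.1 ht.2
  have h0A : (0 : ℝ) ∈ A := by
    obtain ⟨O, hO, δ, hδ, hloc⟩ := exists_nhds_convergesUpTo (hX 0 (left_mem_Icc.2 hL))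
    exact ⟨left_mem_Icc.2 hL, (hloc _ (mem_of_mem_nhds hO)).mono hδ.le⟩
  have hbdd : BddAbove A := ⟨L, fun t ht ↦ ht.1.2⟩
  set s := sSup A
  have hsI : s ∈ Icc 0 L := ⟨le_csSup hbdd h0A, csSup_le ⟨0, h0A⟩ fun t ht ↦ ht.1.2⟩
  obtain ⟨O, hO, δ, hδ, hloc⟩ := exists_nhds_convergesUpTo (hX s hsI)
  obtain ⟨ε, hε, hball⟩ := Metric.mem_nhdsWithin_iff.1 (hZ.1 s hsI hO)
  obtain ⟨t, htA, hts⟩ := exists_lt_of_lt_csSup ⟨0, h0A⟩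
    (show s - min ε (δ / 2) < s by linarith [lt_min hε (half_pos hδ)])
  have hts' : t ≤ s := le_csSup hbdd htA
  have h1 := htA.2.add hδ.le (hZf t htA.1) (hloc _ (hball ⟨by
    rw [Metric.mem_ball, Real.dist_eq, abs_lt]
    exact ⟨by linarith [min_le_left ε (δ / 2)], by linarith⟩, htA.1⟩))
  have h2 : ConvergesUpTo T (Z 0) (s + δ / 2) := h1.mono (by linarith [min_le_right ε (δ / 2)])
  rcases eq_or_lt_of_le hsI.2 with h3 | h3
  · exact ⟨δ / 2, half_pos hδ, h3 ▸ h2⟩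
  · have h4 : min (s + δ / 2) L ∈ A := ⟨⟨le_min (by linarith [hsI.1]) hL, min_le_right _ _⟩,
      h2.mono (min_le_left _ _)⟩
    have h5 : s < min (s + δ / 2) L := lt_min (by linarith) h3
    exact absurd (le_csSup hbdd h4) (not_le.2 h5)

variable [CompactSpace M]

/-- If the initial velocities of geodesics converge and their final points converge to `p`, then the
limit geodesic passes through `p`. -/
theorem exists_le_of_tendsto (hc : StronglyCausal T) (hv : v ∈ futureLightlike T)
    {u w : ℕ → TangentBundle (𝓡∂ n) M} {p : M} (hu : Tendsto u atTop (𝓝 v))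
    (huw : ∀ k, Le T (u k) (w k)) (hw : Tendsto (fun k ↦ (w k).1) atTop (𝓝 p)) :
    ∃ z, Le T v z ∧ z.1 = p := by
  choose s hs using huw
  obtain ⟨L, e, hLe, hmax⟩ := exists_maximal_flow hc hv
  obtain ⟨ε, hε, hconv⟩ := exists_convergesUpTo_gt hLe
  -- If infinitely many geodesics were longer than `L + ε`, truncating them would give a limit which
  -- extends the maximal geodesic from `v`.
  have hev : ∀ᶠ k in atTop, s k ≤ L + ε := by
    by_contra hcon
    rw [not_eventually] at hcon
    obtain ⟨φ, hφ, hφs⟩ := extraction_of_frequently_atTop hcon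
    choose m hm _ using fun k ↦ (hs (φ k)).split (r := L + ε)
      ⟨by linarith [hLe.nonneg], (not_le.1 (hφs k)).le⟩
    obtain ⟨z, hz, -⟩ := hconv (u ∘ φ) m (fun _ ↦ L + ε) (L + ε) (hu.comp hφ.tendsto_atTop)
      tendsto_const_nhds (fun _ ↦ le_rfl) hm
    obtain ⟨e', he', hz'⟩ := hz.split (r := L) ⟨hLe.nonneg, by linarith⟩
    rw [he'.unique hLe] at hz'
    have := hmax _ _ hz'
    linarith
  obtain ⟨k₀, hk₀⟩ := eventually_atTop.1 hev
  obtain ⟨r', -, φ, hφ, hlim⟩ := (isCompact_Icc (a := 0) (b := L + ε)).tendsto_subseq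
    (x := fun k ↦ s (k + k₀)) fun k ↦ ⟨(hs _).nonneg, hk₀ _ (by omega)⟩
  have hφ' : Tendsto (fun k ↦ φ k + k₀) atTop atTop :=
    (tendsto_add_atTop_nat k₀).comp hφ.tendsto_atTop
  obtain ⟨z, hz, hwz⟩ := hconv (fun k ↦ u (φ k + k₀)) (fun k ↦ w (φ k + k₀))
    (fun k ↦ s (φ k + k₀)) r' (hu.comp hφ') hlim (fun k ↦ hk₀ _ (by omega)) (fun k ↦ hs _)
  exact ⟨z, ⟨r', hz⟩, tendsto_nhds_unique ((continuous_base.tendsto z).comp hwz) (hw.comp hφ')⟩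

/-- Either infinitely many of the geodesics run to the future, or almost all run to the past and
time reversal applies. -/
theorem exists_cmp_of_tendsto (hc : StronglyCausal T) (hv : v ∈ futureLightlike T)
    {u w : ℕ → TangentBundle (𝓡∂ n) M} {p : M} (hu : Tendsto u atTop (𝓝 v))
    (huw : ∀ k, Cmp T (u k) (w k)) (hw : Tendsto (fun k ↦ (w k).1) atTop (𝓝 p)) :
    ∃ z, Cmp T v z ∧ z.1 = p := by
  by_cases hf : ∃ᶠ k in atTop, Le T (u k) (w k)
  · obtain ⟨φ, hφ, hφs⟩ := extraction_of_frequently_atTop hf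
    obtain ⟨z, hz, hzp⟩ := exists_le_of_tendsto hc hv (hu.comp hφ.tendsto_atTop) hφs
      (hw.comp hφ.tendsto_atTop)
    exact ⟨z, hz.cmp, hzp⟩
  · rw [not_frequently] at hf
    obtain ⟨k₀, hk₀⟩ := eventually_atTop.1 hf
    have hφ := tendsto_add_atTop_nat k₀
    obtain ⟨z, hz, hzp⟩ := exists_le_of_tendsto (u := fun k ↦ tsmul (-1) (u (k + k₀)))
      (w := fun k ↦ tsmul (-1) (w (k + k₀))) (p := p) hc.reverse (neg_mem_futureLightlike hv)
      (tendsto_tsmul (-1) (hu.comp hφ))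
      (fun k ↦ ((huw (k + k₀)).resolve_left (hk₀ _ (by omega))).reverse) (hw.comp hφ)
    refine ⟨tsmul (-1) z, ?_, hzp⟩
    have := hz.of_reverse'
    rw [tsmul_neg_neg] at this
    exact this.cmp'

end Limits

/-! ### Geodesics meeting all lightlike geodesics through a point -/

section Sky

variable {n : ℕ} [NeZero n]
  {M : Type*} [TopologicalSpace M] [ChartedSpace (EuclideanHalfSpace n) M]
  [IsManifold (𝓡∂ n) ∞ M] {g : LorentzMetric n M} {T : TimeOrientation g}

theorem exists_orthogonal (hn : 3 ≤ n) (φ ψ : Vec n →L[ℝ] ℝ) : ∃ e : Vec n, e ≠ 0 ∧ φ e = 0 ∧ ψ e = 0 := by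
  have h : LinearMap.ker ((φ : Vec n →ₗ[ℝ] ℝ).prod (ψ : Vec n →ₗ[ℝ] ℝ)) ≠ ⊥ := by
    apply LinearMap.ker_ne_bot_of_finrank_lt
    simp
    omega
  obtain ⟨e, he, he0⟩ := Submodule.exists_mem_ne_zero_of_ne_bot h
  rw [LinearMap.mem_ker] at he
  exact ⟨e, he0, congrArg Prod.fst he, congrArg Prod.snd he⟩

theorem exists_scaled (p : M) {c : ℝ} (hc : 0 < c) {t e : Vec n} (ht : g.form p t t < 0)
    (he : g.form p e t = 0) (he0 : e ≠ 0) : ∃ k : ℝ, k ≠ 0 ∧ g.form p (k • e) (k • e) = c := by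
  have h := form_pos_of_orthogonal g p ht he he0
  refine ⟨√(c / g.form p e e), (Real.sqrt_pos.2 (div_pos hc h)).ne', ?_⟩
  simp only [map_smul, smul_apply, smul_eq_mul]
  rw [← mul_assoc, Real.mul_self_sqrt (div_pos hc h).le, div_mul_cancel₀ _ h.ne']

/-- A circle of pairwise nonproportional future-directed lightlike vectors. -/
theorem exists_circle (hn : 3 ≤ n) (T : TimeOrientation g) (q : M) :
    ∃ t e₁ e₂ : Vec n, (t 0 = 0 → e₁ 0 ≠ 0) ∧
      (∀ a b : ℝ, a ^ 2 + b ^ 2 = 1 →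
        tvec q (t + a • e₁ + b • e₂) ∈ futureLightlike T) ∧
      ∀ a b a' b' : ℝ, Par (tvec q (t + a • e₁ + b • e₂))
        (tvec q (t + a' • e₁ + b' • e₂)) → a' = a ∧ b' = b := by
  set t : Vec n := T.field q
  have ht : g.form q t t < 0 := T.timelike q
  set c := -g.form q t t with hc
  have hc0 : 0 < c := by linarith
  -- If `t` has first coordinate `0`, then subtracting a multiple of `t` from the first basis vector
  -- does not change its first coordinate. This will provide directions transverse to the boundary.
  have h1 : ∃ e : Vec n, e ≠ 0 ∧ g.form q e t = 0 ∧ (t 0 = 0 → e 0 ≠ 0) := by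
    by_cases ht0 : t 0 = 0
    · set x : Vec n := EuclideanSpace.single 0 1
      refine ⟨x - (g.form q x t / g.form q t t) • t, ?_, ?_, fun _ ↦ ?_⟩
      · intro h
        have := congrArg (fun v : Vec n ↦ v 0) h
        simp [x, ht0] at this
      · simp only [map_sub, map_smul, sub_apply, smul_apply, smul_eq_mul]
        rw [div_mul_cancel₀ _ ht.ne, sub_self]
      · simp [x, ht0]
    · obtain ⟨e, he, h2, -⟩ := exists_orthogonal hn (g.form q t) (g.form q t)
      exact ⟨e, he, by rw [form_symm, h2], fun h ↦ absurd h ht0⟩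
  obtain ⟨e, he0, het, he⟩ := h1
  obtain ⟨k, hk, hke⟩ := exists_scaled q hc0 ht het he0
  obtain ⟨f, hf0, hft, hfe⟩ := exists_orthogonal hn (g.form q t) (g.form q e)
  rw [form_symm] at hft hfe
  obtain ⟨l, hl, hlf⟩ := exists_scaled q hc0 ht hft hf0
  have e1 : g.form q (k • e) t = 0 := by simp [het]
  have e1' : g.form q t (k • e) = 0 := by rw [form_symm, e1]
  have e2 : g.form q (l • f) t = 0 := by simp [hft]
  have e2' : g.form q t (l • f) = 0 := by rw [form_symm, e2]
  have e3 : g.form q (l • f) (k • e) = 0 := by simp [hfe]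
  have e3' : g.form q (k • e) (l • f) = 0 := by rw [form_symm, e3]
  -- These vectors are orthogonal with squares `-c`, `c` and `c`, so the unit circle gives null
  -- vectors.
  refine ⟨t, k • e, l • f, fun h ↦ ?_, fun a b hab ↦ ?_, fun a b a' b' hpar ↦ ?_⟩
  · simp [hk, he h]
  · rw [mem_futureLightlike_iff]
    change g.form q (t + a • k • e + b • l • f) (t + a • k • e + b • l • f) = 0 ∧
      g.form q (t + a • k • e + b • l • f) t < 0
    generalize k • e = e₁ at *
    generalize l • f = e₂ at *
    simp only [map_add, map_smul, add_apply, smul_apply, smul_eq_mul, e1, e1', e2, e2', e3, e3',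
      hke, hlf]
    refine ⟨?_, by linarith⟩
    have : g.form q t t = -c := by rw [hc, neg_neg]
    rw [this]
    linear_combination c * hab
  · obtain ⟨m, hm, heq⟩ := hpar
    have heq' : t + a' • k • e + b' • l • f = m • (t + a • k • e + b • l • f) := congrArg vecOf heq
    generalize k • e = e₁ at *
    generalize l • f = e₂ at *
    -- Pairing with `t` shows that the factor is `1`; pairing with the other two vectors recovers
    -- the coefficients.
    have h2 := congrArg (fun x ↦ g.form q x t) heq'
    have h3 := congrArg (fun x ↦ g.form q x e₁) heq'
    have h4 := congrArg (fun x ↦ g.form q x e₂) heq'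
    simp only [map_add, map_smul, add_apply, smul_apply, smul_eq_mul, e1, e1', e2, e2', e3, e3',
      hke, hlf] at h2 h3 h4
    have hm1 : m = 1 := by
      have : (m - 1) * g.form q t t = 0 := by linarith
      rcases mul_eq_zero.1 this with h | h
      · linarith
      · exact absurd h ht.ne
    subst hm1
    exact ⟨mul_right_cancel₀ hc0.ne' (by linarith), mul_right_cancel₀ hc0.ne' (by linarith)⟩

theorem continuous_tvec (q : M) : Continuous (fun w : Vec n ↦ tvec (n := n) q w) := by
  have hq : q ∈ (extChartAt (𝓡∂ n) q).source := mem_extChartAt_source q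
  have h1 : ∀ w : Vec n, tvec (n := n) q w = ofCoords q (extChartAt (𝓡∂ n) q q, w) := by
    intro w
    rw [← ofCoords_coords q (v := tvec q w) hq]
    congr 1
    exact Prod.ext rfl (chartDeriv_self q w)
  simp only [h1]
  exact (continuousOn_ofCoords q).comp_continuous (by fun_prop)
    fun w ↦ (extChartAt (𝓡∂ n) q).map_source hq

theorem OrdConnected.lt_or_lt {I J : Set ℝ} (hI : I.OrdConnected) (hJ : J.OrdConnected)
    (hIJ : Disjoint I J) {a b : ℝ} (ha : a ∈ I) (hb : b ∈ J) (hab : a < b) :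
    ∀ a' ∈ I, ∀ b' ∈ J, a' < b' := by
  intro a' ha' b' hb'
  by_contra! h
  rcases le_total a b' with h1 | h1
  · exact disjoint_left.1 hIJ (hI.out ha ha' ⟨h1, h⟩) hb'
  · exact disjoint_left.1 hIJ ha (hJ.out hb' hb ⟨h1, hab.le⟩)

/-- A circle does not map to pairwise disjoint intervals in an upper semicontinuous way. -/
theorem not_exists_disjoint_intervals {L : ℝ} (K : ℝ → Set ℝ) (hK : ∀ θ, (K θ).Nonempty)
    (hKL : ∀ θ, K θ ⊆ Icc 0 L) (hord : ∀ θ, (K θ).OrdConnected)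
    (hper : ∀ θ, K (θ + 2 * Real.pi) = K θ)
    (hdisj : ∀ θ θ', θ < θ' → θ' < θ + 2 * Real.pi → Disjoint (K θ) (K θ'))
    (hcl : ∀ (θ : ℕ → ℝ) (t : ℕ → ℝ) (θ' t' : ℝ), Tendsto θ atTop (𝓝 θ') →
      Tendsto t atTop (𝓝 t') → (∀ k, t k ∈ K (θ k)) → t' ∈ K θ') : False := by
  -- All other intervals lie on the same side of `K θ₀`, because the remaining angles form a
  -- connected set.
  have hside : ∀ θ₀, (∀ θ ∈ Ioo θ₀ (θ₀ + 2 * Real.pi), ∀ a ∈ K θ, ∀ b ∈ K θ₀, a < b) ∨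
      (∀ θ ∈ Ioo θ₀ (θ₀ + 2 * Real.pi), ∀ a ∈ K θ, ∀ b ∈ K θ₀, b < a) := by
    intro θ₀
    set A := {θ ∈ Ioo θ₀ (θ₀ + 2 * Real.pi) | ∀ a ∈ K θ, ∀ b ∈ K θ₀, a < b}
    set B := {θ ∈ Ioo θ₀ (θ₀ + 2 * Real.pi) | ∀ a ∈ K θ, ∀ b ∈ K θ₀, b < a}
    have hAB : Ioo θ₀ (θ₀ + 2 * Real.pi) ⊆ A ∪ B := by
      intro θ hθ
      obtain ⟨a, ha⟩ := hK θ
      obtain ⟨b, hb⟩ := hK θ₀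
      have hd := hdisj θ₀ θ hθ.1 hθ.2
      rcases lt_trichotomy a b with h | h | h
      · exact Or.inl ⟨hθ, OrdConnected.lt_or_lt (hord θ) (hord θ₀) hd.symm ha hb h⟩
      · exact absurd (h ▸ ha) (disjoint_left.1 hd hb)
      · exact Or.inr ⟨hθ, fun a ha' b hb' ↦
          OrdConnected.lt_or_lt (hord θ₀) (hord θ) hd hb ha h b hb' a ha'⟩
    by_contra! hcon
    obtain ⟨⟨θ₁, hθ₁, a₁, ha₁, b₁, hb₁, h₁⟩, ⟨θ₂, hθ₂, a₂, ha₂, b₂, hb₂, h₂⟩⟩ := hcon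
    have hθ₁B : θ₁ ∈ B := (hAB hθ₁).resolve_left fun h ↦ absurd (h.2 a₁ ha₁ b₁ hb₁) (not_lt.2 h₁)
    have hθ₂A : θ₂ ∈ A := (hAB hθ₂).resolve_right fun h ↦ absurd (h.2 a₂ ha₂ b₂ hb₂) (not_lt.2 h₂)
    -- At an angle in both closures, compactness and the closed graph give points of `K θ` on both
    -- sides of a point of `K θ₀`; as `K θ` is an interval, disjointness fails.
    obtain ⟨θ, hθ, hθA, hθB⟩ := isPreconnected_closed_iff.1 isPreconnected_Ioo (closure A)
      (closure B) isClosed_closure isClosed_closure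
      (hAB.trans (union_subset_union subset_closure subset_closure)) ⟨θ₂, hθ₂, subset_closure hθ₂A⟩
      ⟨θ₁, hθ₁, subset_closure hθ₁B⟩
    have hlim : ∀ D : Set ℝ, θ ∈ closure D → ∃ (t : ℕ → ℝ) (θ' : ℕ → ℝ) (t' : ℝ),
        (∀ k, θ' k ∈ D ∧ t k ∈ K (θ' k)) ∧ Tendsto t atTop (𝓝 t') ∧ t' ∈ K θ := by
      intro D hD
      obtain ⟨x, hx, hxθ⟩ := mem_closure_iff_seq_limit.1 hD
      choose y hy using fun k ↦ hK (x k)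
      obtain ⟨t', -, φ, hφ, hlim⟩ := (isCompact_Icc (a := 0) (b := L)).tendsto_subseq
        fun k ↦ hKL _ (hy k)
      exact ⟨y ∘ φ, x ∘ φ, t', fun k ↦ ⟨hx _, hy _⟩, hlim,
        hcl _ _ _ _ (hxθ.comp hφ.tendsto_atTop) hlim fun k ↦ hy _⟩
    obtain ⟨t₁, θ₁', a, h1, h2, ha⟩ := hlim A hθA
    obtain ⟨t₂, θ₂', a', h3, h4, ha'⟩ := hlim B hθB
    obtain ⟨b, hb⟩ := hK θ₀
    have h5 : a ≤ b := le_of_tendsto' h2 fun k ↦ ((h1 k).1.2 _ (h1 k).2 b hb).le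
    have h6 : b ≤ a' := ge_of_tendsto' h4 fun k ↦ ((h3 k).1.2 _ (h3 k).2 b hb).le
    exact disjoint_left.1 (hdisj θ₀ θ hθ.1 hθ.2) hb ((hord θ).out ha ha' ⟨h5, h6⟩)
  -- Of three disjoint intervals, the middle one has the others on different sides. Shifts by the
  -- period bring the angles into the required ranges.
  obtain ⟨a, ha⟩ := hK 0
  obtain ⟨b, hb⟩ := hK 1
  obtain ⟨c, hc⟩ := hK 2
  have hpi := Real.pi_gt_three
  have ha' : a ∈ K (0 + 2 * Real.pi) := by rwa [hper]
  have hb' : b ∈ K (1 + 2 * Real.pi) := by rwa [hper]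
  have m1 : (1 : ℝ) ∈ Ioo (0 : ℝ) (0 + 2 * Real.pi) := ⟨by linarith, by linarith⟩
  have m2 : (2 : ℝ) ∈ Ioo (0 : ℝ) (0 + 2 * Real.pi) := ⟨by linarith, by linarith⟩
  have m3 : (2 : ℝ) ∈ Ioo (1 : ℝ) (1 + 2 * Real.pi) := ⟨by linarith, by linarith⟩
  have m4 : (0 + 2 * Real.pi : ℝ) ∈ Ioo (1 : ℝ) (1 + 2 * Real.pi) := ⟨by linarith, by linarith⟩
  have m5 : (0 + 2 * Real.pi : ℝ) ∈ Ioo (2 : ℝ) (2 + 2 * Real.pi) := ⟨by linarith, by linarith⟩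
  have m6 : (1 + 2 * Real.pi : ℝ) ∈ Ioo (2 : ℝ) (2 + 2 * Real.pi) := ⟨by linarith, by linarith⟩
  rcases hside 0 with h0 | h0 <;> rcases hside 1 with h1 | h1 <;> rcases hside 2 with h2 | h2 <;>
    linarith [h0 _ m1 b hb a ha, h0 _ m2 c hc a ha, h1 _ m3 c hc b hb, h1 _ m4 a ha' b hb,
      h2 _ m5 a ha' c hc, h2 _ m6 b hb' c hc]

variable [T2Space M] [CompactSpace M]

/-- A geodesic which meets all lightlike geodesics through a point passes through this point. -/
theorem exists_le_of_forall_meet (hn : 3 ≤ n) (hc : StronglyCausal T) (hr : NoRefocusing g) {q : M}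
    {x : TangentBundle (𝓡∂ n) M} (hx : x ∈ futureLightlike T)
    (hmeet : ∀ v ∈ futureLightlike T, v.1 = q → ∃ y z, Le T x y ∧ Cmp T v z ∧ z.1 = y.1) :
    ∃ y, Le T x y ∧ y.1 = q := by
  by_contra! hq
  obtain ⟨L, e, hLe, hmax⟩ := exists_maximal_flow hc hx
  obtain ⟨hL, Z, hZ, hX, rfl, rfl⟩ := hLe
  have hZf : ∀ t ∈ Icc 0 L, Flow T t (Z 0) (Z t) := fun t ht ↦ by
    simpa using hZ.flow hX le_rfl ht.1 ht.2
  have hZx : ∀ y, Le T (Z 0) y → ∃ t ∈ Icc 0 L, y = Z t := by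
    rintro y ⟨r, hr⟩
    rcases le_total r L with h | h
    · exact ⟨r, ⟨hr.nonneg, h⟩, hr.unique (hZf r ⟨hr.nonneg, h⟩)⟩
    · obtain ⟨w, hw, hw'⟩ := hr.split ⟨hL, h⟩
      rw [hw.unique (hZf L (right_mem_Icc.2 hL))] at hw'
      rw [hmax _ _ hw'] at hw'
      exact ⟨L, right_mem_Icc.2 hL, hw'.eq_of_zero.symm⟩
  obtain ⟨t₀, e₁, e₂, -, hcirc, hpar⟩ := exists_circle hn T q
  set v : ℝ → TangentBundle (𝓡∂ n) M := fun θ ↦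
    tvec q (t₀ + Real.cos θ • e₁ + Real.sin θ • e₂) with hv
  have hvX : ∀ θ, v θ ∈ futureLightlike T := fun θ ↦ hcirc _ _ (Real.cos_sq_add_sin_sq θ)
  have hvc : Continuous v := (continuous_tvec q).comp (by fun_prop)
  -- The interval of `θ` consists of the times at which the given geodesic lies on the geodesic of
  -- `v θ`.
  refine not_exists_disjoint_intervals (L := L)
    (fun θ ↦ {t | t ∈ Icc 0 L ∧ ∃ z, Cmp T (v θ) z ∧ z.1 = (Z t).1}) (fun θ ↦ ?_)
    (fun θ t ht ↦ ht.1) (fun θ ↦ ?_) (fun θ ↦ ?_) (fun θ θ' h1 h2 ↦ ?_) ?_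
  · obtain ⟨y, z, hy, hz, hzy⟩ := hmeet (v θ) (hvX θ) rfl
    obtain ⟨t, ht, rfl⟩ := hZx y hy
    exact ⟨t, ht, z, hz, hzy⟩
  -- Geodesics with two common points agree in between.
  · refine ⟨fun t₁ h1 t₂ h2 t ht ↦ ?_⟩
    obtain ⟨h1I, z₁, hz₁, hzt₁⟩ := h1
    obtain ⟨h2I, z₂, hz₂, hzt₂⟩ := h2
    have htI : t ∈ Icc 0 L := ⟨h1I.1.trans ht.1, ht.2.trans h2I.2⟩
    rcases eq_or_lt_of_le (ht.1.trans ht.2) with rfl | hlt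
    · obtain rfl : t = t₁ := le_antisymm ht.2 ht.1
      exact ⟨htI, z₁, hz₁, hzt₁⟩
    have f := hZ.flow hX h1I.1 hlt.le h2I.2
    have hne : (Z t₁).1 ≠ (Z t₂).1 := fun h ↦ by
      have := f.smoothReach (by linarith)
      rw [← h] at this
      exact hc.not_transGen _ (.single this)
    obtain ⟨c, hc0, hcz, -⟩ := Cmp.par_of_base hc hr (Le.cmp ⟨_, f⟩) (hz₁.symm.trans hz₂)
      hzt₁.symm hzt₂.symm hne
    refine ⟨htI, tsmul c (Z t), ?_, rfl⟩
    rw [hcz] at hz₁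
    exact hz₁.trans (Le.cmp (Le.smul ⟨_, hZ.flow hX h1I.1 ht.1 htI.2⟩ hc0))
  · simp only [hv, Real.cos_add_two_pi, Real.sin_add_two_pi]
  -- A common time would give two directions at `q` whose geodesics meet again away from `q`; these
  -- are proportional.
  · rw [disjoint_left]
    rintro t ⟨htI, z, hz, hzt⟩ ⟨-, z', hz', hzt'⟩
    have hne : (v θ).1 ≠ z.1 := by
      rw [hzt]
      exact (hq _ ⟨t, hZf t htI⟩).symm
    obtain ⟨c, hc0, hcv, -⟩ := Cmp.par_of_base hc hr hz hz' rfl (hzt.trans hzt'.symm) hne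
    obtain ⟨h3, h4⟩ := hpar _ _ _ _ ⟨c, hc0, hcv⟩
    have h5 : Real.cos (θ' - θ) = 1 := by
      rw [Real.cos_sub, h3, h4, ← sq, ← sq, Real.cos_sq_add_sin_sq]
    have h6 := (Real.cos_eq_one_iff_of_lt_of_lt (by linarith [Real.pi_pos]) (by linarith)).1 h5
    linarith
  · intro θ t θ' t' hθ ht htk
    have ht'I : t' ∈ Icc 0 L := isClosed_Icc.mem_of_tendsto ht (Eventually.of_forall fun k ↦ (htk k).1)
    choose z hz hzt using fun k ↦ (htk k).2
    refine ⟨ht'I, exists_cmp_of_tendsto hc (hvX θ') ((hvc.tendsto θ').comp hθ) hz ?_⟩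
    simp only [hzt]
    exact (continuous_base.tendsto _).comp ((hZ.1 t' ht'I).tendsto.comp
      (tendsto_nhdsWithin_iff.2 ⟨ht, Eventually.of_forall fun k ↦ (htk k).1⟩))

end Sky

/-! ### Openness of chronology and cutting of corners -/

section Corner

variable {n : ℕ} [NeZero n]
  {M : Type*} [TopologicalSpace M] [ChartedSpace (EuclideanHalfSpace n) M]
  [IsManifold (𝓡∂ n) ∞ M] {g : LorentzMetric n M} {T : TimeOrientation g}

theorem mem_futureTimelike_iff_coords {v : TangentBundle (𝓡∂ n) M} {x₀ : M}
    (hv : v.1 ∈ (extChartAt (𝓡∂ n) x₀).source) :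
    v ∈ futureTimelike T ↔
      metricForm g x₀ (coords x₀ v).1 (coords x₀ v).2 (coords x₀ v).2 < 0 ∧
      timeForm T x₀ (coords x₀ v).1 (coords x₀ v).2 < 0 := by
  rw [coords, metricForm_coords g x₀ hv, timeForm_coords T x₀ hv]
  exact Iff.rfl

theorem smoothReach_of_coords {x₀ : M} {α α' : ℝ → Vec n} {a b : ℝ} (hab : a < b)
    (hα : ContDiffOn ℝ ∞ α (Icc a b)) (ht : ∀ t ∈ Icc a b, α t ∈ (extChartAt (𝓡∂ n) x₀).target)
    (hα' : ∀ t ∈ Icc a b, HasDerivWithinAt α (α' t) (Icc a b) t)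
    (hneg : ∀ t ∈ Icc a b, metricForm g x₀ (α t) (α' t) (α' t) < 0 ∧ timeForm T x₀ (α t) (α' t) < 0) :
    SmoothReach (futureTimelike T) ((extChartAt (𝓡∂ n) x₀).symm (α a))
      ((extChartAt (𝓡∂ n) x₀).symm (α b)) := by
  have hsmooth : ContMDiffOn 𝓘(ℝ, ℝ) (𝓡∂ n) ∞ (fun t ↦ (extChartAt (𝓡∂ n) x₀).symm (α t))
      (Icc a b) :=
    (contMDiffOn_extChartAt_symm x₀).comp hα.contMDiffOn ht
  refine ⟨_, a, b, ⟨hab, hsmooth, fun t htI ↦ ?_⟩, rfl, rfl⟩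
  have hs : (extChartAt (𝓡∂ n) x₀).symm (α t) ∈ (extChartAt (𝓡∂ n) x₀).source :=
    (extChartAt (𝓡∂ n) x₀).map_target (ht t htI)
  rw [mem_futureTimelike_iff_coords (x₀ := x₀) hs, chartDeriv_velocity hab htI hs
    ((hsmooth t htI).mdifferentiableWithinAt (by simp))]
  have h1 : derivWithin (fun r ↦ extChartAt (𝓡∂ n) x₀ ((extChartAt (𝓡∂ n) x₀).symm (α r)))
      (Icc a b) t = α' t := by
    rw [derivWithin_congr (fun r hr ↦ (extChartAt (𝓡∂ n) x₀).right_inv (ht r hr))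
      ((extChartAt (𝓡∂ n) x₀).right_inv (ht t htI))]
    exact (hα' t htI).derivWithin (uniqueDiffOn_Icc hab t htI)
  rw [h1]
  simp only [(extChartAt (𝓡∂ n) x₀).right_inv (ht t htI)]
  exact hneg t htI

theorem exists_ball_timelike {x₀ : M} {y₀ u₀ : Vec n}
    (hy₀ : y₀ ∈ (extChartAt (𝓡∂ n) x₀).target) (h1 : metricForm g x₀ y₀ u₀ u₀ < 0)
    (h2 : timeForm T x₀ y₀ u₀ < 0) :
    ∃ ε > 0, ∀ y u : Vec n, dist y y₀ < ε → dist u u₀ < ε → y ∈ halfSpace n →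
      timeForm T x₀ y u < 0 ∧ y ∈ (extChartAt (𝓡∂ n) x₀).target ∧ metricForm g x₀ y u u < 0 := by
  have e1 := eventually_timeForm_neg (T := T) (x₀ := x₀) (z₀ := (y₀, u₀)) hy₀ h2
  have e0 : Tendsto (fun z : Vec n × Vec n ↦ z.1) (𝓝[{z : Vec n × Vec n | z.1 ∈ halfSpace n}] (y₀, u₀))
      (𝓝[halfSpace n] y₀) :=
    tendsto_nhdsWithin_iff.2 ⟨tendsto_nhdsWithin_of_tendsto_nhds (continuous_fst.tendsto (y₀, u₀)),
      self_mem_nhdsWithin⟩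
  have e2 : ∀ᶠ z in 𝓝[{z : Vec n × Vec n | z.1 ∈ halfSpace n}] (y₀, u₀),
      z.1 ∈ (extChartAt (𝓡∂ n) x₀).target :=
    e0 (extChartAt_target_mem_nhdsWithin_of_mem hy₀)
  have e4 : ContinuousWithinAt (fun z : Vec n × Vec n ↦ metricForm g x₀ z.1 z.2 z.2)
      {z | z.1 ∈ (extChartAt (𝓡∂ n) x₀).target} (y₀, u₀) :=
    continuousOn_metricForm_apply g x₀ (y₀, u₀) hy₀
  have e3 : ∀ᶠ z in 𝓝[{z : Vec n × Vec n | z.1 ∈ halfSpace n}] (y₀, u₀),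
      metricForm g x₀ z.1 z.2 z.2 < 0 :=
    (e4.mono_of_mem_nhdsWithin e2).tendsto.eventually_lt_const h1
  obtain ⟨ε, hε, hball⟩ := Metric.nhdsWithin_basis_ball.eventually_iff.1 (e1.and (e2.and e3))
  refine ⟨ε, hε, fun y u d1 d2 hy ↦ ?_⟩
  have h3 : (y, u) ∈ Metric.ball (y₀, u₀) ε := by
    rw [Metric.mem_ball, Prod.dist_eq]
    exact max_lt d1 d2
  exact @hball (y, u) ⟨h3, hy⟩

/-- Straight segments in a chart whose direction is close to a timelike vector are timelike. -/
theorem exists_segment_smoothReach {x₀ : M} {y₀ u₀ : Vec n}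
    (hy₀ : y₀ ∈ (extChartAt (𝓡∂ n) x₀).target) (h1 : metricForm g x₀ y₀ u₀ u₀ < 0)
    (h2 : timeForm T x₀ y₀ u₀ < 0) :
    ∃ ε > 0, ∀ (y₁ y₂ : Vec n) (r : ℝ), 0 < r → y₁ ∈ halfSpace n → y₂ ∈ halfSpace n →
      dist y₁ y₀ < ε → dist y₂ y₀ < ε → dist (r⁻¹ • (y₂ - y₁)) u₀ < ε →
      SmoothReach (futureTimelike T) ((extChartAt (𝓡∂ n) x₀).symm y₁)
        ((extChartAt (𝓡∂ n) x₀).symm y₂) := by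
  obtain ⟨ε, hε, hball⟩ := exists_ball_timelike hy₀ h1 h2
  refine ⟨ε, hε, fun y₁ y₂ r hr hy₁ hy₂ d1 d2 d3 ↦ ?_⟩
  set u := r⁻¹ • (y₂ - y₁) with hu
  have hy₂' : y₂ = y₁ + r • u := by
    rw [hu, smul_smul, mul_inv_cancel₀ hr.ne', one_smul, add_sub_cancel]
  -- The half-space is convex, so segments between its points do not leave the manifold.
  have hmem : ∀ t ∈ Icc 0 r, y₁ + t • u ∈ halfSpace n ∩ Metric.ball y₀ ε := by
    intro t ht
    have hconv : y₁ + (t / r) • (y₂ - y₁) ∈ halfSpace n ∩ Metric.ball y₀ ε :=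
      ((convex_halfSpace n).inter (convex_ball y₀ ε)).add_smul_sub_mem ⟨hy₁, d1⟩ ⟨hy₂, d2⟩
      ⟨div_nonneg ht.1 hr.le, (div_le_one hr).2 ht.2⟩
    rwa [div_eq_mul_inv, mul_smul] at hconv
  have hgood : ∀ t ∈ Icc 0 r, timeForm T x₀ (y₁ + t • u) u < 0 ∧
      y₁ + t • u ∈ (extChartAt (𝓡∂ n) x₀).target ∧ metricForm g x₀ (y₁ + t • u) u u < 0 :=
    fun t ht ↦ hball _ _ (hmem t ht).2 d3 (hmem t ht).1
  have h3 := smoothReach_of_coords (T := T) (x₀ := x₀) (α := fun t ↦ y₁ + t • u) (α' := fun _ ↦ u)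
    hr (by fun_prop) (fun t ht ↦ (hgood t ht).2.1) (fun t _ ↦ by
      simpa using ((hasDerivWithinAt_id t (Icc 0 r)).smul_const u).const_add y₁)
    (fun t ht ↦ ⟨(hgood t ht).2.2, (hgood t ht).1⟩)
  simpa [← hy₂'] using h3

theorem IsPiece.restrict {P : Set (TangentBundle (𝓡∂ n) M)} {γ : ℝ → M} {a b a' b' : ℝ}
    (h : IsPiece P γ a b) (hab' : a' < b') (hsub : Icc a' b' ⊆ Icc a b) : IsPiece P γ a' b' := by
  have h1 := h.affine (a' := a') (b' := b') 1 0 hab' (fun t ht ↦ by simpa using hsub ht)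
  simp only [one_mul, add_zero] at h1
  refine ⟨h1.1, h1.2.1, fun t ht ↦ ?_⟩
  obtain ⟨w, hw, hvw⟩ := h1.2.2 t ht
  rw [hvw, tsmul_one]
  exact hw

theorem halfSpace_mem_of_source {x₀ p : M} (hp : p ∈ (extChartAt (𝓡∂ n) x₀).source) :
    extChartAt (𝓡∂ n) x₀ p ∈ halfSpace n :=
  extChartAt_target_subset_range x₀ ((extChartAt (𝓡∂ n) x₀).map_source hp)

/-- Replace the last piece of the curve by a straight segment in a chart from `γ t` to `q'`. If `q'`
is close to `q` compared with `b - t`, its direction is close to the final velocity, hence timelike.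
-/
theorem SmoothReach.eventually {p q : M} (h : SmoothReach (futureTimelike T) p q) :
    ∀ᶠ q' in 𝓝 q, Chronological T p q' := by
  obtain ⟨γ, a, b, hγ, rfl, rfl⟩ := h
  set x₀ := γ b with hx₀
  have hab := hγ.1
  have hbI : b ∈ Icc a b := right_mem_Icc.2 hab.le
  have hs : γ b ∈ (extChartAt (𝓡∂ n) x₀).source := mem_extChartAt_source x₀
  have hmd := (hγ.2.1 b hbI).mdifferentiableWithinAt (by simp)
  have hv := (mem_futureTimelike_iff_coords (x₀ := x₀) hs).1 (hγ.2.2 b hbI)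
  rw [chartDeriv_velocity hab hbI hs hmd] at hv
  set u₀ := derivWithin (fun r ↦ extChartAt (𝓡∂ n) x₀ (γ r)) (Icc a b) b
  have hy₀ : extChartAt (𝓡∂ n) x₀ (γ b) ∈ (extChartAt (𝓡∂ n) x₀).target :=
    (extChartAt (𝓡∂ n) x₀).map_source hs
  obtain ⟨ε, hε, hseg⟩ := exists_segment_smoothReach hy₀ hv.1 hv.2
  have hdiff : DifferentiableWithinAt ℝ (fun r ↦ extChartAt (𝓡∂ n) x₀ (γ r)) (Icc a b) b :=
    mdifferentiableWithinAt_iff_differentiableWithinAt.1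
      ((mdifferentiableAt_extChartAt (by rwa [extChartAt_source] at hs)).comp_mdifferentiableWithinAt
        b hmd)
  have hd : HasDerivWithinAt (fun r ↦ extChartAt (𝓡∂ n) x₀ (γ r)) u₀ (Icc a b) b :=
    hdiff.hasDerivWithinAt
  have e1 : ∀ᶠ t in 𝓝[Icc a b \ {b}] b, dist (slope (fun r ↦ extChartAt (𝓡∂ n) x₀ (γ r)) b t) u₀ <
      ε / 2 := (hasDerivWithinAt_iff_tendsto_slope.1 hd) (Metric.ball_mem_nhds _ (half_pos hε))
  have e2 : ∀ᶠ t in 𝓝[Icc a b \ {b}] b,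
      dist (extChartAt (𝓡∂ n) x₀ (γ t)) (extChartAt (𝓡∂ n) x₀ (γ b)) < ε :=
    (hd.continuousWithinAt.mono sdiff_subset) (Metric.ball_mem_nhds _ hε)
  have e3 : ∀ᶠ t in 𝓝[Icc a b \ {b}] b, γ t ∈ (extChartAt (𝓡∂ n) x₀).source :=
    ((hγ.2.1.continuousOn b hbI).mono sdiff_subset) (extChartAt_source_mem_nhds x₀)
  have hne : (𝓝[Icc a b \ {b}] b).NeBot := by
    have h1 : b ∈ closure (Ico a b) := by rw [closure_Ico hab.ne]; exact hbI
    exact (mem_closure_iff_nhdsWithin_neBot.1 h1).mono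
      (nhdsWithin_mono b fun t ht ↦ ⟨Ico_subset_Icc_self ht, ht.2.ne⟩)
  have e4 : ∀ᶠ t in 𝓝[Icc a b \ {b}] b, a < t := by
    filter_upwards [mem_nhdsWithin_of_mem_nhds (Ioi_mem_nhds hab)] with t ht using ht
  obtain ⟨t, ⟨⟨ht1, ht2⟩, ht3⟩, ht4, htI⟩ :=
    (((e1.and e2).and e3).and (e4.and self_mem_nhdsWithin)).exists
  have htb : t < b := lt_of_le_of_ne htI.1.2 htI.2
  have hreach : SmoothReach (futureTimelike T) (γ a) (γ t) :=
    ⟨γ, a, t, hγ.restrict ht4 (Icc_subset_Icc_right htb.le), rfl, rfl⟩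
  have hbt : 0 < b - t := sub_pos.2 htb
  filter_upwards [extChartAt_source_mem_nhds (I := 𝓡∂ n) x₀,
    (continuousAt_extChartAt (I := 𝓡∂ n) x₀) (Metric.ball_mem_nhds _ hε),
    (continuousAt_extChartAt (I := 𝓡∂ n) x₀) (Metric.ball_mem_nhds _
      (show 0 < (b - t) * (ε / 2) by positivity))] with q' h1 h2 h3
  rw [chronological_iff]
  have h4 := hseg (extChartAt (𝓡∂ n) x₀ (γ t)) (extChartAt (𝓡∂ n) x₀ q') (b - t) hbt
    (halfSpace_mem_of_source ht3) (halfSpace_mem_of_source h1) ht2 h2 ?_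
  · rw [(extChartAt (𝓡∂ n) x₀).left_inv ht3, (extChartAt (𝓡∂ n) x₀).left_inv h1] at h4
    exact (Relation.TransGen.single hreach).tail h4
  · have h5 : (b - t)⁻¹ • (extChartAt (𝓡∂ n) x₀ q' - extChartAt (𝓡∂ n) x₀ (γ t)) =
        (b - t)⁻¹ • (extChartAt (𝓡∂ n) x₀ q' - extChartAt (𝓡∂ n) x₀ (γ b)) +
        slope (fun r ↦ extChartAt (𝓡∂ n) x₀ (γ r)) b t := by
      rw [slope_def_module, ← neg_sub b t, inv_neg, neg_smul, ← smul_neg, neg_sub, ← smul_add,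
        sub_add_sub_cancel]
    rw [h5]
    refine (dist_triangle _ (slope (fun r ↦ extChartAt (𝓡∂ n) x₀ (γ r)) b t) _).trans_lt ?_
    have h6 : dist ((b - t)⁻¹ • (extChartAt (𝓡∂ n) x₀ q' - extChartAt (𝓡∂ n) x₀ (γ b)) +
        slope (fun r ↦ extChartAt (𝓡∂ n) x₀ (γ r)) b t)
        (slope (fun r ↦ extChartAt (𝓡∂ n) x₀ (γ r)) b t) < ε / 2 := by
      rw [dist_eq_norm, add_sub_cancel_right, norm_smul, norm_inv, Real.norm_of_nonneg hbt.le,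
        inv_mul_lt_iff₀ hbt, ← dist_eq_norm]
      exact h3
    linarith

theorem Chronological.eventually {p q : M} (h : Chronological T p q) :
    ∀ᶠ q' in 𝓝 q, Chronological T p q' := by
  rw [chronological_iff] at h
  cases h with
  | single h => exact h.eventually
  | tail h1 h2 =>
    filter_upwards [h2.eventually] with q' hq'
    rw [chronological_iff] at hq' ⊢
    exact h1.trans hq'

theorem tendsto_seq_zero {s : ℝ} : Tendsto (fun k : ℕ ↦ s / ((k : ℝ) + 1)) atTop (𝓝 0) := by
  have := (tendsto_one_div_add_atTop_nhds_zero_nat (𝕜 := ℝ)).const_mul s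
  simpa [div_eq_mul_inv] using this

/-- Near a corner, a broken lightlike geodesic can be replaced by a timelike curve. -/
theorem exists_chronological_near_corner {s t : ℝ} {x v v' y : TangentBundle (𝓡∂ n) M}
    (hs : 0 < s) (ht : 0 < t) (h1 : Flow T s x v) (h2 : Flow T t v' y) (hv : v.1 = v'.1)
    (hpar : ¬ Par v v') :
    ∃ x₁ y₁, Le T x x₁ ∧ Le T x₁ v ∧ Le T v' y₁ ∧ Le T y₁ y ∧ Chronological T x₁.1 y₁.1 := by
  have hvX := h1.right_mem
  have hvX' := h2.left_mem
  obtain ⟨p, u⟩ := v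
  obtain ⟨p', w⟩ := v'
  obtain rfl : p = p' := hv
  change Vec n at u w
  have hp : p ∈ (extChartAt (𝓡∂ n) p).source := mem_extChartAt_source p
  have hc : ∀ u : Vec n, coords p (tvec p u) = (extChartAt (𝓡∂ n) p p, u) := fun u ↦
    Prod.ext rfl (chartDeriv_self p u)
  have hform : ∀ u w : Vec n, metricForm g p (extChartAt (𝓡∂ n) p p) u w = g.form p u w := by
    intro u w
    rw [← metricForm_coords g p hp, chartDeriv_self, chartDeriv_self]
  have htime : ∀ u : Vec n, timeForm T p (extChartAt (𝓡∂ n) p p) u =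
      g.form p u (T.field p : Vec n) := by
    intro u
    rw [← timeForm_coords T p hp, chartDeriv_self]
  have hu := mem_futureLightlike_iff.1 hvX
  have hw := mem_futureLightlike_iff.1 hvX'
  change g.form p u u = 0 ∧ g.form p u (T.field p : Vec n) < 0 at hu
  change g.form p w w = 0 ∧ g.form p w (T.field p : Vec n) < 0 at hw
  have huw : g.form p u w < 0 := form_neg_of_ne_smul (T.timelike p) hu.1 hw.1 hu.2 hw.2
    fun c hc0 hcw ↦ hpar ⟨c, hc0, congrArg (tvec p) hcw⟩
  -- The square of a sum of null vectors is twice their product, which is negative.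
  have hneg1 : metricForm g p (extChartAt (𝓡∂ n) p p) (u + w) (u + w) < 0 := by
    rw [hform]
    simp only [map_add, add_apply, hu.1, hw.1, form_symm g p w u]
    linarith
  have hneg2 : timeForm T p (extChartAt (𝓡∂ n) p p) (u + w) < 0 := by
    rw [map_add, htime, htime]
    exact add_neg hu.2 hw.2
  obtain ⟨ε, hε, hseg⟩ := exists_segment_smoothReach (mem_extChartAt_target p) hneg1 hneg2
  obtain ⟨-, Z, hZ, hX, hZ0, hZs⟩ := h1
  obtain ⟨-, W, hW, hX', hW0, hWt⟩ := h2
  have hsI : s ∈ Icc 0 s := right_mem_Icc.2 hs.le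
  have h0I : (0 : ℝ) ∈ Icc 0 t := left_mem_Icc.2 ht.le
  have dZ : HasDerivWithinAt (fun r ↦ extChartAt (𝓡∂ n) p (Z r).1) u (Icc 0 s) s := by
    have := hZ.2 s hsI p (by rw [hZs]; exact hp)
    rw [hZs] at this
    refine this.hasFDerivWithinAt.fst.hasDerivWithinAt.congr_deriv ?_
    have h3 : (coords p (⟨p, u⟩ : TangentBundle (𝓡∂ n) M)).2 = u := congrArg Prod.snd (hc u)
    simpa [spray] using h3
  have dW : HasDerivWithinAt (fun r ↦ extChartAt (𝓡∂ n) p (W r).1) w (Icc 0 t) 0 := by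
    have := hW.2 0 h0I p (by rw [hW0]; exact hp)
    rw [hW0] at this
    refine this.hasFDerivWithinAt.fst.hasDerivWithinAt.congr_deriv ?_
    have h3 : (coords p (⟨p, w⟩ : TangentBundle (𝓡∂ n) M)).2 = w := congrArg Prod.snd (hc w)
    simpa [spray] using h3
  set r : ℕ → ℝ := fun k ↦ min s t / ((k : ℝ) + 1) with hr
  have hst : 0 < min s t := lt_min hs ht
  have hrpos : ∀ k, 0 < r k := fun k ↦ by positivity
  have hrle : ∀ k, r k ≤ min s t := fun k ↦ div_le_self hst.le (by linarith [k.cast_nonneg (α := ℝ)])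
  have hrlim : Tendsto r atTop (𝓝 0) := tendsto_seq_zero
  have hrs : ∀ k, s - r k ∈ Icc 0 s := fun k ↦
    ⟨by linarith [hrle k, min_le_left s t], by linarith [hrpos k]⟩
  have hrt : ∀ k, r k ∈ Icc 0 t := fun k ↦ ⟨(hrpos k).le, (hrle k).trans (min_le_right s t)⟩
  have hlim1 : Tendsto (fun k ↦ s - r k) atTop (𝓝[Icc 0 s] s) :=
    tendsto_nhdsWithin_iff.2 ⟨by simpa using hrlim.const_sub s, Eventually.of_forall hrs⟩
  have hlim2 : Tendsto r atTop (𝓝[Icc 0 t] 0) :=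
    tendsto_nhdsWithin_iff.2 ⟨hrlim, Eventually.of_forall hrt⟩
  have s1 := (hasDerivWithinAt_iff_tendsto_slope.1 dZ).comp (tendsto_nhdsWithin_iff.2
    ⟨tendsto_nhds_of_tendsto_nhdsWithin hlim1, Eventually.of_forall fun k ↦
      ⟨hrs k, by simp [(hrpos k).ne']⟩⟩)
  have s2 := (hasDerivWithinAt_iff_tendsto_slope.1 dW).comp (tendsto_nhdsWithin_iff.2
    ⟨hrlim, Eventually.of_forall fun k ↦ ⟨hrt k, by simp [(hrpos k).ne']⟩⟩)
  have c1 := dZ.continuousWithinAt.tendsto.comp hlim1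
  have c2 := dW.continuousWithinAt.tendsto.comp hlim2
  rw [hZs] at c1
  rw [hW0] at c2
  have b1 : Tendsto (fun k ↦ (Z (s - r k)).1) atTop (𝓝 p) := by
    have := (continuous_base.continuousAt.comp_continuousWithinAt (hZ.1 s hsI)).tendsto.comp hlim1
    simpa only [Function.comp_def, hZs] using this
  have b2 : Tendsto (fun k ↦ (W (r k)).1) atTop (𝓝 p) := by
    have := (continuous_base.continuousAt.comp_continuousWithinAt (hW.1 0 h0I)).tendsto.comp hlim2
    simpa only [Function.comp_def, hW0] using this
  -- The segment cutting the corner from time `r k` before it to time `r k` after it has asymptotic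
  -- direction `u + w`.
  have hsum : Tendsto (fun k ↦ (r k)⁻¹ • (extChartAt (𝓡∂ n) p (W (r k)).1 -
      extChartAt (𝓡∂ n) p (Z (s - r k)).1)) atTop (𝓝 (u + w)) := by
    refine (s1.add s2).congr fun k ↦ ?_
    simp only [Function.comp, slope_def_module, hZs, hW0, sub_zero]
    rw [show s - r k - s = -(r k) by ring, inv_neg, neg_smul, ← smul_neg, neg_sub, ← smul_add]
    congr 1
    abel
  have a1 : ∀ᶠ k in atTop, dist ((r k)⁻¹ • (extChartAt (𝓡∂ n) p (W (r k)).1 -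
      extChartAt (𝓡∂ n) p (Z (s - r k)).1)) (u + w) < ε := hsum (Metric.ball_mem_nhds _ hε)
  have a2 : ∀ᶠ k in atTop, dist (extChartAt (𝓡∂ n) p (Z (s - r k)).1) (extChartAt (𝓡∂ n) p p) < ε :=
    c1 (Metric.ball_mem_nhds _ hε)
  have a3 : ∀ᶠ k in atTop, dist (extChartAt (𝓡∂ n) p (W (r k)).1) (extChartAt (𝓡∂ n) p p) < ε :=
    c2 (Metric.ball_mem_nhds _ hε)
  have a4 : ∀ᶠ k in atTop, (Z (s - r k)).1 ∈ (extChartAt (𝓡∂ n) p).source :=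
    b1 (extChartAt_source_mem_nhds p)
  have a5 : ∀ᶠ k in atTop, (W (r k)).1 ∈ (extChartAt (𝓡∂ n) p).source :=
    b2 (extChartAt_source_mem_nhds p)
  obtain ⟨k, k1, k2, k3, k4, k5⟩ := (a1.and (a2.and (a3.and (a4.and a5)))).exists
  have hreach := hseg _ _ (r k) (hrpos k) (halfSpace_mem_of_source k4) (halfSpace_mem_of_source k5)
    k2 k3 k1
  rw [(extChartAt (𝓡∂ n) p).left_inv k4, (extChartAt (𝓡∂ n) p).left_inv k5] at hreach
  refine ⟨Z (s - r k), W (r k), ?_, ?_, ?_, ?_, chronological_iff.2 (.single hreach)⟩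
  · rw [← hZ0]
    exact ⟨_, hZ.flow hX le_rfl (hrs k).1 (hrs k).2⟩
  · rw [← hZs]
    exact ⟨_, hZ.flow hX (hrs k).1 (hrs k).2 le_rfl⟩
  · rw [← hW0]
    exact ⟨_, hW.flow hX' le_rfl (hrt k).1 (hrt k).2⟩
  · rw [← hWt]
    exact ⟨_, hW.flow hX' (hrt k).1 (hrt k).2 le_rfl⟩

end Corner

/-! ### Pushing chronological relations along geodesics; triangles -/

section Push

variable {n : ℕ} [NeZero n]
  {M : Type*} [TopologicalSpace M] [ChartedSpace (EuclideanHalfSpace n) M]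
  [IsManifold (𝓡∂ n) ∞ M] {g : LorentzMetric n M} {T : TimeOrientation g}

/-- The vector is not based at a boundary point, or it is not orthogonal to the boundary. -/
def NotNormal (g : LorentzMetric n M) (v : TangentBundle (𝓡∂ n) M) : Prop :=
  v.1 ∈ (𝓡∂ n).boundary M → ∃ w : Vec n, w 0 = 0 ∧ g.form v.1 (vecOf v) w ≠ 0

theorem NotNormal.smul {v : TangentBundle (𝓡∂ n) M} (h : NotNormal g v) {c : ℝ} (hc : c ≠ 0) :
    NotNormal g (tsmul c v) := by
  intro hb
  obtain ⟨w, hw, hne⟩ := h hb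
  refine ⟨w, hw, ?_⟩
  change g.form v.1 (c • vecOf v) w ≠ 0
  rw [map_smul]
  exact mul_ne_zero hc hne

/-- Small displacements along `N` stay in the manifold: at the boundary `N` is tangential, at
interior points any direction is allowed. -/
theorem NotNormal.exists_direction [T2Space M] {v : TangentBundle (𝓡∂ n) M} (hv : v ∈ futureLightlike T)
    (h : NotNormal g v) : ∃ N : Vec n, 0 < g.form v.1 (vecOf v) N ∧
      (N 0 = 0 ∨ 0 < extChartAt (𝓡∂ n) v.1 v.1 0) := by
  rcases mem_interior_or_boundary (n := n) v.1 with hi | hb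
  · obtain ⟨t, ht⟩ : ∃ t : Vec n, g.form v.1 (vecOf v) t < 0 :=
      ⟨_, (mem_futureLightlike_iff.1 hv).2⟩
    refine ⟨-t, ?_, Or.inr (mem_interior_iff.1 hi)⟩
    rw [map_neg]
    linarith
  · obtain ⟨w, hw, hne⟩ := h hb
    rcases lt_or_gt_of_ne hne with h1 | h1
    · refine ⟨-w, ?_, Or.inl (by simp [hw])⟩
      rw [map_neg]
      linarith
    · exact ⟨w, h1, Or.inl hw⟩

set_option synthInstance.maxHeartbeats 200000 in
-- Bounds how far a null vector is from being null at a slightly displaced point.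
theorem exists_lipschitz_metricForm (g : LorentzMetric n M) (x₀ : M) {y₀ : Vec n}
    (hy₀ : y₀ ∈ (extChartAt (𝓡∂ n) x₀).target) :
    ∃ (K : ℝ) (ρ : ℝ), 0 ≤ K ∧ 0 < ρ ∧ ∀ y ∈ halfSpace n, ∀ y' ∈ halfSpace n, dist y y₀ < ρ →
      dist y' y₀ < ρ → ∀ u : Vec n,
      |metricForm g x₀ y u u - metricForm g x₀ y' u u| ≤ K * dist y y' * ‖u‖ ^ 2 := by
  have h1 : ContDiffWithinAt ℝ 1 (metricForm g x₀) (halfSpace n) y₀ :=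
    ((contDiffOn_metricForm g x₀ y₀ hy₀).of_le (by simp)).mono_of_mem_nhdsWithin
      (extChartAt_target_mem_nhdsWithin_of_mem hy₀)
  obtain ⟨K, t, ht, hK⟩ := h1.exists_lipschitzOnWith (convex_halfSpace n)
  obtain ⟨ρ, hρ, hball⟩ := Metric.mem_nhdsWithin_iff.1 ht
  refine ⟨K, ρ, K.2, hρ, fun y hy y' hy' d d' u ↦ ?_⟩
  have h2 := hK.dist_le_mul y (hball ⟨d, hy⟩) y' (hball ⟨d', hy'⟩)
  rw [dist_eq_norm] at h2
  have h3 := (metricForm g x₀ y - metricForm g x₀ y').le_opNorm₂ u u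
  rw [Real.norm_eq_abs] at h3
  calc |metricForm g x₀ y u u - metricForm g x₀ y' u u|
      = |(metricForm g x₀ y - metricForm g x₀ y') u u| := rfl
    _ ≤ ‖metricForm g x₀ y - metricForm g x₀ y'‖ * ‖u‖ * ‖u‖ := h3
    _ ≤ (K * dist y y') * ‖u‖ * ‖u‖ := by gcongr
    _ = _ := by ring

theorem eventually_mul_lt {a c : ℝ} (hc : 0 < c) : ∀ᶠ η in 𝓝[>] (0 : ℝ), η * a < c := by
  have h : Tendsto (fun η : ℝ ↦ η * a) (𝓝 0) (𝓝 0) := by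
    simpa using (continuous_mul_const a).tendsto 0
  exact (tendsto_nhdsWithin_of_tendsto_nhds h).eventually_lt_const hc

theorem exists_push_ball (T : TimeOrientation g) (x₀ : M) {y₀ u₀ N : Vec n}
    (hy₀ : y₀ ∈ (extChartAt (𝓡∂ n) x₀).target) (h1 : timeForm T x₀ y₀ u₀ < 0)
    (h2 : 0 < metricForm g x₀ y₀ u₀ N) :
    ∃ ρ > 0, ∀ y u : Vec n, dist y y₀ < ρ → dist u u₀ < ρ → y ∈ halfSpace n →
      timeForm T x₀ y u < 0 ∧ y ∈ (extChartAt (𝓡∂ n) x₀).target ∧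
      metricForm g x₀ y₀ u₀ N / 2 < metricForm g x₀ y u N ∧
      metricForm g x₀ y N N < |metricForm g x₀ y₀ N N| + 1 := by
  have e1 := eventually_timeForm_neg (T := T) (x₀ := x₀) (z₀ := (y₀, u₀)) hy₀ h1
  have e0 : Tendsto (fun z : Vec n × Vec n ↦ z.1) (𝓝[{z : Vec n × Vec n | z.1 ∈ halfSpace n}] (y₀, u₀))
      (𝓝[halfSpace n] y₀) :=
    tendsto_nhdsWithin_iff.2 ⟨tendsto_nhdsWithin_of_tendsto_nhds (continuous_fst.tendsto (y₀, u₀)),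
      self_mem_nhdsWithin⟩
  have e2 : ∀ᶠ z in 𝓝[{z : Vec n × Vec n | z.1 ∈ halfSpace n}] (y₀, u₀),
      z.1 ∈ (extChartAt (𝓡∂ n) x₀).target :=
    e0 (extChartAt_target_mem_nhdsWithin_of_mem hy₀)
  have hG : ContinuousOn (fun z : Vec n × Vec n ↦ metricForm g x₀ z.1)
      {z | z.1 ∈ (extChartAt (𝓡∂ n) x₀).target} :=
    (contDiffOn_metricForm g x₀).continuousOn.comp continuous_fst.continuousOn (fun z hz ↦ hz)
  have e3 : ContinuousWithinAt (fun z : Vec n × Vec n ↦ metricForm g x₀ z.1 z.2 N)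
      {z | z.1 ∈ (extChartAt (𝓡∂ n) x₀).target} (y₀, u₀) :=
    (hG.clm_apply continuous_snd.continuousOn).clm_apply continuousOn_const (y₀, u₀) hy₀
  have e4 : ContinuousWithinAt (fun z : Vec n × Vec n ↦ metricForm g x₀ z.1 N N)
      {z | z.1 ∈ (extChartAt (𝓡∂ n) x₀).target} (y₀, u₀) :=
    (hG.clm_apply continuousOn_const).clm_apply continuousOn_const (y₀, u₀) hy₀
  have e5 := (e3.mono_of_mem_nhdsWithin e2).tendsto.eventually_const_lt (half_lt_self h2)
  have e6 := (e4.mono_of_mem_nhdsWithin e2).tendsto.eventually_lt_const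
    (show metricForm g x₀ y₀ N N < |metricForm g x₀ y₀ N N| + 1 by
      linarith [le_abs_self (metricForm g x₀ y₀ N N)])
  obtain ⟨ρ, hρ, hball⟩ := Metric.nhdsWithin_basis_ball.eventually_iff.1
    (e1.and (e2.and (e5.and e6)))
  refine ⟨ρ, hρ, fun y u d1 d2 hy ↦ ?_⟩
  have h3 : (y, u) ∈ Metric.ball (y₀, u₀) ρ := by
    rw [Metric.mem_ball, Prod.dist_eq]
    exact max_lt d1 d2
  exact @hball (y, u) ⟨h3, hy⟩

/-- The estimate for the deformation of a lightlike geodesic into a timelike curve. -/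
theorem push_estimate {A K N V B m η δ G0 G1 G2 : ℝ} (hm : 0 < m) (hη : 0 < η) (hδ : 0 < δ)
    (h0 : G0 ≤ K * (η * N) * V) (hA : A = G0 - 2 * (η / δ) * G1 + (η / δ) ^ 2 * G2)
    (h1 : m / 2 < G1) (h2 : G2 < B) (h3 : δ * (K * N * V) < m / 2) (h4 : η * B < m * δ / 4) :
    A < 0 := by
  have h5 : (η / δ) ^ 2 * G2 ≤ (η / δ) ^ 2 * B := by gcongr
  have h6 : (η / δ) ^ 2 * B = (η / δ) * (η * B / δ) := by ring
  have h7 : η * B / δ < m / 4 := by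
    rw [div_lt_iff₀ hδ]
    linarith
  have h8 : 0 < η / δ := div_pos hη hδ
  -- With `η / δ` factored out, the displacement error is of order `δ`, the quadratic term of order
  -- `η / δ`, and the mixed term is negative and bounded away from `0`.
  have h9 : K * (η * N) * V = (η / δ) * (δ * (K * N * V)) := by field_simp
  have h10 : A ≤ (η / δ) * (δ * (K * N * V) - 2 * G1 + η * B / δ) := by
    rw [hA]
    linarith
  have h11 : δ * (K * N * V) - 2 * G1 + η * B / δ < 0 := by linarith
  exact lt_of_le_of_lt h10 (mul_neg_of_pos_of_neg h8 h11)

/-- By openness of chronology, `p` also precedes the point obtained from `(Z r₁).1` by a small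
displacement along `N`. Letting the displacement decrease to zero at `r₂` turns the geodesic into a
timelike curve, since its velocity has positive product with `N`. -/
theorem push_local [T2Space M] {Z : ℝ → TangentBundle (𝓡∂ n) M} {s t₀ : ℝ} (hs : 0 < s)
    (hZ : IsIntegral g Z (Icc 0 s)) (hX : ∀ t ∈ Icc 0 s, Z t ∈ futureLightlike T)
    (ht₀ : t₀ ∈ Icc 0 s) (hN : NotNormal g (Z t₀)) (p : M) :
    ∃ ε > 0, ∀ r₁ ∈ Icc 0 s, ∀ r₂ ∈ Icc 0 s, dist r₁ t₀ < ε → dist r₂ t₀ < ε → r₁ < r₂ →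
      Chronological T p (Z r₁).1 → Chronological T p (Z r₂).1 := by
  set x₀ := (Z t₀).1 with hx₀
  have hsrc : (Z t₀).1 ∈ (extChartAt (𝓡∂ n) x₀).source := mem_extChartAt_source x₀
  obtain ⟨N, hm, hN0⟩ := hN.exists_direction (hX t₀ ht₀)
  set y₀ := extChartAt (𝓡∂ n) x₀ x₀ with hy₀
  set u₀ : Vec n := vecOf (Z t₀) with hu₀
  have hcoords : coords x₀ (Z t₀) = (y₀, u₀) := Prod.ext rfl (chartDeriv_self x₀ _)
  have hy₀t : y₀ ∈ (extChartAt (𝓡∂ n) x₀).target := mem_extChartAt_target x₀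
  have hform : metricForm g x₀ y₀ u₀ N = g.form x₀ u₀ N := by
    rw [hy₀, ← metricForm_coords g x₀ hsrc, chartDeriv_self, chartDeriv_self]
  have hx := (mem_futureLightlike_iff_coords (x₀ := x₀) hsrc).1 (hX t₀ ht₀)
  rw [hcoords] at hx
  rw [← hform] at hm
  set m := metricForm g x₀ y₀ u₀ N with hmdef
  obtain ⟨ρ₁, hρ₁, hball⟩ := exists_push_ball T x₀ hy₀t hx.2 hm
  obtain ⟨K, ρ₂, hK, hρ₂, hlip⟩ := exists_lipschitz_metricForm g x₀ hy₀t
  set B := |metricForm g x₀ y₀ N N| + 1 with hB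
  -- Either the displacement does not change the boundary coordinate, or `ρ ≤ y₀ 0` keeps the whole
  -- ball in the half-space.
  obtain ⟨ρ, hρ, hρ1, hρ2, hρ3⟩ : ∃ ρ > 0, ρ ≤ ρ₁ ∧ ρ ≤ ρ₂ ∧ (N 0 = 0 ∨ ρ ≤ y₀ 0) := by
    rcases hN0 with h | h
    · exact ⟨min ρ₁ ρ₂, lt_min hρ₁ hρ₂, min_le_left _ _, min_le_right _ _, Or.inl h⟩
    · exact ⟨min (min ρ₁ ρ₂) (y₀ 0), lt_min (lt_min hρ₁ hρ₂) h,
        (min_le_left _ _).trans (min_le_left _ _), (min_le_left _ _).trans (min_le_right _ _),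
        Or.inr (min_le_right _ _)⟩
  set V := (‖u₀‖ + ρ) ^ 2 with hV
  obtain ⟨a', b', -, hsub, -, hJ, hsrc', hcd⟩ := hZ.exists_contDiffOn hs ht₀ hsrc
  have hcont : ContinuousWithinAt (fun r ↦ coords x₀ (Z r)) (Icc 0 s) t₀ :=
    (hZ.2 t₀ ht₀ x₀ hsrc).continuousWithinAt
  have hev : ∀ᶠ r in 𝓝[Icc 0 s] t₀, dist (coords x₀ (Z r)) (y₀, u₀) < ρ / 2 := by
    have h := hcont.tendsto
    rw [hcoords] at h
    exact h (Metric.ball_mem_nhds _ (half_pos hρ))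
  have hJ' : ∀ᶠ r in 𝓝[Icc 0 s] t₀, r ∈ Icc a' b' := hJ
  obtain ⟨ε₁, hε₁, hnear⟩ := Metric.nhdsWithin_basis_ball.eventually_iff.1 (hev.and hJ')
  set D := K * ‖N‖ * V with hD
  have hDnn : 0 ≤ D := by positivity
  -- The second bound ensures `δ * D < m / 2`, as `r₂ - r₁` is less than twice the radius; `D + 1`
  -- replaces `D`, which may vanish.
  refine ⟨min ε₁ (m / (4 * (D + 1))), lt_min hε₁ (by positivity), ?_⟩
  intro r₁ hr₁ r₂ hr₂ d₁ d₂ hlt hch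
  set δ := r₂ - r₁ with hδdef
  have hδ : 0 < δ := sub_pos.2 hlt
  have hIcc : ∀ r ∈ Icc r₁ r₂, dist (coords x₀ (Z r)) (y₀, u₀) < ρ / 2 ∧ r ∈ Icc a' b' := by
    intro r hr
    refine hnear ⟨?_, hr₁.1.trans hr.1, hr.2.trans hr₂.2⟩
    have h1 := d₁.trans_le (min_le_left _ _)
    have h2 := d₂.trans_le (min_le_left _ _)
    rw [Real.dist_eq, abs_lt] at h1 h2
    rw [Metric.mem_ball, Real.dist_eq, abs_lt]
    exact ⟨by linarith [hr.1], by linarith [hr.2]⟩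
  have hδD : δ * D < m / 2 := by
    have h1 := d₁.trans_le (min_le_right _ _)
    have h2 := d₂.trans_le (min_le_right _ _)
    rw [Real.dist_eq, abs_lt] at h1 h2
    have h3 : δ < 2 * (m / (4 * (D + 1))) := by linarith
    calc δ * D ≤ δ * (D + 1) := by gcongr; linarith
      _ < 2 * (m / (4 * (D + 1))) * (D + 1) := by gcongr
      _ = m / 2 := by field_simp; ring
  set c : ℝ → Vec n := fun r ↦ (coords x₀ (Z r)).1 with hc
  set c' : ℝ → Vec n := fun r ↦ (coords x₀ (Z r)).2 with hc'
  have hs1 : (Z r₁).1 ∈ (extChartAt (𝓡∂ n) x₀).source :=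
    hsrc' r₁ (hIcc r₁ (left_mem_Icc.2 hlt.le)).2
  have hs2 : (Z r₂).1 ∈ (extChartAt (𝓡∂ n) x₀).source :=
    hsrc' r₂ (hIcc r₂ (right_mem_Icc.2 hlt.le)).2
  have hopen : ∀ᶠ η in 𝓝[>] (0 : ℝ),
      Chronological T p ((extChartAt (𝓡∂ n) x₀).symm (c r₁ + η • N)) := by
    have h1 : ContinuousAt (fun η : ℝ ↦ (extChartAt (𝓡∂ n) x₀).symm (c r₁ + η • N)) 0 := by
      refine ContinuousAt.comp (f := fun η : ℝ ↦ c r₁ + η • N) ?_ (by fun_prop)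
      simp only [zero_smul, add_zero]
      exact continuousAt_extChartAt_symm' hs1
    have h2 := h1.tendsto
    simp only [zero_smul, add_zero, hc, coords, (extChartAt (𝓡∂ n) x₀).left_inv hs1] at h2
    exact (tendsto_nhdsWithin_of_tendsto_nhds h2).eventually hch.eventually
  obtain ⟨η, hη, hη1, hη2, hη3, hη4⟩ := (eventually_mem_nhdsWithin.and
    (hopen.and ((eventually_mul_lt (a := ‖N‖) (half_pos hρ)).and
    ((eventually_mul_lt (a := ‖N‖ / δ) (half_pos hρ)).and
    (eventually_mul_lt (a := B) (show 0 < m * δ / 4 by positivity)))))).exists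
  have hη0 : 0 < η := hη
  -- The displacement decreases linearly from `η • N` to `0`, which adds `-(η / δ) • N` to the
  -- velocity.
  set ζ : ℝ → Vec n := fun r ↦ c r + (η * (r₂ - r) / δ) • N with hζ
  set ζ' : ℝ → Vec n := fun r ↦ c' r - (η / δ) • N with hζ'
  have hfrac : ∀ r ∈ Icc r₁ r₂, 0 ≤ η * (r₂ - r) / δ ∧ η * (r₂ - r) / δ ≤ η := by
    intro r hr
    refine ⟨div_nonneg (mul_nonneg hη0.le (by linarith [hr.2])) hδ.le, ?_⟩
    rw [div_le_iff₀ hδ]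
    exact mul_le_mul_of_nonneg_left (by linarith [hr.1]) hη0.le
  have hdζ : ∀ r ∈ Icc r₁ r₂, dist (ζ r) (c r) ≤ η * ‖N‖ := by
    intro r hr
    rw [dist_eq_norm, hζ]
    simp only [add_sub_cancel_left]
    rw [norm_smul, Real.norm_of_nonneg (hfrac r hr).1]
    exact mul_le_mul_of_nonneg_right (hfrac r hr).2 (norm_nonneg N)
  have hdc : ∀ r ∈ Icc r₁ r₂, dist (c r) y₀ < ρ / 2 ∧ dist (c' r) u₀ < ρ / 2 := by
    intro r hr
    have h1 := (hIcc r hr).1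
    rw [Prod.dist_eq] at h1
    exact ⟨(le_max_left _ _).trans_lt h1, (le_max_right _ _).trans_lt h1⟩
  have hζy : ∀ r ∈ Icc r₁ r₂, dist (ζ r) y₀ < ρ := fun r hr ↦ by
    linarith [dist_triangle (ζ r) (c r) y₀, hdζ r hr, (hdc r hr).1]
  have hζu : ∀ r ∈ Icc r₁ r₂, dist (ζ' r) u₀ < ρ := by
    intro r hr
    have h1 : dist (ζ' r) (c' r) = η * (‖N‖ / δ) := by
      rw [dist_eq_norm, hζ']
      simp only [sub_sub_cancel_left, norm_neg]
      rw [norm_smul, Real.norm_of_nonneg (by positivity)]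
      ring
    linarith [dist_triangle (ζ' r) (c' r) u₀, (hdc r hr).2]
  have hcH : ∀ r ∈ Icc r₁ r₂, c r ∈ halfSpace n := fun r hr ↦
    halfSpace_mem_of_source (hsrc' r (hIcc r hr).2)
  have hζH : ∀ r ∈ Icc r₁ r₂, ζ r ∈ halfSpace n := by
    intro r hr
    rcases hρ3 with h | h
    · have h1 := mem_halfSpace.1 (hcH r hr)
      rw [mem_halfSpace]
      simpa [hζ, h] using h1
    · rw [mem_halfSpace]
      have h1 : ‖(ζ r - y₀) 0‖ ≤ ‖ζ r - y₀‖ := PiLp.norm_apply_le _ _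
      have h2 := hζy r hr
      rw [dist_eq_norm] at h2
      rw [Real.norm_eq_abs] at h1
      have h3 := (abs_le.1 h1).1
      simp only [PiLp.sub_apply] at h3
      linarith
  have hreach : SmoothReach (futureTimelike T) ((extChartAt (𝓡∂ n) x₀).symm (ζ r₁))
      ((extChartAt (𝓡∂ n) x₀).symm (ζ r₂)) := by
    have hsubI : Icc r₁ r₂ ⊆ Icc a' b' := fun r hr ↦ (hIcc r hr).2
    refine smoothReach_of_coords (α' := ζ') hlt ?_ ?_ ?_ ?_
    · exact (contDiff_fst.comp_contDiffOn (hcd.mono hsubI)).add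
        (ContDiff.contDiffOn (by fun_prop))
    · intro r hr
      exact (hball (ζ r) u₀ ((hζy r hr).trans_le hρ1) (by simpa using hρ₁) (hζH r hr)).2.1
    · intro r hr
      have h1 : HasDerivWithinAt c (c' r) (Icc r₁ r₂) r :=
        (((hZ.2 r (hsub (hsubI hr)) x₀ (hsrc' r (hsubI hr))).mono
          (hsubI.trans hsub)).hasFDerivWithinAt.fst.hasDerivWithinAt).congr_deriv
          (by simp [spray, hc'])
      have h2 : HasDerivWithinAt (fun r : ℝ ↦ η * (r₂ - r) / δ) (-(η / δ)) (Icc r₁ r₂) r := by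
        refine ((((hasDerivWithinAt_id r (Icc r₁ r₂)).const_sub r₂).const_mul η).div_const
          δ).congr_deriv ?_
        ring
      refine (h1.add (h2.smul_const N)).congr_deriv ?_
      rw [neg_smul, ← sub_eq_add_neg]
    · intro r hr
      have hb1 := hball (ζ r) (c' r) ((hζy r hr).trans_le hρ1)
        (by linarith [(hdc r hr).2]) (hζH r hr)
      have hb2 := hball (ζ r) (ζ' r) ((hζy r hr).trans_le hρ1)
        ((hζu r hr).trans_le hρ1) (hζH r hr)
      refine ⟨?_, hb2.1⟩
      have hnull : metricForm g x₀ (c r) (c' r) (c' r) = 0 :=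
        ((mem_futureLightlike_iff_coords (x₀ := x₀) (hsrc' r (hsubI hr))).1
          (hX r (hsub (hsubI hr)))).1
      have hl := hlip (ζ r) (hζH r hr) (c r) (hcH r hr) ((hζy r hr).trans_le hρ2)
        (by linarith [(hdc r hr).1]) (c' r)
      rw [hnull, sub_zero] at hl
      have hnorm : ‖c' r‖ ^ 2 ≤ V := by
        have : ‖c' r‖ ≤ ‖u₀‖ + ρ := by
          have h1 := norm_le_norm_add_norm_sub' (c' r) u₀
          rw [← dist_eq_norm] at h1
          linarith [(hdc r hr).2]
        rw [hV]
        gcongr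
      have hG0 : metricForm g x₀ (ζ r) (c' r) (c' r) ≤ K * (η * ‖N‖) * V := by
        refine (le_abs_self _).trans (hl.trans ?_)
        have := hdζ r hr
        gcongr
      refine push_estimate (G1 := metricForm g x₀ (ζ r) (c' r) N)
        (G2 := metricForm g x₀ (ζ r) N N) hm hη0 hδ hG0 ?_ hb1.2.2.1 hb1.2.2.2 ?_ hη4
      · simp only [hζ', map_sub, map_smul, sub_apply, smul_apply, smul_eq_mul,
          metricForm_symm g x₀ (ζ r) N (c' r)]
        ring
      · exact hδD
  have e1 : ζ r₁ = c r₁ + η • N := by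
    simp only [hζ, ← hδdef]
    rw [mul_div_assoc, div_self hδ.ne', mul_one]
  have e2 : ζ r₂ = c r₂ := by simp [hζ]
  rw [e1, e2, show c r₂ = extChartAt (𝓡∂ n) x₀ (Z r₂).1 from rfl,
    (extChartAt (𝓡∂ n) x₀).left_inv hs2] at hreach
  rw [chronological_iff] at hη1 ⊢
  exact hη1.tail hreach

/-- Every vector on the lightlike geodesic between two vectors is not normal to the boundary. -/
def Clear (T : TimeOrientation g) (x y : TangentBundle (𝓡∂ n) M) : Prop :=
  ∀ z, (Le T x z ∧ Le T z y) ∨ (Le T y z ∧ Le T z x) → NotNormal g z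

theorem Clear.symm {x y : TangentBundle (𝓡∂ n) M} (h : Clear T x y) : Clear T y x :=
  fun z hz ↦ h z hz.symm

variable [T2Space M]

/-- Continuous induction: `push_local` at the supremum of the good times leads beyond it, unless it
is the end of the geodesic. -/
theorem Le.push {x y : TangentBundle (𝓡∂ n) M} (h : Le T x y)
    (hN : ∀ z, Le T x z → Le T z y → NotNormal g z) {p : M} (hp : Chronological T p x.1) :
    Chronological T p y.1 := by
  obtain ⟨s, hs, Z, hZ, hX, rfl, rfl⟩ := h
  rcases hs.eq_or_lt with rfl | hs
  · exact hp
  have h0 : (0 : ℝ) ∈ Icc 0 s := left_mem_Icc.2 hs.le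
  set S := {t ∈ Icc 0 s | ∀ r ∈ Icc 0 t, Chronological T p (Z r).1} with hS
  have h0S : (0 : ℝ) ∈ S := ⟨h0, fun r hr ↦ by rwa [le_antisymm hr.2 hr.1]⟩
  have hbdd : BddAbove S := ⟨s, fun t ht ↦ ht.1.2⟩
  set t₀ := sSup S with ht₀
  have ht₀I : t₀ ∈ Icc 0 s := ⟨le_csSup hbdd h0S, csSup_le ⟨0, h0S⟩ fun t ht ↦ ht.1.2⟩
  have hN' : NotNormal g (Z t₀) := hN _ ⟨_, hZ.flow hX le_rfl ht₀I.1 ht₀I.2⟩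
    ⟨_, hZ.flow hX ht₀I.1 ht₀I.2 le_rfl⟩
  obtain ⟨ε, hε, hpush⟩ := push_local hs hZ hX ht₀I hN' p
  obtain ⟨r₁, hr₁, hlt⟩ := exists_lt_of_lt_csSup ⟨0, h0S⟩ (show t₀ - ε < sSup S by linarith)
  have hr₁t : r₁ ≤ t₀ := le_csSup hbdd hr₁
  have hall : ∀ r ∈ Icc 0 s, r < t₀ + ε → Chronological T p (Z r).1 := by
    intro r hr hrε
    by_cases hrr : r ≤ r₁
    · exact hr₁.2 r ⟨hr.1, hrr⟩
    · push Not at hrr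
      refine hpush r₁ hr₁.1 r hr ?_ ?_ hrr (hr₁.2 r₁ ⟨hr₁.1.1, le_rfl⟩)
      · rw [Real.dist_eq, abs_lt]
        exact ⟨by linarith, by linarith⟩
      · rw [Real.dist_eq, abs_lt]
        exact ⟨by linarith, by linarith⟩
  have hmem : min s (t₀ + ε / 2) ∈ S :=
    ⟨⟨le_min hs.le (by linarith [ht₀I.1]), min_le_left _ _⟩, fun r hr ↦
      hall r ⟨hr.1, hr.2.trans (min_le_left _ _)⟩ (by linarith [hr.2.trans (min_le_right _ _)])⟩
  have h1 : s ≤ t₀ + ε / 2 := by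
    by_contra! h
    have h2 := le_csSup hbdd hmem
    rw [min_eq_right h.le, ← ht₀] at h2
    linarith
  exact hall s (right_mem_Icc.2 hs.le) (by linarith)

theorem NotNormal.of_neg {v : TangentBundle (𝓡∂ n) M} (h : NotNormal g (tsmul (-1) v)) :
    NotNormal g v := by
  have := h.smul (c := -1) (by norm_num)
  rwa [tsmul_neg_neg] at this

/-- A broken lightlike geodesic with an actual corner can be deformed to a timelike curve. -/
theorem chronological_of_corner {x v v' y : TangentBundle (𝓡∂ n) M} (h₁ : Le T x v)
    (h₂ : Le T v' y) (hv : v.1 = v'.1) (hpar : ¬ Par v v') (hxv : x ≠ v) (hvy : v' ≠ y)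
    (hN₁ : Clear T x v) (hN₂ : Clear T v' y) : Chronological T x.1 y.1 := by
  obtain ⟨s, h1⟩ := h₁
  obtain ⟨t, h2⟩ := h₂
  have hs : 0 < s := h1.nonneg.lt_of_ne fun h ↦ hxv (by subst h; exact h1.eq_of_zero)
  have ht : 0 < t := h2.nonneg.lt_of_ne fun h ↦ hvy (by subst h; exact h2.eq_of_zero)
  obtain ⟨x₁, y₁, a1, a2, b1, b2, hch⟩ := exists_chronological_near_corner hs ht h1 h2 hv hpar
  -- The future end of the short timelike curve is pushed along the second geodesic, and then its
  -- past end along the first, by time reversal.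
  have hch1 : Chronological T x₁.1 y.1 := b2.push (fun z hz hz' ↦
    hN₂ z (Or.inl ⟨b1.trans hz, hz'⟩)) hch
  have hch2 := a1.reverse.push (p := y.1) (fun z hz hz' ↦ ?_) hch1.reverse
  · have := hch2.reverse
    rwa [T.reverse_reverse] at this
  · rw [← tsmul_neg_neg z] at hz hz'
    have := hN₁ _ (Or.inl ⟨hz'.of_reverse, hz.of_reverse.trans a2⟩)
    exact this.of_neg

/-- The corner at `b` makes the base points of `a` and `c'` chronologically related, but both lie on
the third geodesic, which is achronal whatever its direction. -/
theorem not_corner (hach : LightlikeGeodesicsAchronal T) {a a' b b' c c' : TangentBundle (𝓡∂ n) M}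
    (ha : a.1 = a'.1) (hb : b'.1 = b.1) (hc : c.1 = c'.1) (hpar : ¬ Par b' b)
    (hab : Le T a b') (hbc : Le T b c') (hca : Cmp T c a') (hne : a ≠ b') (hne' : b ≠ c')
    (hca' : c.1 ≠ a.1) (hN₁ : Clear T a b') (hN₂ : Clear T b c') : False := by
  have hch := chronological_of_corner hab hbc hb hpar hne hne' hN₁ hN₂
  rcases hca with h | h
  · obtain ⟨γ, s, hs, hγ, h0, h1⟩ := h.exists_geodesic (fun h ↦ hca' (by rw [h, ha]))
    refine hach γ 0 s hγ.isLightlikeGeodesic a.1 ⟨s, right_mem_Icc.2 hs.le, ?_⟩ c'.1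
      ⟨0, left_mem_Icc.2 hs.le, ?_⟩ hch
    · rw [ha, ← h1]; rfl
    · rw [← hc, ← h0]; rfl
  · obtain ⟨γ, s, hs, hγ, h0, h1⟩ := h.exists_geodesic (fun h ↦ hca' (by rw [← h, ha]))
    refine hach γ 0 s hγ.isLightlikeGeodesic a.1 ⟨0, left_mem_Icc.2 hs.le, ?_⟩ c'.1
      ⟨s, right_mem_Icc.2 hs.le, ?_⟩ hch
    · rw [ha, ← h0]; rfl
    · rw [← hc, ← h1]; rfl

/-- There are no triangles of lightlike geodesics. -/
theorem not_triangle (hach : LightlikeGeodesicsAchronal T)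
    {a a' b b' c c' : TangentBundle (𝓡∂ n) M}
    (ha : a.1 = a'.1) (hb : b.1 = b'.1) (hc : c.1 = c'.1)
    (pa : ¬ Par a a') (pb : ¬ Par b b') (pc : ¬ Par c c')
    (hab : Cmp T a b') (hbc : Cmp T b c') (hca : Cmp T c a')
    (nab : a.1 ≠ b.1) (nbc : b.1 ≠ c.1) (nca : c.1 ≠ a.1)
    (hN₁ : Clear T a b') (hN₂ : Clear T b c') (hN₃ : Clear T c a') : False := by
  have pa' : ¬ Par a' a := fun h ↦ pa h.symm
  have pb' : ¬ Par b' b := fun h ↦ pb h.symm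
  have pc' : ¬ Par c' c := fun h ↦ pc h.symm
  have n1 : a ≠ b' := fun h ↦ nab (by rw [h, hb])
  have n2 : b ≠ c' := fun h ↦ nbc (by rw [h, hc])
  have n3 : c ≠ a' := fun h ↦ nca (by rw [h, ha])
  -- For every orientation of the sides, some vertex is the future end of one side and the past end
  -- of another; the corner is taken there.
  rcases hab with h1 | h1 <;> rcases hbc with h2 | h2
  · exact not_corner hach ha hb.symm hc pb' h1 h2 hca n1 n2 nca hN₁ hN₂
  · rcases hca with h3 | h3
    · exact not_corner hach hc ha.symm hb pa' h3 h1 (Or.inr h2) n3 n1 nbc hN₃ hN₁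
    · exact not_corner hach ha.symm hc hb.symm pc h3 h2 (Or.inr h1) n3.symm n2.symm
        (fun h ↦ nab (by rw [ha, ← h, hb])) hN₃.symm hN₂.symm
  · rcases hca with h3 | h3
    · exact not_corner hach hb hc.symm ha pc' h2 h3 (Or.inr h1) n2 n3 nab hN₂ hN₃
    · exact not_corner hach hb.symm ha hc.symm pa h1 h3 (Or.inr h2) n1.symm n3.symm
        (fun h ↦ nbc (by rw [hb, ← h, hc])) hN₁.symm hN₃.symm
  · exact not_corner hach hc.symm hb ha.symm pb h2 h1 hca.symm n2.symm n1.symm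
      (fun h ↦ nca (by rw [hc, ← h, ha])) hN₂.symm hN₁.symm

end Push

/-! ### Sky shadows and maximal sets of intersecting vectors -/

section Shadows

variable {n : ℕ} [NeZero n]
  {M : Type*} [TopologicalSpace M] [ChartedSpace (EuclideanHalfSpace n) M]
  [IsManifold (𝓡∂ n) ∞ M] {g : LorentzMetric n M} {T : TimeOrientation g}
  [T2Space M] {x y : TangentBundle (𝓡∂ n) M}

/-- The future-directed initial vectors at the boundary of lightlike geodesics through `p`. -/
def FutureShadow (T : TimeOrientation g) (p : M) : Set (TangentBundle (𝓡∂ n) M) :=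
  {x | x ∈ boundaryTangent n M ∧ ¬ IsEnd T x ∧ ∃ y, Le T x y ∧ y.1 = p}

theorem mk_neg_eq (v : TangentBundle (𝓡∂ n) M) :
    (⟨v.1, -v.2⟩ : TangentBundle (𝓡∂ n) M) = tsmul (-1) v := by
  change tvec v.1 (-vecOf v) = tvec v.1 ((-1 : ℝ) • vecOf v)
  rw [neg_one_smul]

theorem startsWith_iff {γ : ℝ → M} {a b : ℝ} {η : TangentBundle (𝓡∂ n) M} :
    StartsWith T η γ a b ↔ IsFutureLightlikeGeodesic T γ a b ∧
      (velocity γ a b a = η ∨ velocity γ a b a = tsmul (-1) η) := by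
  rw [StartsWith, mk_neg_eq]

/-- Geodesics live on nondegenerate intervals, which `¬ IsEnd T x` accounts for: if `y = x`, some
proper extension of `x` supplies the interval. -/
theorem exists_geodesic_iff (hc : StronglyCausal T) {p : M} :
    (∃ (γ : ℝ → M) (a b : ℝ), IsFutureLightlikeGeodesic T γ a b ∧ velocity γ a b a = x ∧
      p ∈ γ '' Icc a b) ↔ ¬ IsEnd T x ∧ ∃ y, Le T x y ∧ y.1 = p := by
  constructor
  · rintro ⟨γ, a, b, hγ, rfl, t, ht, rfl⟩
    refine ⟨fun hend ↦ ?_, velocity γ a b t, le_of_geodesic hγ le_rfl ht.1 ht.2, rfl⟩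
    have hab : a < b := hγ.1.1
    have h1 := flow_of_geodesic hγ le_rfl hab.le le_rfl
    have h2 := h1.smoothReach (sub_pos.2 hab)
    rw [hend _ ⟨_, h1⟩] at h2
    exact hc.not_transGen _ (.single h2)
  · rintro ⟨hend, y, hxy, rfl⟩
    obtain ⟨z, hxz, hzx, hyz⟩ : ∃ z, Le T x z ∧ x ≠ z ∧ Le T y z := by
      by_cases h : x = y
      · subst h
        unfold IsEnd at hend
        push Not at hend
        obtain ⟨z, hz, hne⟩ := hend
        exact ⟨z, hz, hne.symm, hz⟩
      · exact ⟨y, hxy, h, .refl hxy.right_mem⟩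
    obtain ⟨s, hs⟩ := hxy
    obtain ⟨t, ht⟩ := hyz
    have hst := hs.trans ht
    have hpos : 0 < s + t := hst.nonneg.lt_of_ne fun h ↦ hzx (by rw [← h] at hst; exact hst.eq_of_zero)
    obtain ⟨γ, hγ, h0, h1⟩ := hst.exists_geodesic hpos
    refine ⟨γ, 0, s + t, hγ, h0, s, ⟨hs.nonneg, by linarith [ht.nonneg]⟩, ?_⟩
    have h2 := flow_of_geodesic (t := 0) (t' := s) hγ le_rfl hs.nonneg (by linarith [ht.nonneg])
    rw [h0, sub_zero] at h2
    rw [hs.unique h2]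
    rfl

theorem mem_pastSkyShadow_iff (hc : StronglyCausal T) {p : M} {η : TangentBundle (𝓡∂ n) M} :
    η ∈ pastSkyShadow T p ↔ η ∈ FutureShadow T p ∨ tsmul (-1) η ∈ FutureShadow T p := by
  have h1 := exists_geodesic_iff (x := η) hc (p := p)
  have h2 := exists_geodesic_iff (x := tsmul (-1) η) hc (p := p)
  simp only [pastSkyShadow, startsWith_iff, FutureShadow, mem_ofPred_eq]
  rw [← h1, ← h2]
  have h3 : tsmul (-1) η ∈ boundaryTangent n M ↔ η ∈ boundaryTangent n M := Iff.rfl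
  rw [h3]
  constructor
  · rintro ⟨hb, γ, a, b, ⟨hγ, h | h⟩, hp⟩
    · exact Or.inl ⟨hb, γ, a, b, hγ, h, hp⟩
    · exact Or.inr ⟨hb, γ, a, b, hγ, h, hp⟩
  · rintro (⟨hb, γ, a, b, hγ, h, hp⟩ | ⟨hb, γ, a, b, hγ, h, hp⟩)
    · exact ⟨hb, γ, a, b, ⟨hγ, Or.inl h⟩, hp⟩
    · exact ⟨hb, γ, a, b, ⟨hγ, Or.inr h⟩, hp⟩

theorem futureShadow_subset {p : M} : FutureShadow T p ⊆ futureLightlike T :=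
  fun _ ⟨_, _, _, h, _⟩ ↦ h.left_mem

theorem neg_not_mem (hx : x ∈ futureLightlike T) : tsmul (-1) x ∉ futureLightlike T := by
  intro h
  have h1 := (mem_futureLightlike_iff.1 hx).2
  have h2 := (mem_futureLightlike_iff.1 h).2
  rw [vecOf_tsmul, map_smul] at h2
  change -1 * g.form x.1 (vecOf x) (T.field x.1 : Vec n) < 0 at h2
  linarith

theorem mem_futureShadow_iff (hc : StronglyCausal T) {p : M} (hx : x ∈ futureLightlike T) :
    x ∈ FutureShadow T p ↔ x ∈ pastSkyShadow T p := by
  rw [mem_pastSkyShadow_iff hc]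
  exact ⟨Or.inl, fun h ↦ h.resolve_right fun h ↦ neg_not_mem hx (futureShadow_subset h)⟩

theorem neg_mem_pastSkyShadow_iff (hc : StronglyCausal T) {p : M} :
    tsmul (-1) x ∈ pastSkyShadow T p ↔ x ∈ pastSkyShadow T p := by
  rw [mem_pastSkyShadow_iff hc, mem_pastSkyShadow_iff hc, tsmul_neg_neg, or_comm]

theorem intersecting_iff {ξ ξ' : TangentBundle (𝓡∂ n) M} :
    Intersecting T ξ ξ' ↔ ∃ p, ξ ∈ pastSkyShadow T p ∧ ξ' ∈ pastSkyShadow T p := by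
  constructor
  · rintro ⟨hb, hb', γ, σ, a, b, c, d, h, h', p, hp, hp'⟩
    exact ⟨p, ⟨hb, γ, a, b, h, hp⟩, hb', σ, c, d, h', hp'⟩
  · rintro ⟨p, ⟨hb, γ, a, b, h, hp⟩, hb', σ, c, d, h', hp'⟩
    exact ⟨hb, hb', γ, σ, a, b, c, d, h, h', p, hp, hp'⟩

/-- The future-directed vectors which belong, up to sign, to a set. -/
def futurePart (T : TimeOrientation g) (S : Set (TangentBundle (𝓡∂ n) M)) :
    Set (TangentBundle (𝓡∂ n) M) :=
  {x | x ∈ futureLightlike T ∧ (x ∈ S ∨ tsmul (-1) x ∈ S)}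

theorem exists_meet_of_futurePart (hc : StronglyCausal T) {S : Set (TangentBundle (𝓡∂ n) M)}
    (hS : ∀ ξ ∈ S, ∀ ξ' ∈ S, Intersecting T ξ ξ') {x x' : TangentBundle (𝓡∂ n) M}
    (hx : x ∈ futurePart T S) (hx' : x' ∈ futurePart T S) :
    ∃ p, x ∈ FutureShadow T p ∧ x' ∈ FutureShadow T p := by
  have key : ∃ p, x ∈ pastSkyShadow T p ∧ x' ∈ pastSkyShadow T p := by
    rcases hx.2 with h | h <;> rcases hx'.2 with h' | h' <;>
      obtain ⟨p, h1, h2⟩ := intersecting_iff.1 (hS _ h _ h') <;>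
      refine ⟨p, ?_, ?_⟩ <;>
      first
      | assumption
      | (rw [← neg_mem_pastSkyShadow_iff hc]; assumption)
  obtain ⟨p, h1, h2⟩ := key
  exact ⟨p, (mem_futureShadow_iff hc hx.1).2 h1, (mem_futureShadow_iff hc hx'.1).2 h2⟩

/-- A member of `S` intersects itself, so up to sign it is future-directed, and shadows are
invariant under sign. -/
theorem subset_pastSkyShadow (hc : StronglyCausal T) {S : Set (TangentBundle (𝓡∂ n) M)}
    (hS : ∀ ξ ∈ S, ∀ ξ' ∈ S, Intersecting T ξ ξ') {q : M}
    (h : ∀ x ∈ futurePart T S, x ∈ FutureShadow T q) : S ⊆ pastSkyShadow T q := by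
  intro η hη
  obtain ⟨p, hp, -⟩ := intersecting_iff.1 (hS η hη η hη)
  rw [mem_pastSkyShadow_iff hc] at hp ⊢
  rcases hp with hp | hp
  · exact Or.inl (h η ⟨futureShadow_subset hp, Or.inl hη⟩)
  · exact Or.inr (h _ ⟨futureShadow_subset hp, Or.inr (by rwa [tsmul_neg_neg])⟩)

theorem futurePart_nonempty (hc : StronglyCausal T) {S : Set (TangentBundle (𝓡∂ n) M)}
    (hS : ∀ ξ ∈ S, ∀ ξ' ∈ S, Intersecting T ξ ξ') (hne : S.Nonempty) :
    (futurePart T S).Nonempty := by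
  obtain ⟨η, hη⟩ := hne
  obtain ⟨p, hp, -⟩ := intersecting_iff.1 (hS η hη η hη)
  rw [mem_pastSkyShadow_iff hc] at hp
  rcases hp with hp | hp
  · exact ⟨η, futureShadow_subset hp, Or.inl hη⟩
  · exact ⟨_, futureShadow_subset hp, Or.inr (by rwa [tsmul_neg_neg])⟩

theorem pastSkyShadow_pairwise (p : M) :
    ∀ ξ ∈ pastSkyShadow T p, ∀ ξ' ∈ pastSkyShadow T p, Intersecting T ξ ξ' :=
  fun _ h _ h' ↦ intersecting_iff.2 ⟨p, h, h'⟩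

/-- Reduces maximality to single geodesics: one that meets all geodesics of the shadow of `q` has to
pass through `q`. -/
theorem isMaximalIntersecting_of (hc : StronglyCausal T) {q : M}
    (h : ∀ x ∈ futureLightlike T, x ∈ boundaryTangent n M → ¬ IsEnd T x →
      (∀ w ∈ FutureShadow T q, ∃ p, x ∈ FutureShadow T p ∧ w ∈ FutureShadow T p) →
      ∃ y, Le T x y ∧ y.1 = q) : IsMaximalIntersecting T (pastSkyShadow T q) := by
  refine ⟨pastSkyShadow_pairwise q, fun S hS hsub ↦ subset_pastSkyShadow hc hS fun x hx ↦ ?_⟩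
  obtain ⟨p, hp, -⟩ := exists_meet_of_futurePart hc hS hx hx
  refine ⟨hp.1, hp.2.1, h x hx.1 hp.1 hp.2.1 fun w hw ↦ ?_⟩
  exact exists_meet_of_futurePart hc hS hx ⟨futureShadow_subset hw, Or.inl (hsub
    ((mem_pastSkyShadow_iff hc).2 (Or.inl hw)))⟩

variable [CompactSpace M]

/-- If `v` is not itself an extendible boundary vector, it is interior or points outward. Then it
can be followed into the past, back to the boundary. -/
theorem exists_futureShadow_le (hc : StronglyCausal T) {v : TangentBundle (𝓡∂ n) M}
    (hv : v ∈ futureLightlike T) (h : v.1 ∈ (𝓡∂ n).interior M ∨ vecOf v 0 ≠ 0) :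
    ∃ x ∈ FutureShadow T v.1, Le T x v := by
  by_cases h0 : v ∈ boundaryTangent n M ∧ ¬ IsEnd T v
  · exact ⟨v, ⟨h0.1, h0.2, v, .refl hv, rfl⟩, .refl hv⟩
  · obtain ⟨u, huv, hne⟩ : ∃ u, Le T u v ∧ u ≠ v := by
      rcases h with hi | h
      · exact exists_lt hv hc (Or.inl hi)
      · rcases mem_interior_or_boundary (n := n) v.1 with hi | hb
        · exact exists_lt hv hc (Or.inl hi)
        · refine exists_lt hv hc (Or.inr (h.lt_of_le ?_))
          by_contra! hpos
          refine h0 ⟨hb, fun hend ↦ ?_⟩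
          obtain ⟨y, hy, hne⟩ := not_isEnd hv hc (Or.inr hpos)
          exact hne (hend y hy).symm
    -- Going back from `u` instead of `v` makes `x` come strictly before `v`, so that it is not an
    -- end.
    obtain ⟨x, hxb, hxu, -⟩ := exists_last_boundary hc huv.left_mem
    refine ⟨x, ⟨hxb, fun hend ↦ ?_, v, hxu.trans huv, rfl⟩, hxu.trans huv⟩
    have h1 := hend u hxu
    have h2 := hend v (hxu.trans huv)
    exact hne (h1.trans h2.symm)

/-- The past sky shadow of an interior point is a maximal set of pairwise intersecting vectors. -/
theorem isMaximalIntersecting_pastSkyShadow (hn : 3 ≤ n) (hc : StronglyCausal T)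
    (hr : NoRefocusing g) {q : M} (hq : q ∈ (𝓡∂ n).interior M) :
    IsMaximalIntersecting T (pastSkyShadow T q) := by
  refine isMaximalIntersecting_of hc fun x hx hxb hxe hmeet ↦ ?_
  refine exists_le_of_forall_meet hn hc hr hx ?_
  rintro v hv rfl
  obtain ⟨w, hw, hwv⟩ := exists_futureShadow_le hc hv (Or.inl hq)
  obtain ⟨p, ⟨-, -, y, hxy, rfl⟩, -, -, z, hwz, hzy⟩ := hmeet w hw
  exact ⟨y, z, hxy, hwv.total_right hwz, hzy⟩

/-- The nonzero first coordinates guarantee that, even at a boundary point, these vectors belong to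
actual geodesics. -/
theorem exists_pair_not_par (hn : 3 ≤ n) (T : TimeOrientation g) (q : M) :
    ∃ v₁ ∈ futureLightlike T, ∃ v₂ ∈ futureLightlike T, v₁.1 = q ∧ v₂.1 = q ∧
      vecOf v₁ 0 ≠ 0 ∧ vecOf v₂ 0 ≠ 0 ∧ ¬ Par v₁ v₂ := by
  obtain ⟨t, e₁, e₂, h0, hX, hpar⟩ := exists_circle hn T q
  have hv : ∀ a b : ℝ, vecOf (tvec q (t + a • e₁ + b • e₂)) 0 = t 0 + a * e₁ 0 + b * e₂ 0 :=
    fun a b ↦ rfl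
  by_cases ht : t 0 = 0
  · refine ⟨_, hX 1 0 (by norm_num), _, hX (-1) 0 (by norm_num), rfl, rfl, ?_, ?_, fun h ↦ ?_⟩
    · rw [hv, ht]
      simpa using h0 ht
    · rw [hv, ht]
      simpa using h0 ht
    · have := (hpar _ _ _ _ h).1
      norm_num at this
  · have h1 : ∃ a : ℝ, a ^ 2 = 1 ∧ t 0 + a * e₁ 0 + 0 * e₂ 0 ≠ 0 := by
      by_contra! h
      have h1 := h 1 (by norm_num)
      have h2 := h (-1) (by norm_num)
      exact ht (by linarith)
    have h2 : ∃ b : ℝ, b ^ 2 = 1 ∧ t 0 + 0 * e₁ 0 + b * e₂ 0 ≠ 0 := by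
      by_contra! h
      have h1 := h 1 (by norm_num)
      have h2 := h (-1) (by norm_num)
      exact ht (by linarith)
    obtain ⟨a, ha, hane⟩ := h1
    obtain ⟨b, hb, hbne⟩ := h2
    refine ⟨_, hX a 0 (by simp [ha]), _, hX 0 b (by simp [hb]), rfl, rfl, ?_, ?_, fun h ↦ ?_⟩
    · rwa [hv]
    · rwa [hv]
    · have := (hpar _ _ _ _ h).1
      rw [← this] at ha
      norm_num at ha


/-- A lightlike geodesic which meets two different lightlike geodesics through a point meets one of
them at this point. -/
theorem base_eq_of_meet (hc : StronglyCausal T) (hr : NoRefocusing g)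
    (hach : LightlikeGeodesicsAchronal T) {v₁ v₂ w₁ w₁' w₂ w₂' : TangentBundle (𝓡∂ n) M}
    (h₁ : Cmp T v₁ w₁') (h₂ : Cmp T v₂ w₂') (h : Cmp T w₁ w₂) (hv : v₁.1 = v₂.1)
    (hpar : ¬ Par v₁ v₂) (hw₁ : w₁.1 = w₁'.1) (hw₂ : w₂.1 = w₂'.1)
    (hN₁ : v₁.1 ≠ w₁'.1 → Clear T v₁ w₁') (hN₂ : v₂.1 ≠ w₂'.1 → Clear T v₂ w₂')
    (hN : w₁.1 ≠ w₂.1 → Clear T w₁ w₂) : w₁.1 = v₁.1 ∨ w₂.1 = v₁.1 := by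
  by_contra! hne
  obtain ⟨n1, n2⟩ := hne
  have key : ∀ {v₁ v₂ w w₂ : TangentBundle (𝓡∂ n) M}, Cmp T v₁ w → Cmp T v₂ w₂ → v₁.1 = v₂.1 →
      w.1 = w₂.1 → v₁.1 ≠ w.1 → Par v₁ v₂ := by
    intro v₁ v₂ w w₂ h h' hv hw hne
    obtain ⟨c, hc0, h1, -⟩ := h.par_of_base hc hr h' hv hw hne
    exact ⟨c, hc0, h1⟩
  -- In each degenerate case, equal meeting points or tangent sides, the geodesics of `v₁` and `v₂`
  -- would share a second point and be proportional.
  have hww : w₁.1 ≠ w₂.1 := fun hww ↦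
    hpar (key h₁ h₂ hv (by rw [← hw₁, hww, hw₂]) (by rw [← hw₁]; exact n1.symm))
  have p1 : ¬ Par w₁' w₁ := by
    rintro ⟨c, hc0, rfl⟩
    refine hpar (Par.trans (y := tsmul c v₁) ⟨c, hc0, rfl⟩ ?_)
    exact key ((h₁.smul hc0).trans h) h₂ hv hw₂ n2.symm
  have p2 : ¬ Par w₂ w₂' := by
    intro hp
    obtain ⟨c, hc0, rfl⟩ := hp.symm
    refine hpar (Par.trans (y := tsmul c v₂) ?_ (Par.symm ⟨c, hc0, rfl⟩))
    exact key h₁ ((h₂.smul hc0).trans h.symm) hv hw₁.symm (by rw [← hw₁]; exact n1.symm)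
  refine not_triangle hach (a := v₁) (a' := v₂) (b' := w₁') (b := w₁) (c' := w₂) (c := w₂') hv hw₁
    hw₂.symm hpar (fun h ↦ p1 h.symm) (fun h ↦ p2 h.symm) h₁ h h₂.symm n1.symm
    (by rw [← hw₂]; exact hww) (by rw [← hw₂]; exact n2) (hN₁ (by rw [← hw₁]; exact n1.symm))
    (hN hww) (hN₂ ?_).symm
  rw [← hv, ← hw₂]
  exact n2.symm

theorem Le.notNormal (hno : NoLightlikeGeodesicNormalToBoundary g) (h : Le T x y)
    (hne : x ≠ y) : NotNormal g x ∧ NotNormal g y := by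
  obtain ⟨γ, s, hs, hγ, rfl, rfl⟩ := h.exists_geodesic hne
  have key : ∀ t ∈ Icc 0 s, NotNormal g (velocity γ 0 s t) := by
    intro t ht hb
    obtain ⟨w, hw, hwne⟩ := hno γ 0 s hγ.isLightlikeGeodesic t ht hb
    have h1 : chartDeriv (γ t) (γ t) w = (w : Vec n) := chartDeriv_self (γ t) w
    exact ⟨w, (congrFun (congrArg WithLp.ofLp h1) 0).symm.trans hw, hwne⟩
  exact ⟨key 0 (left_mem_Icc.2 hs.le), key s (right_mem_Icc.2 hs.le)⟩

theorem clear_of_noNormal (hno : NoLightlikeGeodesicNormalToBoundary g) (hxy : x.1 ≠ y.1) :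
    Clear T x y := by
  rintro z (⟨h1, h2⟩ | ⟨h1, h2⟩)
  · by_cases hxz : x = z
    · subst hxz
      exact (h2.notNormal hno fun h ↦ hxy (by rw [h])).1
    · exact (h1.notNormal hno hxz).2
  · by_cases hyz : y = z
    · subst hyz
      exact (h2.notNormal hno fun h ↦ hxy (by rw [h])).1
    · exact (h1.notNormal hno hyz).2

theorem exists_le_of_meet_pair (hc : StronglyCausal T) (hr : NoRefocusing g)
    (hach : LightlikeGeodesicsAchronal T) (hno : NoLightlikeGeodesicNormalToBoundary g)
    {x x₁ x₂ v₁ v₂ : TangentBundle (𝓡∂ n) M} (h₁ : Le T x₁ v₁) (h₂ : Le T x₂ v₂)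
    (hv : v₁.1 = v₂.1) (hpar : ¬ Par v₁ v₂)
    (hm₁ : ∃ p, x ∈ FutureShadow T p ∧ x₁ ∈ FutureShadow T p)
    (hm₂ : ∃ p, x ∈ FutureShadow T p ∧ x₂ ∈ FutureShadow T p) :
    ∃ y, Le T x y ∧ y.1 = v₁.1 := by
  obtain ⟨p₁, ⟨-, -, w₁, hw₁, rfl⟩, -, -, w₁', hw₁', hp₁⟩ := hm₁
  obtain ⟨p₂, ⟨-, -, w₂, hw₂, rfl⟩, -, -, w₂', hw₂', hp₂⟩ := hm₂
  rcases base_eq_of_meet hc hr hach (h₁.total_right hw₁') (h₂.total_right hw₂')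
    (hw₁.total_right hw₂) hv hpar hp₁.symm hp₂.symm (clear_of_noNormal hno)
    (clear_of_noNormal hno) (clear_of_noNormal hno) with h | h
  · exact ⟨w₁, hw₁, h⟩
  · exact ⟨w₂, hw₂, h⟩

theorem pastSkyShadow_nonempty (hn : 3 ≤ n) (hc : StronglyCausal T) (q : M) :
    (pastSkyShadow T q).Nonempty := by
  obtain ⟨v, hv, -, -, rfl, -, h0, -⟩ := exists_pair_not_par hn T q
  obtain ⟨x, hx, -⟩ := exists_futureShadow_le hc hv (Or.inr h0)
  exact ⟨x, (mem_pastSkyShadow_iff hc).2 (Or.inl hx)⟩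

/-- The maximal sets of pairwise intersecting vectors are the past sky shadows. -/
theorem isMaximalIntersecting_iff (hn : 3 ≤ n) (hc : StronglyCausal T) (hr : NoRefocusing g)
    (hach : LightlikeGeodesicsAchronal T) (hno : NoLightlikeGeodesicNormalToBoundary g)
    (S : Set (TangentBundle (𝓡∂ n) M)) :
    (S.Nonempty ∧ IsMaximalIntersecting T S) ↔ ∃ q, S = pastSkyShadow T q := by
  constructor
  · rintro ⟨hne, hmax⟩
    have hS := hmax.1
    suffices h : ∃ q, ∀ x ∈ futurePart T S, ∃ y, Le T x y ∧ y.1 = q by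
      obtain ⟨q, hq⟩ := h
      have hsub : S ⊆ pastSkyShadow T q := subset_pastSkyShadow hc hS fun x hx ↦ by
        obtain ⟨p, hp, -⟩ := exists_meet_of_futurePart hc hS hx hx
        exact ⟨hp.1, hp.2.1, hq x hx⟩
      exact ⟨q, hsub.antisymm (hmax.2 (pastSkyShadow_pairwise q) hsub)⟩
    -- If two geodesics of the set cross in different directions, all others must pass through the
    -- crossing point.
    by_cases hcase : ∃ x₁ ∈ futurePart T S, ∃ x₂ ∈ futurePart T S, ∃ v₁ v₂, Le T x₁ v₁ ∧
        Le T x₂ v₂ ∧ v₁.1 = v₂.1 ∧ ¬ Par v₁ v₂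
    · obtain ⟨x₁, hx₁, x₂, hx₂, v₁, v₂, h1, h2, hv, hpar⟩ := hcase
      exact ⟨v₁.1, fun x hx ↦ exists_le_of_meet_pair hc hr hach hno h1 h2 hv hpar
        (exists_meet_of_futurePart hc hS hx hx₁) (exists_meet_of_futurePart hc hS hx hx₂)⟩
    -- Otherwise every geodesic of the set follows, after rescaling, that of `x₀` from their meeting
    -- point on, and so reaches the same end.
    · push Not at hcase
      obtain ⟨x₀, hx₀⟩ := futurePart_nonempty hc hS hne
      obtain ⟨e, hxe, he⟩ := exists_isEnd hc hx₀.1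
      refine ⟨e.1, fun x hx ↦ ?_⟩
      obtain ⟨p, ⟨-, -, w, hw, rfl⟩, -, -, w₀, hw₀, hp⟩ := exists_meet_of_futurePart hc hS hx hx₀
      obtain ⟨c, hc0, rfl⟩ := hcase x₀ hx₀ x hx w₀ w hw₀ hw hp
      have hwe : Le T w₀ e := by
        rcases hw₀.total_right hxe with h | h
        · exact h
        · rw [he _ h]
          exact .refl hxe.right_mem
      exact ⟨tsmul c e, hw.trans (hwe.smul hc0), rfl⟩
  · rintro ⟨q, rfl⟩
    refine ⟨pastSkyShadow_nonempty hn hc q, isMaximalIntersecting_of hc fun x _ _ _ hmeet ↦ ?_⟩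
    -- Two transverse directions at `q` already force a geodesic meeting the whole shadow to pass
    -- through `q`; this also works at boundary points.
    obtain ⟨v₁, hv₁, v₂, hv₂, rfl, hq₂, h01, h02, hpar⟩ := exists_pair_not_par hn T q
    obtain ⟨x₁, hx₁, h1⟩ := exists_futureShadow_le hc hv₁ (Or.inr h01)
    obtain ⟨x₂, hx₂, h2⟩ := exists_futureShadow_le hc hv₂ (Or.inr h02)
    exact exists_le_of_meet_pair hc hr hach hno h1 h2 hq₂.symm hpar (hmeet _ hx₁)
      (hmeet _ (by rwa [hq₂] at hx₂))

end Shadows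

/-! ### Scattering data in terms of vectors, and chords -/

section Data

variable {n : ℕ} [NeZero n]
  {M : Type*} [TopologicalSpace M] [ChartedSpace (EuclideanHalfSpace n) M]
  [IsManifold (𝓡∂ n) ∞ M] {g : LorentzMetric n M} {T : TimeOrientation g}
  [T2Space M] {x y : TangentBundle (𝓡∂ n) M}

/-- Without closed causal curves, a geodesic is nondegenerate exactly when its end vectors differ.
-/
theorem mem_unbrokenData_iff (hc : StronglyCausal T) :
    (x, y) ∈ unbrokenData T ↔
      x ∈ boundaryTangent n M ∧ y ∈ boundaryTangent n M ∧ Le T x y ∧ x ≠ y := by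
  constructor
  · rintro ⟨hx, hy, γ, a, b, hγ, h1, h2⟩
    obtain rfl : velocity γ a b a = x := h1
    obtain rfl : velocity γ a b b = y := h2
    have hab : a < b := hγ.1.1
    have h1 := flow_of_geodesic hγ le_rfl hab.le le_rfl
    refine ⟨hx, hy, ⟨_, h1⟩, fun h ↦ ?_⟩
    have h2 := h1.smoothReach (sub_pos.2 hab)
    rw [← h] at h2
    exact hc.not_transGen _ (.single h2)
  · rintro ⟨hx, hy, hxy, hne⟩
    obtain ⟨γ, s, hs, hγ, h0, h1⟩ := hxy.exists_geodesic hne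
    exact ⟨hx, hy, γ, 0, s, hγ, h0, h1⟩

theorem exists_of_mem_brokenData (h : (x, y) ∈ brokenData T) :
    ∃ u u', Le T x u ∧ Le T u' y ∧ u.1 = u'.1 := by
  obtain ⟨-, -, γ, σ, a, b, c, d, hγ, h1, hσ, h2, p, ⟨t, ht, rfl⟩, r, hr, hp⟩ := h
  obtain rfl : velocity γ a b a = x := h1
  obtain rfl : velocity σ c d d = y := h2
  exact ⟨velocity γ a b t, velocity σ c d r, le_of_geodesic hγ le_rfl ht.1 ht.2,
    le_of_geodesic hσ hr.1 hr.2 le_rfl, hp.symm⟩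

theorem mem_brokenData {u u' : TangentBundle (𝓡∂ n) M} (hx : x ∈ boundaryTangent n M)
    (hy : y ∈ boundaryTangent n M) (h : Le T x u) (h' : Le T u' y) (hu : u.1 = u'.1)
    (hne : x ≠ u) (hne' : u' ≠ y) : (x, y) ∈ brokenData T := by
  obtain ⟨γ, s, hs, hγ, h0, h1⟩ := h.exists_geodesic hne
  obtain ⟨σ, t, ht, hσ, h2, h3⟩ := h'.exists_geodesic hne'
  refine ⟨hx, hy, γ, σ, 0, s, 0, t, hγ, h0, hσ, h3, u.1, ⟨s, right_mem_Icc.2 hs.le, ?_⟩,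
    0, left_mem_Icc.2 ht.le, ?_⟩
  · rw [← h1]; rfl
  · rw [hu, ← h2]; rfl

/-- The first boundary vectors before and after a vector on its lightlike geodesic. -/
structure IsChord (T : TimeOrientation g) (v x y : TangentBundle (𝓡∂ n) M) : Prop where
  left_mem : x ∈ boundaryTangent n M
  right_mem : y ∈ boundaryTangent n M
  le_left : Le T x v
  le_right : Le T v y
  le_of_le : ∀ z ∈ boundaryTangent n M, Le T z v → Le T z x
  le_of_ge : ∀ z ∈ boundaryTangent n M, Le T v z → Le T y z

theorem exists_isChord [CompactSpace M] (hc : StronglyCausal T) {v : TangentBundle (𝓡∂ n) M}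
    (hv : v ∈ futureLightlike T) : ∃ x y, IsChord T v x y := by
  obtain ⟨x, hx, h1, h2⟩ := exists_last_boundary hc hv
  obtain ⟨y, hy, h3, h4⟩ := exists_first_boundary hc hv
  exact ⟨x, y, hx, hy, h1, h3, h2, h4⟩

/-- Successive boundary vectors on a lightlike geodesic. -/
def Adjacent (T : TimeOrientation g) (x y : TangentBundle (𝓡∂ n) M) : Prop :=
  ∀ z ∈ boundaryTangent n M, Le T x z → Le T z y → z = x ∨ z = y

theorem IsChord.adjacent {v : TangentBundle (𝓡∂ n) M} (hc : StronglyCausal T)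
    (h : IsChord T v x y) : Adjacent T x y := by
  intro z hz hxz hzy
  rcases hxz.total_right h.le_left with h1 | h1
  · exact Or.inl ((h.le_of_le z hz h1).antisymm hc hxz)
  · exact Or.inr (hzy.antisymm hc (h.le_of_ge z hz h1))

/-- A boundary vector between `u` and `w` would be `x` or `y`, and antisymmetry would make `u` or
`w` a boundary vector. So the condition is void. -/
theorem Adjacent.clear (hc : StronglyCausal T) (h : Adjacent T x y)
    {u w : TangentBundle (𝓡∂ n) M} (hu : Le T x u) (hu' : Le T u y) (hw : Le T x w)
    (hw' : Le T w y) (hx : x ∈ boundaryTangent n M) (hy : y ∈ boundaryTangent n M)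
    (hui : u.1 ∈ (𝓡∂ n).interior M) (hwi : w.1 ∈ (𝓡∂ n).interior M) : Clear T u w := by
  have key : ∀ {u w : TangentBundle (𝓡∂ n) M}, Le T x u → Le T w y →
      u.1 ∈ (𝓡∂ n).interior M → w.1 ∈ (𝓡∂ n).interior M → ∀ z, Le T u z → Le T z w →
      NotNormal g z := by
    intro u w hu hw hui hwi z h1 h2 hz
    rcases h z hz (hu.trans h1) (h2.trans hw) with h3 | h3
    · rw [h3] at h1
      rw [← hu.antisymm hc h1] at hui
      exact (not_mem_boundary hui hx).elim
    · rw [h3] at h2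
      rw [hw.antisymm hc h2] at hwi
      exact (not_mem_boundary hwi hy).elim
  rintro z (⟨h1, h2⟩ | ⟨h1, h2⟩)
  · exact key hu hw' hui hwi z h1 h2
  · exact key hw hu' hwi hui z h1 h2

end Data

/-! ### Transport of chords and shadows by an identification of the data -/

section Compare

variable {n : ℕ} [NeZero n]
  {M₁ : Type*} [TopologicalSpace M₁] [ChartedSpace (EuclideanHalfSpace n) M₁]
  [IsManifold (𝓡∂ n) ∞ M₁] {g₁ : LorentzMetric n M₁} {T₁ : TimeOrientation g₁}
  {M₂ : Type*} [TopologicalSpace M₂] [ChartedSpace (EuclideanHalfSpace n) M₂]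
  [IsManifold (𝓡∂ n) ∞ M₂] {g₂ : LorentzMetric n M₂} {T₂ : TimeOrientation g₂}
  {e : PartialEquiv (TangentBundle (𝓡∂ n) M₁) (TangentBundle (𝓡∂ n) M₂)}

/-- An identification of the vectors at the boundaries which is compatible with base points and
with scalar multiplication and which identifies the scattering data. -/
structure DataIso (T₁ : TimeOrientation g₁) (T₂ : TimeOrientation g₂)
    (e : PartialEquiv (TangentBundle (𝓡∂ n) M₁) (TangentBundle (𝓡∂ n) M₂)) : Prop where
  source_eq : e.source = boundaryTangent n M₁
  target_eq : e.target = boundaryTangent n M₂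
  base_iff : ∀ x ∈ boundaryTangent n M₁, ∀ y ∈ boundaryTangent n M₁,
    ((e x).1 = (e y).1 ↔ x.1 = y.1)
  map_smul : ∀ x ∈ boundaryTangent n M₁, ∀ c : ℝ, e (tsmul c x) = tsmul c (e x)
  unbroken_iff : ∀ x ∈ boundaryTangent n M₁, ∀ y ∈ boundaryTangent n M₁,
    ((e x, e y) ∈ unbrokenData T₂ ↔ (x, y) ∈ unbrokenData T₁)
  broken_iff : ∀ x ∈ boundaryTangent n M₁, ∀ y ∈ boundaryTangent n M₁,
    ((e x, e y) ∈ brokenData T₂ ↔ (x, y) ∈ brokenData T₁)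

theorem DataIso.mem (h : DataIso T₁ T₂ e) {x : TangentBundle (𝓡∂ n) M₁}
    (hx : x ∈ boundaryTangent n M₁) : e x ∈ boundaryTangent n M₂ :=
  h.target_eq ▸ e.map_source (h.source_eq ▸ hx)

theorem DataIso.mem_symm (h : DataIso T₁ T₂ e) {x : TangentBundle (𝓡∂ n) M₂}
    (hx : x ∈ boundaryTangent n M₂) : e.symm x ∈ boundaryTangent n M₁ :=
  h.source_eq ▸ e.map_target (h.target_eq ▸ hx)

theorem DataIso.left_inv (h : DataIso T₁ T₂ e) {x : TangentBundle (𝓡∂ n) M₁}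
    (hx : x ∈ boundaryTangent n M₁) : e.symm (e x) = x :=
  e.left_inv (h.source_eq ▸ hx)

theorem DataIso.right_inv (h : DataIso T₁ T₂ e) {x : TangentBundle (𝓡∂ n) M₂}
    (hx : x ∈ boundaryTangent n M₂) : e (e.symm x) = x :=
  e.right_inv (h.target_eq ▸ hx)

theorem DataIso.symm (h : DataIso T₁ T₂ e) : DataIso T₂ T₁ e.symm where
  source_eq := h.target_eq
  target_eq := h.source_eq
  base_iff x hx y hy := by
    rw [← h.base_iff _ (h.mem_symm hx) _ (h.mem_symm hy), h.right_inv hx, h.right_inv hy]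
  map_smul x hx c := by
    have h1 : tsmul c (e.symm x) ∈ boundaryTangent n M₁ := h.mem_symm hx
    rw [← h.left_inv h1, h.map_smul _ (h.mem_symm hx), h.right_inv hx]
  unbroken_iff x hx y hy := by
    rw [← h.unbroken_iff _ (h.mem_symm hx) _ (h.mem_symm hy), h.right_inv hx, h.right_inv hy]
  broken_iff x hx y hy := by
    rw [← h.broken_iff _ (h.mem_symm hx) _ (h.mem_symm hy), h.right_inv hx, h.right_inv hy]

theorem DataIso.injective (h : DataIso T₁ T₂ e) {x y : TangentBundle (𝓡∂ n) M₁}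
    (hx : x ∈ boundaryTangent n M₁) (hy : y ∈ boundaryTangent n M₁) (hxy : e x = e y) : x = y := by
  rw [← h.left_inv hx, hxy, h.left_inv hy]

variable [T2Space M₁] [T2Space M₂]

theorem DataIso.map_le (h : DataIso T₁ T₂ e) (hc₁ : StronglyCausal T₁) (hc₂ : StronglyCausal T₂)
    {x y : TangentBundle (𝓡∂ n) M₁} (hx : x ∈ boundaryTangent n M₁)
    (hy : y ∈ boundaryTangent n M₁) (hxy : Le T₁ x y) (hne : x ≠ y) :
    Le T₂ (e x) (e y) :=
  ((mem_unbrokenData_iff hc₂).1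
    ((h.unbroken_iff x hx y hy).2 ((mem_unbrokenData_iff hc₁).2 ⟨hx, hy, hxy, hne⟩))).2.2.1

theorem DataIso.of_map_le (h : DataIso T₁ T₂ e) (hc₁ : StronglyCausal T₁)
    (hc₂ : StronglyCausal T₂) {x y : TangentBundle (𝓡∂ n) M₁} (hx : x ∈ boundaryTangent n M₁)
    (hy : y ∈ boundaryTangent n M₁) (hxy : Le T₂ (e x) (e y)) (hne : x ≠ y) : Le T₁ x y := by
  have := h.symm.map_le hc₂ hc₁ (h.mem hx) (h.mem hy) hxy
    (fun hxy ↦ hne (h.injective hx hy hxy))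
  rwa [h.left_inv hx, h.left_inv hy] at this

theorem DataIso.of_map_cmp (h : DataIso T₁ T₂ e) (hc₁ : StronglyCausal T₁)
    (hc₂ : StronglyCausal T₂) {x y : TangentBundle (𝓡∂ n) M₁} (hx : x ∈ boundaryTangent n M₁)
    (hy : y ∈ boundaryTangent n M₁) (hX : x ∈ futureLightlike T₁) (hxy : Cmp T₂ (e x) (e y)) :
    Cmp T₁ x y := by
  by_cases hne : x = y
  · subst hne
    exact Or.inl (.refl hX)
  · exact hxy.imp (fun hxy ↦ h.of_map_le hc₁ hc₂ hx hy hxy hne)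
      (fun hxy ↦ h.of_map_le hc₁ hc₂ hy hx hxy (Ne.symm hne))

/-- Adjacency only involves the order among boundary vectors, which is determined by the unbroken
data. -/
theorem DataIso.map_adjacent (h : DataIso T₁ T₂ e) (hc₁ : StronglyCausal T₁)
    (hc₂ : StronglyCausal T₂) {x y : TangentBundle (𝓡∂ n) M₁} (hx : x ∈ boundaryTangent n M₁)
    (hy : y ∈ boundaryTangent n M₁) (hxy : Adjacent T₁ x y) : Adjacent T₂ (e x) (e y) := by
  intro z hz h1 h2
  by_contra! hne
  rw [← h.right_inv hz] at h1 h2 hne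
  have n1 : x ≠ e.symm z := fun h ↦ hne.1 (by rw [← h])
  have n2 : e.symm z ≠ y := fun h ↦ hne.2 (by rw [← h])
  rcases hxy _ (h.mem_symm hz) (h.of_map_le hc₁ hc₂ hx (h.mem_symm hz) h1 n1)
    (h.of_map_le hc₁ hc₂ (h.mem_symm hz) hy h2 n2) with h3 | h3
  · exact n1 h3.symm
  · exact n2 h3

/-- If the images were on one geodesic, so would be the original vectors, hence a multiple of `v`
and `w`; having the same base point, these would be equal. -/
theorem DataIso.not_cmp (h : DataIso T₁ T₂ e) (hc₁ : StronglyCausal T₁) (hc₂ : StronglyCausal T₂)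
    {v w x x' : TangentBundle (𝓡∂ n) M₁} (hvw : v.1 = w.1) (hpar : ¬ Par v w) (hxv : Le T₁ x v)
    (hxw : Le T₁ x' w) (hx : x ∈ boundaryTangent n M₁) (hx' : x' ∈ boundaryTangent n M₁)
    {c : ℝ} (hc : 0 < c) : ¬ Cmp T₂ (tsmul c (e x)) (e x') := by
  intro hcmp
  rw [← h.map_smul x hx] at hcmp
  have h1 := h.of_map_cmp hc₁ hc₂ (x := tsmul c x) hx hx'
    (tsmul_mem_futureLightlike hc hxv.left_mem) hcmp
  have h2 : Cmp T₁ (tsmul c v) w := ((hxv.smul hc).cmp'.trans h1).trans hxw.cmp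
  exact hpar ⟨c, hc, (h2.eq_of_base hc₁ hvw).symm⟩

/-- The images of two different lightlike geodesics through an interior point meet. -/
theorem DataIso.exists_meet (h : DataIso T₁ T₂ e) (hc₁ : StronglyCausal T₁)
    (hc₂ : StronglyCausal T₂) (hr₁ : NoRefocusing g₁) (hr₂ : NoRefocusing g₂)
    {v w x y x' y' : TangentBundle (𝓡∂ n) M₁} (hvw : v.1 = w.1)
    (hq : v.1 ∈ (𝓡∂ n).interior M₁) (hpar : ¬ Par v w) (hv : IsChord T₁ v x y)
    (hw : IsChord T₁ w x' y') :
    ∃ u u', u.1 = u'.1 ∧ u.1 ∈ (𝓡∂ n).interior M₂ ∧ ¬ Par u u' ∧ Le T₂ (e x) u ∧ Le T₂ u (e y) ∧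
      Le T₂ (e x') u' ∧ Le T₂ u' (e y') := by
  have hqw : w.1 ∈ (𝓡∂ n).interior M₁ := hvw ▸ hq
  have hne : ∀ {z v : TangentBundle (𝓡∂ n) M₁}, z ∈ boundaryTangent n M₁ →
      v.1 ∈ (𝓡∂ n).interior M₁ → z ≠ v := by
    rintro z v hz hv rfl
    exact not_mem_boundary hv hz
  have hxy : Le T₂ (e x) (e y) := h.map_le hc₁ hc₂ hv.left_mem hv.right_mem
    (hv.le_left.trans hv.le_right) fun hxy ↦ hne hv.left_mem hq
      (hv.le_left.antisymm hc₁ (hxy ▸ hv.le_right))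
  have hxy' : Le T₂ (e x') (e y') := h.map_le hc₁ hc₂ hw.left_mem hw.right_mem
    (hw.le_left.trans hw.le_right) fun hxy ↦ hne hw.left_mem hqw
      (hw.le_left.antisymm hc₁ (hxy ▸ hw.le_right))
  -- At the common point one can switch from either chord to the other. Both switches are recorded
  -- by the broken data.
  have b1 : (e x, e y') ∈ brokenData T₂ := (h.broken_iff _ hv.left_mem _ hw.right_mem).2
    (mem_brokenData hv.left_mem hw.right_mem hv.le_left hw.le_right hvw (hne hv.left_mem hq)
      (hne hw.right_mem hqw).symm)
  have b2 : (e x', e y) ∈ brokenData T₂ := (h.broken_iff _ hw.left_mem _ hv.right_mem).2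
    (mem_brokenData hw.left_mem hv.right_mem hw.le_left hv.le_right hvw.symm (hne hw.left_mem hqw)
      (hne hv.right_mem hq).symm)
  obtain ⟨u₁, u₁', l1, l1', hu₁⟩ := exists_of_mem_brokenData b1
  obtain ⟨u₂', u₂, l2', l2, hu₂⟩ := exists_of_mem_brokenData b2
  have hnp : ∀ {u u' : TangentBundle (𝓡∂ n) M₂}, Cmp T₂ (e x) u → Cmp T₂ u' (e x') →
      ¬ Par u u' := by
    rintro u u' h1 h2 ⟨c, hc0, rfl⟩
    exact h.not_cmp hc₁ hc₂ hvw hpar hv.le_left hw.le_left hv.left_mem hw.left_mem hc0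
      ((h1.smul hc0).trans h2)
  have cu₁' : Cmp T₂ u₁' (e x') := l1'.cmp.trans hxy'.cmp'
  have cu₂ : Cmp T₂ (e x) u₂ := hxy.cmp.trans l2.cmp'
  -- Both switches happen where the two image geodesics meet; two different meeting points would
  -- make these geodesics agree.
  have hbase : u₁.1 = u₂.1 := by
    by_contra hne'
    obtain ⟨c, hc0, h1, -⟩ := (l1.cmp'.trans cu₂).par_of_base hc₂ hr₂ (cu₁'.trans l2'.cmp) hu₁
      hu₂.symm hne'
    exact hnp l1.cmp cu₁' ⟨c, hc0, h1⟩
  have e1 : u₁ = u₂ := (l1.cmp'.trans cu₂).eq_of_base hc₂ hbase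
  have e2 : u₁' = u₂' := (cu₁'.trans l2'.cmp).eq_of_base hc₂ (by rw [← hu₁, hbase, hu₂])
  subst e1 e2
  refine ⟨u₁, u₁', hu₁, ?_, hnp l1.cmp cu₁', l1, l2, l2', l1'⟩
  -- By adjacency, a meeting point at the boundary would be an end of both image chords. The
  -- original chords would then share a boundary point in addition to the base point of `v`.
  refine (mem_interior_or_boundary u₁.1).resolve_right fun hb ↦ ?_
  have hno : ∀ {z z' : TangentBundle (𝓡∂ n) M₁}, z ∈ boundaryTangent n M₁ →
      z' ∈ boundaryTangent n M₁ → Cmp T₁ v z → Cmp T₁ w z' → (e z).1 ≠ (e z').1 := by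
    intro z z' hz hz' h1 h2 heq
    rw [h.base_iff z hz z' hz'] at heq
    obtain ⟨c, hc0, h3, -⟩ := h1.par_of_base hc₁ hr₁ h2 hvw heq
      (fun h ↦ not_mem_boundary hq (h ▸ hz))
    exact hpar ⟨c, hc0, h3⟩
  have a1 := h.map_adjacent hc₁ hc₂ hv.left_mem hv.right_mem (hv.adjacent hc₁) u₁ hb l1 l2
  have a2 := h.map_adjacent hc₁ hc₂ hw.left_mem hw.right_mem (hw.adjacent hc₁) u₁'
    (by rw [hu₁] at hb; exact hb) l2' l1'
  rcases a1 with a1 | a1 <;> rcases a2 with a2 | a2 <;> rw [a1, a2] at hu₁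
  · exact hno hv.left_mem hw.left_mem hv.le_left.cmp' hw.le_left.cmp' hu₁
  · exact hno hv.left_mem hw.right_mem hv.le_left.cmp' hw.le_right.cmp hu₁
  · exact hno hv.right_mem hw.left_mem hv.le_right.cmp hw.le_left.cmp' hu₁
  · exact hno hv.right_mem hw.right_mem hv.le_right.cmp hw.le_right.cmp hu₁

variable [CompactSpace M₁] [CompactSpace M₂]

/-- The images of the lightlike geodesics through an interior point have a common point. -/
theorem DataIso.exists_common_point (h : DataIso T₁ T₂ e) (hn : 3 ≤ n) (hc₁ : StronglyCausal T₁)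
    (hc₂ : StronglyCausal T₂) (hr₁ : NoRefocusing g₁) (hr₂ : NoRefocusing g₂)
    (hach₂ : LightlikeGeodesicsAchronal T₂) {q : M₁} (hq : q ∈ (𝓡∂ n).interior M₁) :
    ∃ p ∈ (𝓡∂ n).interior M₂, ∀ v ∈ futureLightlike T₁, v.1 = q →
      ∃ c : ℝ, 0 < c ∧ ∃ x y u, IsChord T₁ (tsmul c v) x y ∧ Le T₂ (e x) u ∧ u.1 = p := by
  -- Two directions determine the candidate for `p`. The image of any third chord meets both image
  -- chords, hence contains `p`, for otherwise there would be a triangle.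
  obtain ⟨v₁, hv₁, v₂, hv₂, hq₁, hq₂, -, -, hpar⟩ := exists_pair_not_par hn T₁ q
  obtain ⟨x₁, y₁, c₁⟩ := exists_isChord hc₁ hv₁
  obtain ⟨x₂, y₂, c₂⟩ := exists_isChord hc₁ hv₂
  obtain ⟨u₁, u₂, hu, hui, hupar, a1, a1', a2, a2'⟩ := h.exists_meet hc₁ hc₂ hr₁ hr₂
    (hq₁.trans hq₂.symm) (hq₁ ▸ hq) hpar c₁ c₂
  refine ⟨u₁.1, hui, fun v hv hvq ↦ ?_⟩
  by_cases p1 : Par v v₁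
  · obtain ⟨c, hc0, rfl⟩ := p1
    exact ⟨c, hc0, x₁, y₁, u₁, c₁, a1, rfl⟩
  by_cases p2 : Par v v₂
  · obtain ⟨c, hc0, rfl⟩ := p2
    exact ⟨c, hc0, x₂, y₂, u₂, c₂, a2, hu.symm⟩
  obtain ⟨x, y, cv⟩ := exists_isChord hc₁ hv
  obtain ⟨w₁, w₁', hw₁, hwi₁, -, b1, b1', b2, b2'⟩ := h.exists_meet hc₁ hc₂ hr₁ hr₂
    (hvq.trans hq₁.symm) (hvq ▸ hq) p1 cv c₁
  obtain ⟨w₂, w₂', hw₂, hwi₂, -, d1, d1', d2, d2'⟩ := h.exists_meet hc₁ hc₂ hr₁ hr₂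
    (hvq.trans hq₂.symm) (hvq ▸ hq) p2 cv c₂
  -- The sides of this triangle are inside image chords, away from the boundary, so geodesics normal
  -- to the boundary do no harm.
  have clear : ∀ {v x y u w}, IsChord T₁ v x y → Le T₂ (e x) u → Le T₂ u (e y) →
      Le T₂ (e x) w → Le T₂ w (e y) → u.1 ∈ (𝓡∂ n).interior M₂ →
      w.1 ∈ (𝓡∂ n).interior M₂ → Clear T₂ u w := fun cv l1 l2 l3 l4 i1 i2 ↦
    (h.map_adjacent hc₁ hc₂ cv.left_mem cv.right_mem (cv.adjacent hc₁)).clear hc₂ l1 l2 l3 l4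
      (h.mem cv.left_mem) (h.mem cv.right_mem) i1 i2
  rw [← hvq] at hq
  refine ⟨1, one_pos, x, y, ?_⟩
  rw [tsmul_one]
  rcases base_eq_of_meet hc₂ hr₂ hach₂ (a1.total_right b2) (a2.total_right d2)
    (b1.total_right d1) hu hupar hw₁ hw₂
    (fun _ ↦ clear c₁ a1 a1' b2 b2' hui (hw₁ ▸ hwi₁))
    (fun _ ↦ clear c₂ a2 a2' d2 d2' (hu ▸ hui) (hw₂ ▸ hwi₂))
    (fun _ ↦ clear cv b1 b1' d1 d1' hwi₁ hwi₂) with h1 | h1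
  · exact ⟨w₁, cv, b1, h1⟩
  · exact ⟨w₂, cv, d1, h1⟩

/-- A shadow vector may lie before the chord, with further boundary points in between; the unbroken
data connect its image to the image of the chord. -/
theorem DataIso.exists_image_subset (h : DataIso T₁ T₂ e) (hn : 3 ≤ n) (hc₁ : StronglyCausal T₁)
    (hc₂ : StronglyCausal T₂) (hr₁ : NoRefocusing g₁) (hr₂ : NoRefocusing g₂)
    (hach₂ : LightlikeGeodesicsAchronal T₂) {q : M₁} (hq : q ∈ (𝓡∂ n).interior M₁) :
    ∃ p ∈ (𝓡∂ n).interior M₂, e '' pastSkyShadow T₁ q ⊆ pastSkyShadow T₂ p := by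
  obtain ⟨p, hp, hall⟩ := h.exists_common_point hn hc₁ hc₂ hr₁ hr₂ hach₂ hq
  have key : ∀ x ∈ FutureShadow T₁ q, e x ∈ FutureShadow T₂ p := by
    rintro x ⟨hx, -, v, hxv, hvq⟩
    obtain ⟨c, hc0, x', y', u, hch, hu, rfl⟩ := hall v hxv.right_mem hvq
    have hle : Le T₂ (tsmul c (e x)) u := by
      rw [← h.map_smul x hx]
      have hxx' : Le T₁ (tsmul c x) x' := hch.le_of_le (tsmul c x) hx (hxv.smul hc0)
      by_cases heq : tsmul c x = x'
      · rwa [heq]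
      · exact (h.map_le hc₁ hc₂ (x := tsmul c x) hx hch.left_mem hxx' heq).trans hu
    have hle' := hle.smul (inv_pos.2 hc0)
    rw [tsmul_tsmul, inv_mul_cancel₀ hc0.ne', tsmul_one] at hle'
    refine ⟨h.mem hx, fun hend ↦ ?_, _, hle', rfl⟩
    have h1 := congrArg (·.1) (hend _ hle')
    exact not_mem_boundary hp (by change u.1 = (e x).1 at h1; rw [h1]; exact h.mem hx)
  refine ⟨p, hp, ?_⟩
  rintro _ ⟨η, hη, rfl⟩
  have hηb : η ∈ boundaryTangent n M₁ := hη.1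
  rw [mem_pastSkyShadow_iff hc₁] at hη
  rw [mem_pastSkyShadow_iff hc₂, ← h.map_smul η hηb]
  exact hη.imp (key η) (key _)

/-- Mapping forth and back shows that the shadow of `q` is contained in that of some `q'`. By
maximality the two shadows are equal, and so are the sets in between. -/
theorem DataIso.exists_image_eq (h : DataIso T₁ T₂ e) (hn : 3 ≤ n) (hc₁ : StronglyCausal T₁)
    (hc₂ : StronglyCausal T₂) (hr₁ : NoRefocusing g₁) (hr₂ : NoRefocusing g₂)
    (hach₁ : LightlikeGeodesicsAchronal T₁) (hach₂ : LightlikeGeodesicsAchronal T₂) {q : M₁}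
    (hq : q ∈ (𝓡∂ n).interior M₁) :
    ∃ p ∈ (𝓡∂ n).interior M₂, e '' pastSkyShadow T₁ q = pastSkyShadow T₂ p := by
  obtain ⟨p, hp, h1⟩ := h.exists_image_subset hn hc₁ hc₂ hr₁ hr₂ hach₂ hq
  obtain ⟨q', hq', h2⟩ := h.symm.exists_image_subset hn hc₂ hc₁ hr₂ hr₁ hach₁ hp
  have h3 : pastSkyShadow T₁ q ⊆ pastSkyShadow T₁ q' := fun η hη ↦
    h2 ⟨e η, h1 ⟨η, hη, rfl⟩, h.left_inv hη.1⟩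
  have h4 := (isMaximalIntersecting_pastSkyShadow hn hc₁ hr₁ hq).2 (pastSkyShadow_pairwise q') h3
  refine ⟨p, hp, h1.antisymm fun η hη ↦ ?_⟩
  exact ⟨e.symm η, h4 (h2 ⟨η, hη, rfl⟩), h.right_inv hη.1⟩

theorem DataIso.image_shadowData (h : DataIso T₁ T₂ e) (hn : 3 ≤ n) (hc₁ : StronglyCausal T₁)
    (hc₂ : StronglyCausal T₂) (hr₁ : NoRefocusing g₁) (hr₂ : NoRefocusing g₂)
    (hach₁ : LightlikeGeodesicsAchronal T₁) (hach₂ : LightlikeGeodesicsAchronal T₂) :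
    (fun S ↦ e '' S) '' pastSkyShadowData T₁ = pastSkyShadowData T₂ := by
  ext S
  constructor
  · rintro ⟨_, ⟨q, hq, rfl⟩, rfl⟩
    obtain ⟨p, hp, heq⟩ := h.exists_image_eq hn hc₁ hc₂ hr₁ hr₂ hach₁ hach₂ hq
    exact ⟨p, hp, heq.symm⟩
  · rintro ⟨p, hp, rfl⟩
    obtain ⟨q, hq, heq⟩ := h.symm.exists_image_eq hn hc₂ hc₁ hr₂ hr₁ hach₂ hach₁ hp
    refine ⟨_, ⟨q, hq, rfl⟩, ?_⟩
    change e '' pastSkyShadow T₁ q = _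
    rw [← heq, image_image]
    ext η
    constructor
    · rintro ⟨ζ, hζ, rfl⟩
      change e (e.symm ζ) ∈ _
      rw [h.right_inv hζ.1]
      exact hζ
    · exact fun hη ↦ ⟨η, hη, h.right_inv hη.1⟩

end Compare

/-! ### From conformal boundary isomorphisms to identifications of data -/

section Conformal

variable {n : ℕ} [NeZero n]
  {M₁ : Type*} [TopologicalSpace M₁] [ChartedSpace (EuclideanHalfSpace n) M₁]
  [IsManifold (𝓡∂ n) ∞ M₁] {g₁ : LorentzMetric n M₁} {T₁ : TimeOrientation g₁}
  {M₂ : Type*} [TopologicalSpace M₂] [ChartedSpace (EuclideanHalfSpace n) M₂]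
  [IsManifold (𝓡∂ n) ∞ M₂] {g₂ : LorentzMetric n M₂} {T₂ : TimeOrientation g₂}

theorem ConformalBoundaryIso.map_tsmul (Φ : ConformalBoundaryIso g₁ g₂)
    {x : TangentBundle (𝓡∂ n) M₁} (hx : x ∈ boundaryTangent n M₁) (c : ℝ) :
    Φ.toPartialEquiv (tsmul c x) = tsmul c (Φ.toPartialEquiv x) := by
  rw [Φ.map_eq x hx, Φ.map_eq (tsmul c x) hx]
  exact congrArg (tvec (Φ.base x.1)) (map_smul (Φ.fiber x.1) c x.2)

theorem ConformalBoundaryIso.base_iff (Φ : ConformalBoundaryIso g₁ g₂)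
    {x y : TangentBundle (𝓡∂ n) M₁} (hx : x ∈ boundaryTangent n M₁)
    (hy : y ∈ boundaryTangent n M₁) :
    (Φ.toPartialEquiv x).1 = (Φ.toPartialEquiv y).1 ↔ x.1 = y.1 := by
  constructor
  · intro h
    -- Zero vectors stand for their base points, so injectivity on vectors gives injectivity on
    -- boundary points.
    have h0 : Φ.toPartialEquiv (tsmul 0 x) = Φ.toPartialEquiv (tsmul 0 y) := by
      rw [Φ.map_tsmul hx, Φ.map_tsmul hy]
      simp only [tsmul, zero_smul, h]
    have h1 := Φ.toPartialEquiv.injOn (Φ.source_eq ▸ hx) (Φ.source_eq ▸ hy) h0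
    exact congrArg (·.1) h1
  · intro h
    rw [Φ.map_eq x hx, Φ.map_eq y hy]
    exact congrArg Φ.base h

theorem ConformalBoundaryIso.dataIso (Φ : ConformalBoundaryIso g₁ g₂)
    (hb : Φ.IdentifiesBroken T₁ T₂) (hu : Φ.IdentifiesUnbroken T₁ T₂) :
    DataIso T₁ T₂ Φ.toPartialEquiv where
  source_eq := Φ.source_eq
  target_eq := Φ.target_eq
  base_iff _ hx _ hy := Φ.base_iff hx hy
  map_smul _ hx c := Φ.map_tsmul hx c
  unbroken_iff x hx y hy := by
    rw [← (show _ = unbrokenData T₂ from hu)]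
    refine ⟨?_, fun h ↦ ⟨_, h, rfl⟩⟩
    rintro ⟨⟨x', y'⟩, h, heq⟩
    obtain ⟨h1, h2⟩ := Prod.mk.inj heq
    rwa [Φ.toPartialEquiv.injOn (Φ.source_eq ▸ h.1) (Φ.source_eq ▸ hx) h1,
      Φ.toPartialEquiv.injOn (Φ.source_eq ▸ h.2.1) (Φ.source_eq ▸ hy) h2] at h
  broken_iff x hx y hy := by
    rw [← (show _ = brokenData T₂ from hb)]
    refine ⟨?_, fun h ↦ ⟨_, h, rfl⟩⟩
    rintro ⟨⟨x', y'⟩, h, heq⟩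
    obtain ⟨h1, h2⟩ := Prod.mk.inj heq
    rwa [Φ.toPartialEquiv.injOn (Φ.source_eq ▸ h.1) (Φ.source_eq ▸ hx) h1,
      Φ.toPartialEquiv.injOn (Φ.source_eq ▸ h.2.1) (Φ.source_eq ▸ hy) h2] at h

end Conformal

end LightlikeScattering

end

theorem mainTheorem6 (n : ℕ) [NeZero n] (hn : 3 ≤ n)
    {M₁ : Type*} [TopologicalSpace M₁] [T2Space M₁] [CompactSpace M₁]
    [ChartedSpace (EuclideanHalfSpace n) M₁] [IsManifold (𝓡∂ n) ∞ M₁]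
    (g₁ : LorentzMetric n M₁) (T₁ : TimeOrientation g₁)
    {M₂ : Type*} [TopologicalSpace M₂] [T2Space M₂] [CompactSpace M₂]
    [ChartedSpace (EuclideanHalfSpace n) M₂] [IsManifold (𝓡∂ n) ∞ M₂]
    (g₂ : LorentzMetric n M₂) (T₂ : TimeOrientation g₂)
    (hcausal₁ : StronglyCausal T₁) (hcausal₂ : StronglyCausal T₂)
    (hrefocus₁ : NoRefocusing g₁) (hrefocus₂ : NoRefocusing g₂)
    (hachronal₁ : LightlikeGeodesicsAchronal T₁)
    (hachronal₂ : LightlikeGeodesicsAchronal T₂) :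
    -- isomorphic broken and unbroken data imply isomorphic past sky shadow data
    (∀ Φ : ConformalBoundaryIso g₁ g₂,
      Φ.IdentifiesBroken T₁ T₂ → Φ.IdentifiesUnbroken T₁ T₂ → Φ.IdentifiesShadows T₁ T₂) ∧
    -- past sky shadows of interior points are maximal pairwise intersecting sets
    (∀ q ∈ (𝓡∂ n).interior M₁, IsMaximalIntersecting T₁ (pastSkyShadow T₁ q)) ∧
    -- and the maximal sets are exactly the shadows of points of the manifold with boundary
    (NoLightlikeGeodesicNormalToBoundary g₁ → ∀ S : Set (TangentBundle (𝓡∂ n) M₁),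
      (S.Nonempty ∧ IsMaximalIntersecting T₁ S) ↔ ∃ q : M₁, S = pastSkyShadow T₁ q) := by
  exact ⟨fun Φ hb hu ↦ (Φ.dataIso hb hu).image_shadowData hn hcausal₁ hcausal₂ hrefocus₁ hrefocus₂
      hachronal₁ hachronal₂,
    fun q hq ↦ isMaximalIntersecting_pastSkyShadow hn hcausal₁ hrefocus₁ hq,
    fun hno S ↦ isMaximalIntersecting_iff hn hcausal₁ hrefocus₁ hachronal₁ hno S⟩
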